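/- **Second-order free-surface expansion of hexagonal standing waves.** Let $\omega,k_1,k_2,\tau_1,\tau_2,\beta_0>0$. For $n=(n_1,n_2)\in\mathbb Z^2$ put $p=p(n)=(k_1n_1+k_2n_2,\ \tau_1k_1n_1-\tau_2k_2n_2)$, and suppose that, for some $q\in\mathbb Z$, $q>0$, $$\Omega_{\beta_0}:=\{(n_1,n_2,m)\in\mathbb Z^2\times\mathbb Z^+:\ m(1+\omega|p|^2)-\beta_0|p|=0\}=\{(\pm1,0,q),(0,\pm1,q)\}.$$ For real $s\ge 2$ let $H^s_{\natural,e}$ (resp. $H^s_{\natural,o}$) be the space of real functions $u(x_1,x_2,t)=\sum_{n\in\mathbb Z^2,\,m\ge0}u_{nm}e^{ip\cdot x}\cos mt$ (resp. $\sum_{n\in\mathbb Z^2,\,m>0}u_{nm}e^{ip\cdot x}\sin mt$) with $\|u\|_s^2=\sum(1+|p|^2+m^2)^s|u_{nm}|^2<\infty$. Consider the Boussinesq system $$\eta_t+\beta\nabla\cdot v+\beta\nabla\cdot(\eta v)-\omega\Delta\eta_t=0,\qquad v_t+\beta\nabla\eta+\tfrac12\beta\nabla|v|^2-\omega\Delta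 v_t=0 .$$ *Coefficients.* Put $s_j=\sqrt{1+\tau_j^2}$, $\pi=k_1k_2(1-\tau_1\tau_2)$, $N_\pm=(k_1\pm k_2)^2+(k_1\tau_1\mp k_2\tau_2)^2$, $d_1=4q^2(1+\omega N_+)^2-\beta_0^2N_+$, $d_2=4q^2(1+\omega N_-)^2-\beta_0^2N_-$, $E_j=4q^2(1+4\omega k_j^2s_j^2)^2-4\beta_0^2k_j^2s_j^2$, and $$S_\pm=k_1k_2(k_1\pm k_2)(s_1\pm s_2)-k_1k_2(k_1\tau_1\mp k_2\tau_2)(\tau_2s_1\mp\tau_1s_2).$$ Define $$a_1=-\frac{\beta_0k_1^4s_1^4+2qk_1^3s_1^3(1+4\omega k_1^2s_1^2)}{E_1},\quad a_2=\frac{2\beta_0k_1^4s_1^3+qk_1^3s_1^2(1+4\omega k_1^2s_1^2)}{E_1},$$ $$a_3=-\frac{\beta_0k_2^4s_2^4+2qk_2^3s_2^3(1+4\omega k_2^2s_2^2)}{E_2},\quad a_4=\frac{2\beta_0k_2^4s_2^3+qk_2^3s_2^2(1+4\omega k_2^2s_2^2)}{E_2},$$ $$b_1=\frac{-2q(1+\omega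 N_+)S_+-\beta_0\pi N_+}{2d_1},\quad b_4=\frac{2q(1+\omega N_-)S_-+\beta_0\pi N_-}{2d_2},$$ $$(b_2,b_3)=(k_1+k_2,\ k_1\tau_1-k_2\tau_2)\,\frac{2q\pi(1+\omega N_+)+\beta_0S_+}{2d_1},$$ $$(b_5,b_6)=-(k_1-k_2,\ k_1\tau_1+k_2\tau_2)\,\frac{2q\pi(1+\omega N_-)+\beta_0S_-}{2d_2},$$ $$l_1=\tfrac14k_1^4s_1^4-\beta_0a_2k_1^2s_1^3+\tfrac12\beta_0a_1k_1^2s_1^2,\qquad l_3=\tfrac14k_2^4s_2^4-\beta_0a_4k_2^2s_2^3+\tfrac12\beta_0a_3k_2^2s_2^2,$$ $$l_2=\pi^2+\tfrac12\beta_0(b_1-b_4)\pi+\tfrac12\beta_0k_1k_2\big[-b_2(s_1+s_2)-b_3(\tau_1s_2-\tau_2s_1)+b_5(s_1-s_2)-b_6(\tau_1s_2+\tau_2s_1)\big].$$ Assume $l_1l_3-l_2^2\ne0$ and let $s\ge2$. For real $\mu$ put $$|A_1|^2=\frac{2\mu\,[l_3k_1^2s_1^2-l_2k_2^2s_2^2]}{\beta_0(l_1l_3-l_2^2)},\qquad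 |A_2|^2=\frac{2\mu\,[l_1k_2^2s_2^2-l_2k_1^2s_1^2]}{\beta_0(l_1l_3-l_2^2)} .$$ *Claim.* There are $\mu_0,M>0$ such that for every $\mu$ with $|\mu|<\mu_0$ for which both right-hand sides are $\ge0$, the system with $\beta=\beta_0+\mu$ has a classical ($C^3$) solution $(\eta,v)\in H^s_{\natural,e}\times H^s_{\natural,o}\times H^s_{\natural,o}$ on $\mathbb R^2\times\mathbb R$ such that $\eta$ has average $C=0$, every space shift $(\eta,v)(x+\vec\sigma,t)$, $\vec\sigma\in\mathbb R^2$, is again such a solution, and, with $\theta_1=k_1x_1+k_1\tau_1x_2$ and $\theta_2=k_2x_1-k_2\tau_2x_2$, $$\begin{aligned}\eta={}&2k_1s_1|A_1|\cos\theta_1\cos qt+2k_2s_2|A_2|\cos\theta_2\cos qt\\ &+\tfrac12k_1^2s_1^2|A_1|^2\cos2\theta_1+\tfrac12k_2^2s_2^2|A_2|^2\cos2\theta_2\\ &+k_1k_2(1-\tau_1\tau_2)|A_1A_2|\,[\cos(\theta_1+\theta_2)-\cos(\theta_1-\theta_2)]\\ &-2\beta_0\big[a_1|A_1|^2\cos2\theta_1+a_3|A_2|^2\cos2\theta_2+b_1|A_1A_2|\cos(\theta_1+\theta_2)+b_4|A_1A_2|\cos(\theta_1-\theta_2)\big]\cos2qt+R,\end{aligned}$$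 where $|R|\le M|\mu|^{3/2}$ everywhere and $\|R\|_s\le M|\mu|^{3/2}$; moreover $$v=2\big[|A_1|k_1(1,\tau_1)\sin\theta_1+|A_2|k_2(1,-\tau_2)\sin\theta_2\big]\sin qt+R',$$ with both components of $R'$ of $H^s$ norm at most $M|\mu|$. -/

import Mathlib

/-- The data of the problem: the dispersion parameter `ω`, the lattice parameters
`k₁, k₂, τ₁, τ₂` (generators `P₁ = k₁ (1, τ₁)` and `P₂ = k₂ (1, -τ₂)` of the wave-vector lattice),
the critical value `β₀` of the bifurcation parameter and the time frequency `q`. -/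
structure StandingWaveData where
  ω : ℝ
  k₁ : ℝ
  k₂ : ℝ
  τ₁ : ℝ
  τ₂ : ℝ
  β₀ : ℝ
  q : ℤ

noncomputable section

namespace StandingWaveData

variable (D : StandingWaveData)

/-- First component of the lattice vector `n₁ P₁ + n₂ P₂`. -/
def p₁ (n₁ n₂ : ℤ) : ℝ := D.k₁ * n₁ + D.k₂ * n₂

/-- Second component of the lattice vector `n₁ P₁ + n₂ P₂`. -/
def p₂ (n₁ n₂ : ℤ) : ℝ := D.τ₁ * D.k₁ * n₁ - D.τ₂ * D.k₂ * n₂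

/-- The set of resonant modes `(n₁, n₂, q)`, `q ≥ 1`, of the system linearized at rest, for
the parameter `β`. -/
def Omega (β : ℝ) : Set (ℤ × ℤ × ℤ) :=
  {n | 0 < n.2.2 ∧
    (n.2.2 : ℝ) * (1 + D.ω * (D.p₁ n.1 n.2.1 ^ 2 + D.p₂ n.1 n.2.1 ^ 2))
      - β * √(D.p₁ n.1 n.2.1 ^ 2 + D.p₂ n.1 n.2.1 ^ 2) = 0}

/-! ### Function spaces

Functions of `(x₁, x₂, t)` are curried. For `s ≥ 2` the Fourier series of an `H^s` function of the
three variables converges absolutely, so an element of `H^s` is identified with its continuous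
representative, the pointwise sum of its Fourier series. -/

/-- The Fourier phase `exp (i p · x)`, `p = n₁ P₁ + n₂ P₂`. -/
def phase (n₁ n₂ : ℤ) (x₁ x₂ : ℝ) : ℂ :=
  Complex.exp (Complex.I * ((D.p₁ n₁ n₂ * x₁ + D.p₂ n₁ n₂ * x₂ : ℝ) : ℂ))

/-- `u = ∑ c_{n m} exp (i p · x) cos (m t)`, the sum over `n ∈ ℤ²`, `m ≥ 0`. -/
def HasCosSeries (c : ℤ × ℤ × ℕ → ℂ) (u : ℝ → ℝ → ℝ → ℝ) : Prop :=
  ∀ x₁ x₂ t : ℝ, HasSum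
    (fun n : ℤ × ℤ × ℕ =>
      c n * D.phase n.1 n.2.1 x₁ x₂ * ((Real.cos ((n.2.2 : ℝ) * t) : ℝ) : ℂ))
    ((u x₁ x₂ t : ℝ) : ℂ)

/-- `u = ∑ c_{n m} exp (i p · x) sin (m t)`, the sum over `n ∈ ℤ²`, `m > 0`. -/
def HasSinSeries (c : ℤ × ℤ × ℕ → ℂ) (u : ℝ → ℝ → ℝ → ℝ) : Prop :=
  (∀ n₁ n₂ : ℤ, c (n₁, n₂, 0) = 0) ∧
  ∀ x₁ x₂ t : ℝ, HasSum
    (fun n : ℤ × ℤ × ℕ =>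
      c n * D.phase n.1 n.2.1 x₁ x₂ * ((Real.sin ((n.2.2 : ℝ) * t) : ℝ) : ℂ))
    ((u x₁ x₂ t : ℝ) : ℂ)

/-- The terms `(1 + |p|² + m²)^s |c_{n m}|²` of the squared `H^s` norm. -/
def sobolevTerm (s : ℝ) (c : ℤ × ℤ × ℕ → ℂ) (n : ℤ × ℤ × ℕ) : ℝ :=
  (1 + D.p₁ n.1 n.2.1 ^ 2 + D.p₂ n.1 n.2.1 ^ 2 + (n.2.2 : ℝ) ^ 2) ^ s * ‖c n‖ ^ 2

/-- `u` is a real function in the space `H^s` of lattice-periodic functions that are `2π`-periodic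
and even in time, and its average (its constant Fourier coefficient) is `C`. -/
def MemEven (s C : ℝ) (u : ℝ → ℝ → ℝ → ℝ) : Prop :=
  ∃ c : ℤ × ℤ × ℕ → ℂ, D.HasCosSeries c u ∧ Summable (D.sobolevTerm s c) ∧ c (0, 0, 0) = (C : ℂ)

/-- `u` is a real function in the space `H^s` of lattice-periodic functions that are `2π`-periodic
and odd in time. -/
def MemOdd (s : ℝ) (u : ℝ → ℝ → ℝ → ℝ) : Prop :=
  ∃ c : ℤ × ℤ × ℕ → ℂ, D.HasSinSeries c u ∧ Summable (D.sobolevTerm s c)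

/-- `u` is in the even space, with `H^s` norm at most `B`. -/
def EvenNormLE (s : ℝ) (u : ℝ → ℝ → ℝ → ℝ) (B : ℝ) : Prop :=
  ∃ c : ℤ × ℤ × ℕ → ℂ, D.HasCosSeries c u ∧ Summable (D.sobolevTerm s c) ∧
    √(∑' n, D.sobolevTerm s c n) ≤ B

/-- `u` is in the odd space, with `H^s` norm at most `B`. -/
def OddNormLE (s : ℝ) (u : ℝ → ℝ → ℝ → ℝ) (B : ℝ) : Prop :=
  ∃ c : ℤ × ℤ × ℕ → ℂ, D.HasSinSeries c u ∧ Summable (D.sobolevTerm s c) ∧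
    √(∑' n, D.sobolevTerm s c n) ≤ B

/-! ### The Boussinesq system -/

/-- Partial derivative in `x₁`. -/
def dx₁ (u : ℝ → ℝ → ℝ → ℝ) : ℝ → ℝ → ℝ → ℝ := fun x₁ x₂ t => deriv (fun y => u y x₂ t) x₁

/-- Partial derivative in `x₂`. -/
def dx₂ (u : ℝ → ℝ → ℝ → ℝ) : ℝ → ℝ → ℝ → ℝ := fun x₁ x₂ t => deriv (fun y => u x₁ y t) x₂

/-- Partial derivative in `t`. -/
def dt (u : ℝ → ℝ → ℝ → ℝ) : ℝ → ℝ → ℝ → ℝ := fun x₁ x₂ t => deriv (fun r => u x₁ x₂ r) t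

/-- The Laplacian in `x = (x₁, x₂)`. -/
def lap (u : ℝ → ℝ → ℝ → ℝ) : ℝ → ℝ → ℝ → ℝ :=
  fun x₁ x₂ t => dx₁ (dx₁ u) x₁ x₂ t + dx₂ (dx₂ u) x₁ x₂ t

/-- `u` is three times continuously differentiable in `(x₁, x₂, t)`. -/
def IsC3 (u : ℝ → ℝ → ℝ → ℝ) : Prop := ContDiff ℝ 3 (fun z : ℝ × ℝ × ℝ => u z.1 z.2.1 z.2.2)

/-- The Boussinesq system
`η_t + β ∇·v + β ∇·(η v) - ω Δ η_t = 0`, `v_t + β ∇η + (β/2) ∇|v|² - ω Δ v_t = 0`,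
satisfied classically on `ℝ² × ℝ` by `(η, v₁, v₂)`. -/
def SolvesBoussinesq (β : ℝ) (η v₁ v₂ : ℝ → ℝ → ℝ → ℝ) : Prop :=
  IsC3 η ∧ IsC3 v₁ ∧ IsC3 v₂ ∧ ∀ x₁ x₂ t : ℝ,
    (dt η x₁ x₂ t + β * (dx₁ v₁ x₁ x₂ t + dx₂ v₂ x₁ x₂ t)
      + β * (dx₁ (fun x y r => η x y r * v₁ x y r) x₁ x₂ t
        + dx₂ (fun x y r => η x y r * v₂ x y r) x₁ x₂ t)
      - D.ω * lap (dt η) x₁ x₂ t = 0) ∧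
    (dt v₁ x₁ x₂ t + β * dx₁ η x₁ x₂ t
      + 1 / 2 * β * dx₁ (fun x y r => v₁ x y r ^ 2 + v₂ x y r ^ 2) x₁ x₂ t
      - D.ω * lap (dt v₁) x₁ x₂ t = 0) ∧
    (dt v₂ x₁ x₂ t + β * dx₂ η x₁ x₂ t
      + 1 / 2 * β * dx₂ (fun x y r => v₁ x y r ^ 2 + v₂ x y r ^ 2) x₁ x₂ t
      - D.ω * lap (dt v₂) x₁ x₂ t = 0)

/-- `(η, v₁, v₂)` is a standing wave in `H^s_e × H^s_o × H^s_o`, with average elevation `C`, for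
the parameter `β`. -/
def IsStandingWave (β s C : ℝ) (η v₁ v₂ : ℝ → ℝ → ℝ → ℝ) : Prop :=
  D.MemEven s C η ∧ D.MemOdd s v₁ ∧ D.MemOdd s v₂ ∧ D.SolvesBoussinesq β η v₁ v₂

/-- The space shift `(x, t) ↦ u (x + σ, t)`. -/
def shift (σ₁ σ₂ : ℝ) (u : ℝ → ℝ → ℝ → ℝ) : ℝ → ℝ → ℝ → ℝ :=
  fun x₁ x₂ t => u (x₁ + σ₁) (x₂ + σ₂) t

/-! ### The coefficients of the expansion -/

/-- `√(1 + τ₁²)`. -/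
def s₁ : ℝ := √(1 + D.τ₁ ^ 2)

/-- `√(1 + τ₂²)`. -/
def s₂ : ℝ := √(1 + D.τ₂ ^ 2)

/-- `|P₁ + P₂|²`. -/
def sqPlus : ℝ := (D.k₁ + D.k₂) ^ 2 + (D.k₁ * D.τ₁ - D.k₂ * D.τ₂) ^ 2

/-- `|P₁ - P₂|²`. -/
def sqMinus : ℝ := (D.k₁ - D.k₂) ^ 2 + (D.k₁ * D.τ₁ + D.k₂ * D.τ₂) ^ 2

/-- `P₁ · P₂`. -/
def dot : ℝ := D.k₁ * D.k₂ * (1 - D.τ₁ * D.τ₂)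

def a₁ : ℝ :=
  -(D.β₀ * D.k₁ ^ 4 * D.s₁ ^ 4 + 2 * D.q * D.k₁ ^ 3 * D.s₁ ^ 3 * (1 + 4 * D.ω * D.k₁ ^ 2 * D.s₁ ^ 2))
    / (4 * D.q ^ 2 * (1 + 4 * D.ω * D.k₁ ^ 2 * D.s₁ ^ 2) ^ 2 - 4 * D.β₀ ^ 2 * D.k₁ ^ 2 * D.s₁ ^ 2)

def a₂ : ℝ :=
  (2 * D.β₀ * D.k₁ ^ 4 * D.s₁ ^ 3 + D.q * D.k₁ ^ 3 * D.s₁ ^ 2 * (1 + 4 * D.ω * D.k₁ ^ 2 * D.s₁ ^ 2))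
    / (4 * D.q ^ 2 * (1 + 4 * D.ω * D.k₁ ^ 2 * D.s₁ ^ 2) ^ 2 - 4 * D.β₀ ^ 2 * D.k₁ ^ 2 * D.s₁ ^ 2)

def a₃ : ℝ :=
  -(D.β₀ * D.k₂ ^ 4 * D.s₂ ^ 4 + 2 * D.q * D.k₂ ^ 3 * D.s₂ ^ 3 * (1 + 4 * D.ω * D.k₂ ^ 2 * D.s₂ ^ 2))
    / (4 * D.q ^ 2 * (1 + 4 * D.ω * D.k₂ ^ 2 * D.s₂ ^ 2) ^ 2 - 4 * D.β₀ ^ 2 * D.k₂ ^ 2 * D.s₂ ^ 2)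

def a₄ : ℝ :=
  (2 * D.β₀ * D.k₂ ^ 4 * D.s₂ ^ 3 + D.q * D.k₂ ^ 3 * D.s₂ ^ 2 * (1 + 4 * D.ω * D.k₂ ^ 2 * D.s₂ ^ 2))
    / (4 * D.q ^ 2 * (1 + 4 * D.ω * D.k₂ ^ 2 * D.s₂ ^ 2) ^ 2 - 4 * D.β₀ ^ 2 * D.k₂ ^ 2 * D.s₂ ^ 2)

def d₁ : ℝ := 4 * D.q ^ 2 * (1 + D.ω * D.sqPlus) ^ 2 - D.β₀ ^ 2 * D.sqPlus

def d₂ : ℝ := 4 * D.q ^ 2 * (1 + D.ω * D.sqMinus) ^ 2 - D.β₀ ^ 2 * D.sqMinus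

/-- The bracket `k₁k₂(k₁+k₂)(s₁+s₂) - k₁k₂(k₁τ₁-k₂τ₂)(τ₂s₁-τ₁s₂)`, common to `b₁, b₂, b₃`. -/
def bracketPlus : ℝ :=
  D.k₁ * D.k₂ * (D.k₁ + D.k₂) * (D.s₁ + D.s₂)
    - D.k₁ * D.k₂ * (D.k₁ * D.τ₁ - D.k₂ * D.τ₂) * (D.τ₂ * D.s₁ - D.τ₁ * D.s₂)

/-- The bracket `k₁k₂(k₁-k₂)(s₁-s₂) - k₁k₂(k₁τ₁+k₂τ₂)(τ₂s₁+τ₁s₂)`, common to `b₄, b₅, b₆`. -/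
def bracketMinus : ℝ :=
  D.k₁ * D.k₂ * (D.k₁ - D.k₂) * (D.s₁ - D.s₂)
    - D.k₁ * D.k₂ * (D.k₁ * D.τ₁ + D.k₂ * D.τ₂) * (D.τ₂ * D.s₁ + D.τ₁ * D.s₂)

def b₁ : ℝ :=
  1 / (2 * D.d₁) *
    (-(2 * D.q * (1 + D.ω * D.sqPlus) * D.bracketPlus) - D.β₀ * D.dot * D.sqPlus)

def b₂ : ℝ :=
  (D.k₁ + D.k₂) / (2 * D.d₁) *
    (2 * D.q * D.dot * (1 + D.ω * D.sqPlus) + D.β₀ * D.bracketPlus)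

/-- `b₃ = (k₁τ₁ - k₂τ₂)/(k₁ + k₂) · b₂`. -/
def b₃ : ℝ :=
  (D.k₁ * D.τ₁ - D.k₂ * D.τ₂) / (2 * D.d₁) *
    (2 * D.q * D.dot * (1 + D.ω * D.sqPlus) + D.β₀ * D.bracketPlus)

def b₄ : ℝ :=
  1 / (2 * D.d₂) *
    (2 * D.q * (1 + D.ω * D.sqMinus) * D.bracketMinus + D.β₀ * D.dot * D.sqMinus)

def b₅ : ℝ :=
  (D.k₁ - D.k₂) / (2 * D.d₂) *
    (-(2 * D.q * D.dot * (1 + D.ω * D.sqMinus)) - D.β₀ * D.bracketMinus)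

/-- `b₆ = (k₁τ₁ + k₂τ₂)/(k₁ - k₂) · b₅`, written so as to make sense for `k₁ = k₂` too. -/
def b₆ : ℝ :=
  (D.k₁ * D.τ₁ + D.k₂ * D.τ₂) / (2 * D.d₂) *
    (-(2 * D.q * D.dot * (1 + D.ω * D.sqMinus)) - D.β₀ * D.bracketMinus)

def l₁ : ℝ :=
  1 / 4 * D.k₁ ^ 4 * D.s₁ ^ 4 - D.β₀ * D.a₂ * D.k₁ ^ 2 * D.s₁ ^ 3
    + 1 / 2 * D.β₀ * D.a₁ * D.k₁ ^ 2 * D.s₁ ^ 2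

def l₂ : ℝ :=
  D.dot ^ 2 + 1 / 2 * D.β₀ * (D.b₁ - D.b₄) * D.dot
    - 1 / 2 * D.β₀ * D.b₂ * D.k₁ * D.k₂ * (D.s₁ + D.s₂)
    - 1 / 2 * D.β₀ * D.b₃ * D.k₁ * D.k₂ * (D.τ₁ * D.s₂ - D.τ₂ * D.s₁)
    + 1 / 2 * D.β₀ * D.b₅ * D.k₁ * D.k₂ * (D.s₁ - D.s₂)
    - 1 / 2 * D.β₀ * D.b₆ * D.k₁ * D.k₂ * (D.τ₁ * D.s₂ + D.τ₂ * D.s₁)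

def l₃ : ℝ :=
  1 / 4 * D.k₂ ^ 4 * D.s₂ ^ 4 - D.β₀ * D.a₄ * D.k₂ ^ 2 * D.s₂ ^ 3
    + 1 / 2 * D.β₀ * D.a₃ * D.k₂ ^ 2 * D.s₂ ^ 2

/-- `|A₁|²` for `C = 0`, as a function of `μ`. -/
def ampSq₁ (μ : ℝ) : ℝ :=
  2 * μ * (D.l₃ * (D.k₁ ^ 2 * (1 + D.τ₁ ^ 2)) - D.l₂ * (D.k₂ ^ 2 * (1 + D.τ₂ ^ 2)))
    / (D.β₀ * (D.l₁ * D.l₃ - D.l₂ ^ 2))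

/-- `|A₂|²` for `C = 0`, as a function of `μ`. -/
def ampSq₂ (μ : ℝ) : ℝ :=
  2 * μ * (D.l₁ * (D.k₂ ^ 2 * (1 + D.τ₂ ^ 2)) - D.l₂ * (D.k₁ ^ 2 * (1 + D.τ₁ ^ 2)))
    / (D.β₀ * (D.l₁ * D.l₃ - D.l₂ ^ 2))

/-- The explicit second-order free surface, for amplitudes `A₁ = |A₁|` and `A₂ = |A₂|`. -/
def surface (A₁ A₂ : ℝ) (x₁ x₂ t : ℝ) : ℝ :=
  2 * D.k₁ * √(1 + D.τ₁ ^ 2) * A₁ * Real.cos (D.k₁ * x₁ + D.k₁ * D.τ₁ * x₂) * Real.cos (D.q * t)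
  + 2 * D.k₂ * √(1 + D.τ₂ ^ 2) * A₂ * Real.cos (D.k₂ * x₁ - D.k₂ * D.τ₂ * x₂) * Real.cos (D.q * t)
  + (1 / 2 * D.k₁ ^ 2 * (1 + D.τ₁ ^ 2) * A₁ ^ 2
        * Real.cos (2 * D.k₁ * x₁ + 2 * D.k₁ * D.τ₁ * x₂)
      + 1 / 2 * D.k₂ ^ 2 * (1 + D.τ₂ ^ 2) * A₂ ^ 2
        * Real.cos (2 * D.k₂ * x₁ - 2 * D.k₂ * D.τ₂ * x₂)
      + D.k₁ * D.k₂ * (1 - D.τ₁ * D.τ₂) * (A₁ * A₂)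
        * Real.cos ((D.k₁ + D.k₂) * x₁ + (D.k₁ * D.τ₁ - D.k₂ * D.τ₂) * x₂)
      - D.k₁ * D.k₂ * (1 - D.τ₁ * D.τ₂) * (A₁ * A₂)
        * Real.cos ((D.k₁ - D.k₂) * x₁ + (D.k₁ * D.τ₁ + D.k₂ * D.τ₂) * x₂))
  - 2 * D.β₀ * D.a₁ * A₁ ^ 2
      * Real.cos (2 * D.k₁ * x₁ + 2 * D.k₁ * D.τ₁ * x₂) * Real.cos (2 * D.q * t)
  - 2 * D.β₀ * D.a₃ * A₂ ^ 2
      * Real.cos (2 * D.k₂ * x₁ - 2 * D.k₂ * D.τ₂ * x₂) * Real.cos (2 * D.q * t)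
  - 2 * D.β₀ * D.b₁ * (A₁ * A₂)
      * Real.cos ((D.k₁ + D.k₂) * x₁ + (D.k₁ * D.τ₁ - D.k₂ * D.τ₂) * x₂) * Real.cos (2 * D.q * t)
  - 2 * D.β₀ * D.b₄ * (A₁ * A₂)
      * Real.cos ((D.k₁ - D.k₂) * x₁ + (D.k₁ * D.τ₁ + D.k₂ * D.τ₂) * x₂) * Real.cos (2 * D.q * t)

/-- Leading order of the first velocity component. -/
def velocity₁ (A₁ A₂ : ℝ) (x₁ x₂ t : ℝ) : ℝ :=
  2 * D.k₁ * A₁ * Real.sin (D.k₁ * x₁ + D.k₁ * D.τ₁ * x₂) * Real.sin (D.q * t)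
  + 2 * D.k₂ * A₂ * Real.sin (D.k₂ * x₁ - D.k₂ * D.τ₂ * x₂) * Real.sin (D.q * t)

/-- Leading order of the second velocity component. -/
def velocity₂ (A₁ A₂ : ℝ) (x₁ x₂ t : ℝ) : ℝ :=
  2 * D.k₁ * D.τ₁ * A₁ * Real.sin (D.k₁ * x₁ + D.k₁ * D.τ₁ * x₂) * Real.sin (D.q * t)
  - 2 * D.k₂ * D.τ₂ * A₂ * Real.sin (D.k₂ * x₁ - D.k₂ * D.τ₂ * x₂) * Real.sin (D.q * t)

end StandingWaveData

end

/-! The proof is a Lyapunov–Schmidt reduction in a weighted ℓ¹ algebra of Fourier coefficients,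
arranged so that the square root of `μ` never enters the fixed point problem.

Setting. The unknown is the family of real coefficients of `cos (p · x + m t)`, weighted by a power
`K` of the size of the mode. The weight is submultiplicative, so the quadratic terms act as a
bounded bilinear map `quad`; taking `K ≥ 3` and `K ≥ s` makes the fields `C³` and `H^s`. Elevations
are even and velocities odd, in space and in time. This symmetry is what makes products of cosine
series again cosine series of convolutions (`hasSum_mul_cos_add`), so that the system becomes
algebraic (`SolvesFourier`).

Linear part. At a mode the linearized system has determinant `disc = disp² - β₀² |p|²`. For `m ≠ 0`
the dispersive term makes `|disp|` at least `1 + ω |p|²`, so `disc` is comparable with `disp²`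
outside a finite set: there are no small divisors, and the hypothesis on `Ω` lists the zeros
(`exists_disp_bound`, `resonant_cases`). Hence a bounded partial inverse `T` exists
(`exists_invSymbol_bound`), and by symmetry solvability amounts to two scalar conditions `κ₁`, `κ₂`
(`balanced_of_kernelFun`).

Removing the root. The solution is sought as `U = A₁ X₁ + A₂ X₂ + μ y + (A₁ A₂) W` with `A_j² = μ
b_j`, the parities of `(n₁, n₂)` in `X₁, X₂, y, W` being `(1,0), (0,1), (0,0), (1,1)`. Each parity
class of the equation then carries a common factor `A₁ μ`, `A₂ μ`, `μ` or `A₁ A₂`; once it is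
removed, the system is polynomial in `μ, b₁, b₂` and the components (`Bifurcation.superposition`).
At `μ = 0` it is solved explicitly, and `(b₁, b₂)` satisfies a linear system with matrix `β₀/2`
times `(l₁, l₂; l₂, l₃)`, whose solution is `(ampSq₁ 1, ampSq₂ 1)`. A Newton step with the matrix
frozen at `μ = 0` makes the fixed point map constant there (`step_zero`), so
`exists_fixedPoint_of_const` gives a solution at distance `O(μ)` from the explicit one.

Vanishing amplitudes. If the limit of `b_j` is zero, the sign of `μ b_j` is not controlled and `A_j`
might not be real. The equation for `b_j` is then replaced by `b_j = 0`; as `A_j = 0`, the discarded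
solvability condition is not needed.

Expansion. The `O(μ)` closeness gives an error `O(|μ|^(3/2))` for `U` (`norm_sub_expansion_le`), and
evaluating `T` on the quadratic interactions of the critical modes gives the stated coefficients
(`surface_eq_field`). -/

noncomputable section
namespace StandingWave

open scoped ENNReal

/-- Indices `(n₁, n₂, m)` of the Fourier modes `exp i (p(n) · x + m t)`. -/
abbrev Mode := ℤ × ℤ × ℤ

/-- Values of the Fourier coefficients: one scalar and one planar vector. -/
abbrev Vec := ℝ × ℝ × ℝ

/-- Summable families of coefficients; the weights are absorbed in the entries, see `coef`. -/
abbrev Seq := lp (fun _ : Mode => Vec) 1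

/-! ### Weights -/

def size (g : Mode) : ℝ := 1 + |(g.1 : ℝ)| + |(g.2.1 : ℝ)| + |(g.2.2 : ℝ)|

theorem one_le_size (g : Mode) : 1 ≤ size g := by
  unfold size
  have := abs_nonneg (g.1 : ℝ)
  have := abs_nonneg (g.2.1 : ℝ)
  have := abs_nonneg (g.2.2 : ℝ)
  linarith

/-- With `x, y ≥ 1` the two sizes, `x + y - 1 ≤ x y` because `(x - 1) (y - 1) ≥ 0`. This
submultiplicativity is what makes the weighted ℓ¹ space a convolution algebra. -/
theorem size_add_le (g h : Mode) : size (g + h) ≤ size g * size h := by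
  have h1 := abs_add_le (g.1 : ℝ) h.1
  have h2 := abs_add_le (g.2.1 : ℝ) h.2.1
  have h3 := abs_add_le (g.2.2 : ℝ) h.2.2
  have hg := one_le_size g
  have hh := one_le_size h
  have key : size (g + h) ≤ size g + size h - 1 := by
    simp only [size, Prod.fst_add, Prod.snd_add, Int.cast_add]
    linarith
  nlinarith

def wt (K : ℕ) (g : Mode) : ℝ := size g ^ K

theorem one_le_wt (K : ℕ) (g : Mode) : 1 ≤ wt K g := one_le_pow₀ (one_le_size g)

theorem wt_pos (K : ℕ) (g : Mode) : 0 < wt K g := zero_lt_one.trans_le (one_le_wt K g)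

theorem wt_add_le (K : ℕ) (g h : Mode) : wt K (g + h) ≤ wt K g * wt K h := by
  unfold wt
  rw [← mul_pow]
  exact pow_le_pow_left₀ (zero_le_one.trans (one_le_size _)) (size_add_le g h) K

/-! ### Coefficients and basis elements -/

variable (K : ℕ)

theorem summable_norm_seq (u : Seq) : Summable fun g => ‖u g‖ := by
  have := (lp.memℓp u).summable (by simp)
  simpa using this

theorem norm_seq_eq (u : Seq) : ‖u‖ = ∑' g, ‖u g‖ := by
  simp [lp.norm_eq_tsum_rpow (p := 1) (by simp) u]

/-- The Fourier coefficient of index `g`. -/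
def coef (u : Seq) (g : Mode) : Vec := (wt K g)⁻¹ • u g

theorem coef_add (u v : Seq) (g : Mode) : coef K (u + v) g = coef K u g + coef K v g := by
  simp [coef]

theorem coef_sub (u v : Seq) (g : Mode) : coef K (u - v) g = coef K u g - coef K v g := by
  simp [coef, smul_sub]

theorem coef_smul (c : ℝ) (u : Seq) (g : Mode) : coef K (c • u) g = c • coef K u g := by
  simp only [coef, lp.coeFn_smul, Pi.smul_apply]
  rw [smul_comm]

theorem coef_zero (g : Mode) : coef K 0 g = 0 := by
  simp [coef]

theorem wt_smul_coef (u : Seq) (g : Mode) : wt K g • coef K u g = u g := by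
  rw [coef, smul_smul, mul_inv_cancel₀ (wt_pos K g).ne', one_smul]

theorem wt_mul_norm_coef (u : Seq) (g : Mode) : wt K g * ‖coef K u g‖ = ‖u g‖ := by
  rw [← wt_smul_coef K u g, norm_smul, Real.norm_of_nonneg (wt_pos K g).le]

theorem norm_coef_le (u : Seq) (g : Mode) : ‖coef K u g‖ ≤ ‖u g‖ := by
  rw [← wt_mul_norm_coef K u g]
  exact le_mul_of_one_le_left (norm_nonneg _) (one_le_wt K g)

theorem ext_coef {u v : Seq} (h : ∀ g, coef K u g = coef K v g) : u = v := by
  refine lp.ext (funext fun g => ?_)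
  rw [← wt_smul_coef K u g, ← wt_smul_coef K v g, h]

/-- The coefficient of index `g` as a continuous linear map. -/
def coefL (g : Mode) : Seq →L[ℝ] Vec := (wt K g)⁻¹ • lp.evalCLM ℝ (fun _ : Mode => Vec) 1 g

theorem coefL_apply (g : Mode) (u : Seq) : coefL K g u = coef K u g := rfl

theorem continuous_coef (g : Mode) : Continuous fun u : Seq => coef K u g :=
  (coefL K g).continuous

/-- The element whose only nonzero coefficient is `a`, at the index `g`. -/
def bas (g : Mode) (a : Vec) : Seq := lp.single 1 g (wt K g • a)

theorem coef_bas (g h : Mode) (a : Vec) : coef K (bas K g a) h = if h = g then a else 0 := by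
  rw [coef, bas, lp.single_apply]
  split_ifs with hh
  · subst hh
    rw [Pi.single_eq_same, smul_smul, inv_mul_cancel₀ (wt_pos K h).ne', one_smul]
  · rw [Pi.single_eq_of_ne hh, smul_zero]

theorem norm_bas (g : Mode) (a : Vec) : ‖bas K g a‖ = wt K g * ‖a‖ := by
  rw [bas, lp.norm_single (by simp), norm_smul, Real.norm_of_nonneg (wt_pos K g).le]

theorem bas_add (g : Mode) (a b : Vec) : bas K g (a + b) = bas K g a + bas K g b := by
  simp [bas]

theorem bas_smul (g : Mode) (c : ℝ) (a : Vec) : bas K g (c • a) = c • bas K g a := by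
  rw [bas, bas, smul_comm, lp.single_smul]

theorem bas_zero (g : Mode) : bas K g 0 = 0 := by simp [bas]

/-! ### The quadratic interaction -/

/-- Polarization of `(h, v) ↦ (|v|² / 2, h v)`. -/
def interact (a b : Vec) : Vec :=
  (1 / 2 * (a.2.1 * b.2.1 + a.2.2 * b.2.2), 1 / 2 * (a.1 * b.2.1 + b.1 * a.2.1),
    1 / 2 * (a.1 * b.2.2 + b.1 * a.2.2))

theorem interact_comm (a b : Vec) : interact a b = interact b a := by
  ext <;> simp only [interact] <;> ring

theorem interact_add_left (a a' b : Vec) :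
    interact (a + a') b = interact a b + interact a' b := by
  ext <;> simp only [interact, Prod.fst_add, Prod.snd_add] <;> ring

theorem interact_smul_left (c : ℝ) (a b : Vec) : interact (c • a) b = c • interact a b := by
  ext <;> simp only [interact, Prod.smul_fst, Prod.smul_snd, smul_eq_mul] <;> ring

theorem interact_add_right (a b b' : Vec) :
    interact a (b + b') = interact a b + interact a b' := by
  rw [interact_comm, interact_add_left, interact_comm b, interact_comm b']

theorem interact_smul_right (c : ℝ) (a b : Vec) : interact a (c • b) = c • interact a b := by
  rw [interact_comm, interact_smul_left, interact_comm]

@[simp] theorem interact_zero_left (b : Vec) : interact 0 b = 0 := by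
  ext <;> simp [interact]

@[simp] theorem interact_zero_right (b : Vec) : interact b 0 = 0 := by
  rw [interact_comm, interact_zero_left]

theorem norm_interact_le (a b : Vec) : ‖interact a b‖ ≤ ‖a‖ * ‖b‖ := by
  have a0 := norm_fst_le a
  have b0 := norm_fst_le b
  have a1 := (norm_fst_le a.2).trans (norm_snd_le a)
  have b1 := (norm_fst_le b.2).trans (norm_snd_le b)
  have a2 := (norm_snd_le a.2).trans (norm_snd_le a)
  have b2 := (norm_snd_le b.2).trans (norm_snd_le b)
  have key : ∀ x y z w : ℝ, ‖x‖ ≤ ‖a‖ → ‖y‖ ≤ ‖b‖ → ‖z‖ ≤ ‖b‖ → ‖w‖ ≤ ‖a‖ →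
      ‖1 / 2 * (x * y + z * w)‖ ≤ ‖a‖ * ‖b‖ := by
    intro x y z w hx hy hz hw
    have h1 : ‖x * y‖ ≤ ‖a‖ * ‖b‖ := by
      rw [norm_mul]; exact mul_le_mul hx hy (norm_nonneg _) (norm_nonneg _)
    have h2 : ‖z * w‖ ≤ ‖a‖ * ‖b‖ := by
      rw [norm_mul, mul_comm]; exact mul_le_mul hw hz (norm_nonneg _) (norm_nonneg _)
    have h3 := norm_add_le (x * y) (z * w)
    rw [norm_mul, Real.norm_of_nonneg (by norm_num : (0 : ℝ) ≤ 1 / 2)]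
    linarith
  refine norm_prod_le_iff.2 ⟨?_, norm_prod_le_iff.2
    ⟨key _ _ _ _ a0 b1 b0 a1, key _ _ _ _ a0 b2 b0 a2⟩⟩
  have h := key a.2.1 b.2.1 b.2.2 a.2.2 a1 b1 b2 a2
  rwa [mul_comm b.2.2] at h

/-- The weight of a sum of modes is absorbed by the product of the weights, so the double series
defining `quad` is dominated by the product of two convergent series, with constant one. -/
theorem norm_bas_interact_le (u v : Seq) (x : Mode × Mode) :
    ‖bas K (x.1 + x.2) (interact (coef K u x.1) (coef K v x.2))‖ ≤ ‖u x.1‖ * ‖v x.2‖ := by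
  rw [norm_bas, ← wt_mul_norm_coef K u, ← wt_mul_norm_coef K v]
  calc wt K (x.1 + x.2) * ‖interact (coef K u x.1) (coef K v x.2)‖
      ≤ (wt K x.1 * wt K x.2) * (‖coef K u x.1‖ * ‖coef K v x.2‖) :=
        mul_le_mul (wt_add_le K _ _) (norm_interact_le _ _) (norm_nonneg _)
          (mul_pos (wt_pos K _) (wt_pos K _)).le
    _ = _ := by ring

theorem summable_norm_mul (u v : Seq) : Summable fun x : Mode × Mode => ‖u x.1‖ * ‖v x.2‖ :=
  (summable_norm_seq u).mul_of_nonneg (summable_norm_seq v) (fun _ => norm_nonneg _)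
    (fun _ => norm_nonneg _)

theorem summable_bas_interact (u v : Seq) : Summable fun x : Mode × Mode =>
    bas K (x.1 + x.2) (interact (coef K u x.1) (coef K v x.2)) :=
  Summable.of_norm_bounded (summable_norm_mul u v) (norm_bas_interact_le K u v)

/-- The quadratic interaction, as a continuous bilinear map on sequences of coefficients. -/
def quad : Seq →L[ℝ] Seq →L[ℝ] Seq :=
  LinearMap.mkContinuous₂
    (LinearMap.mk₂ ℝ
      (fun u v => ∑' x : Mode × Mode,
        bas K (x.1 + x.2) (interact (coef K u x.1) (coef K v x.2)))
      (fun u u' v => by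
        rw [← (summable_bas_interact K u v).tsum_add (summable_bas_interact K u' v)]
        simp only [coef_add, interact_add_left, bas_add])
      (fun c u v => by
        rw [← (summable_bas_interact K u v).tsum_const_smul]
        simp only [coef_smul, interact_smul_left, bas_smul])
      (fun u v v' => by
        rw [← (summable_bas_interact K u v).tsum_add (summable_bas_interact K u v')]
        simp only [coef_add, interact_add_right, bas_add])
      (fun c u v => by
        rw [← (summable_bas_interact K u v).tsum_const_smul]
        simp only [coef_smul, interact_smul_right, bas_smul])) 1
    (fun u v => by
      rw [one_mul, norm_seq_eq u, norm_seq_eq v, LinearMap.mk₂_apply,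
        (summable_norm_seq u).tsum_mul_tsum (summable_norm_seq v) (summable_norm_mul u v)]
      exact tsum_of_norm_bounded (summable_norm_mul u v).hasSum (norm_bas_interact_le K u v))

theorem quad_apply (u v : Seq) : quad K u v = ∑' x : Mode × Mode,
    bas K (x.1 + x.2) (interact (coef K u x.1) (coef K v x.2)) := rfl

theorem hasSum_quad (u v : Seq) : HasSum (fun x : Mode × Mode =>
    bas K (x.1 + x.2) (interact (coef K u x.1) (coef K v x.2))) (quad K u v) :=
  (summable_bas_interact K u v).hasSum

/-- Grouping the pairs by their first entry shows that `quad` is a convolution. The sum over pairs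
is suited to norm bounds; this form is suited to symmetries and supports. -/
theorem hasSum_coef_quad (u v : Seq) (g : Mode) :
    HasSum (fun h => interact (coef K u h) (coef K v (g - h))) (coef K (quad K u v) g) := by
  have h1 := (hasSum_quad K u v).mapL (coefL K g)
  simp only [coefL_apply, coef_bas] at h1
  refine (h1.prod_fiberwise fun h => ?_)
  have : ∀ k, k ≠ g - h → (if g = h + k then interact (coef K u h) (coef K v k) else 0) = 0 := by
    intro k hk
    rw [if_neg]
    rintro rfl
    exact hk (by abel)
  have h2 := hasSum_single (f := fun k => if g = h + k then interact (coef K u h) (coef K v k) else 0)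
    (g - h) this
  simpa using h2

theorem quad_comm (u v : Seq) : quad K u v = quad K v u := by
  rw [quad_apply, quad_apply, ← (Equiv.prodComm Mode Mode).tsum_eq]
  refine tsum_congr fun x => ?_
  simp only [Equiv.prodComm_apply, Prod.fst_swap, Prod.snd_swap]
  rw [add_comm, interact_comm]

theorem quad_bas_bas (g h : Mode) (a b : Vec) :
    quad K (bas K g a) (bas K h b) = bas K (g + h) (interact a b) := by
  rw [quad_apply, tsum_eq_single (g, h)]
  · simp [coef_bas]
  · rintro ⟨x, y⟩ hxy
    simp only [coef_bas]
    by_cases hx : x = g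
    · have : y ≠ h := fun hy => hxy (by rw [hx, hy])
      simp [this, bas_zero]
    · simp [hx, bas_zero]

/-! ### Symmetries and parity classes -/

/-- Reflection of the wave vector. -/
def spaceFlip (g : Mode) : Mode := (-g.1, -g.2.1, g.2.2)

/-- Reflection of the time frequency. -/
def timeFlip (g : Mode) : Mode := (g.1, g.2.1, -g.2.2)

theorem spaceFlip_spaceFlip (g : Mode) : spaceFlip (spaceFlip g) = g := by simp [spaceFlip]

theorem timeFlip_timeFlip (g : Mode) : timeFlip (timeFlip g) = g := by simp [timeFlip]

theorem spaceFlip_sub (g h : Mode) : spaceFlip (g - h) = spaceFlip g - spaceFlip h := by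
  ext <;> simp [spaceFlip] <;> ring

theorem timeFlip_sub (g h : Mode) : timeFlip (g - h) = timeFlip g - timeFlip h := by
  ext <;> simp [timeFlip]; ring

/-- Change of sign of the vector part. -/
def conjVec : Vec →L[ℝ] Vec :=
  (ContinuousLinearMap.fst ℝ ℝ (ℝ × ℝ)).prod (-ContinuousLinearMap.snd ℝ ℝ (ℝ × ℝ))

theorem conjVec_apply (a : Vec) : conjVec a = (a.1, -a.2.1, -a.2.2) := rfl

theorem conjVec_conjVec (a : Vec) : conjVec (conjVec a) = a := by simp [conjVec_apply]

theorem interact_conjVec (a b : Vec) :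
    interact (conjVec a) (conjVec b) = conjVec (interact a b) := by
  ext <;> simp only [interact, conjVec_apply]
  all_goals ring

/-- The sequences whose scalar part is even and whose vector part is odd, both in space and
in time. -/
def symSpace : Submodule ℝ Seq where
  carrier := {u | (∀ g, coef K u (spaceFlip g) = conjVec (coef K u g)) ∧
    ∀ g, coef K u (timeFlip g) = conjVec (coef K u g)}
  add_mem' hu hv := by
    constructor <;> intro g
    · rw [coef_add, coef_add, hu.1, hv.1, map_add]
    · rw [coef_add, coef_add, hu.2, hv.2, map_add]
  zero_mem' := by simp [coef_zero]
  smul_mem' c u hu := by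
    constructor <;> intro g
    · rw [coef_smul, coef_smul, hu.1, map_smul]
    · rw [coef_smul, coef_smul, hu.2, map_smul]

/-- The sequences supported by the modes with `n₁ ≡ i` and `n₂ ≡ j` modulo two. -/
def parSpace (i j : ZMod 2) : Submodule ℝ Seq where
  carrier := {u | ∀ g : Mode, ¬((g.1 : ZMod 2) = i ∧ (g.2.1 : ZMod 2) = j) → coef K u g = 0}
  add_mem' hu hv g hg := by rw [coef_add, hu g hg, hv g hg, add_zero]
  zero_mem' := by simp [coef_zero]
  smul_mem' c u hu g hg := by rw [coef_smul, hu g hg, smul_zero]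

theorem isClosed_symSpace : IsClosed (symSpace K : Set Seq) := by
  have : (symSpace K : Set Seq) = (⋂ g, {u | coef K u (spaceFlip g) = conjVec (coef K u g)}) ∩
      ⋂ g, {u | coef K u (timeFlip g) = conjVec (coef K u g)} := by
    ext u; simp [symSpace]
  rw [this]
  refine IsClosed.inter (isClosed_iInter fun g => ?_) (isClosed_iInter fun g => ?_)
  · exact isClosed_eq (continuous_coef K _) (conjVec.continuous.comp (continuous_coef K g))
  · exact isClosed_eq (continuous_coef K _) (conjVec.continuous.comp (continuous_coef K g))

theorem isClosed_parSpace (i j : ZMod 2) : IsClosed (parSpace K i j : Set Seq) := by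
  have : (parSpace K i j : Set Seq) = ⋂ g : Mode,
      ⋂ _ : ¬((g.1 : ZMod 2) = i ∧ (g.2.1 : ZMod 2) = j), {u | coef K u g = 0} := by
    ext u; simp [parSpace]
  rw [this]
  exact isClosed_iInter fun g => isClosed_iInter fun _ =>
    isClosed_eq (continuous_coef K g) continuous_const

variable {K}

/-- Convolution commutes with any involution of the modes compatible with subtraction, and
`interact` is equivariant under the sign change of the vector part. -/
theorem quad_mem_symSpace {u v : Seq} (hu : u ∈ symSpace K) (hv : v ∈ symSpace K) :
    quad K u v ∈ symSpace K := by
  have key : ∀ f : Mode → Mode, (∀ g, f (f g) = g) → (∀ g h, f (g - h) = f g - f h) →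
      (∀ g, coef K u (f g) = conjVec (coef K u g)) →
      (∀ g, coef K v (f g) = conjVec (coef K v g)) →
      ∀ g, coef K (quad K u v) (f g) = conjVec (coef K (quad K u v) g) := by
    intro f hf hs hu hv g
    have h1 := (hasSum_coef_quad K u v g).mapL conjVec
    have h2 := hasSum_coef_quad K u v (f g)
    let e : Mode ≃ Mode := ⟨f, f, hf, hf⟩
    rw [← e.hasSum_iff] at h2
    refine h2.unique ?_
    convert h1 using 2 with h
    change interact (coef K u (f h)) (coef K v (f g - f h)) = _
    rw [← hs, hu, hv, interact_conjVec]
  exact ⟨key _ spaceFlip_spaceFlip spaceFlip_sub hu.1 hv.1,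
    key _ timeFlip_timeFlip timeFlip_sub hu.2 hv.2⟩

/-- Supports add under convolution, hence so do the parities of the indices. -/
theorem quad_mem_parSpace {i j i' j' : ZMod 2} {u v : Seq} (hu : u ∈ parSpace K i j)
    (hv : v ∈ parSpace K i' j') : quad K u v ∈ parSpace K (i + i') (j + j') := by
  intro g hg
  refine (hasSum_coef_quad K u v g).unique ?_
  convert hasSum_zero using 2 with h
  by_cases hh : (h.1 : ZMod 2) = i ∧ (h.2.1 : ZMod 2) = j
  · rw [hv (g - h), interact_zero_right]
    rintro ⟨h1, h2⟩
    refine hg ⟨?_, ?_⟩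
    · rw [← hh.1, ← h1]; push_cast [Prod.fst_sub]; ring
    · rw [← hh.2, ← h2]; push_cast [Prod.fst_sub, Prod.snd_sub]; ring
  · rw [hu h hh, interact_zero_left]

/-! ### Fourier multipliers -/

variable (K)

/-- The operator acting on the coefficient of index `g` by the linear map `t g`. -/
def multiplier (t : Mode → Vec →L[ℝ] Vec) {C : ℝ} (hC : 0 ≤ C) (ht : ∀ g, ‖t g‖ ≤ C) :
    Seq →L[ℝ] Seq := lp.mapCLM 1 t hC ht

variable {t : Mode → Vec →L[ℝ] Vec} {C : ℝ} (hC : 0 ≤ C) (ht : ∀ g, ‖t g‖ ≤ C)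

theorem coef_multiplier (u : Seq) (g : Mode) :
    coef K (multiplier t hC ht u) g = t g (coef K u g) := by
  rw [coef, coef, map_smul]
  rfl

theorem multiplier_bas (g : Mode) (a : Vec) :
    multiplier t hC ht (bas K g a) = bas K g (t g a) := by
  refine ext_coef K fun h => ?_
  rw [coef_multiplier, coef_bas, coef_bas]
  split_ifs with hh
  · rw [hh]
  · rw [map_zero]

variable {K}

theorem multiplier_mem_symSpace (h1 : ∀ g a, t (spaceFlip g) (conjVec a) = conjVec (t g a))
    (h2 : ∀ g a, t (timeFlip g) (conjVec a) = conjVec (t g a)) {u : Seq}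
    (hu : u ∈ symSpace K) : multiplier t hC ht u ∈ symSpace K := by
  constructor <;> intro g
  · rw [coef_multiplier, coef_multiplier, hu.1, h1]
  · rw [coef_multiplier, coef_multiplier, hu.2, h2]

theorem multiplier_mem_parSpace {i j : ZMod 2} {u : Seq} (hu : u ∈ parSpace K i j) :
    multiplier t hC ht u ∈ parSpace K i j := by
  intro g hg
  rw [coef_multiplier, hu g hg, map_zero]

end StandingWave
end

noncomputable section
namespace StandingWave

/-! ### A fixed point theorem -/

/-- A `C¹` family of maps `G (μ, ·)` which is constant for `μ = 0` has a fixed point, for small `μ`,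
in any closed set that it leaves invariant. -/
theorem exists_fixedPoint_of_const {E : Type*} [NormedAddCommGroup E] [NormedSpace ℝ E]
    [CompleteSpace E] {G : ℝ × E → E} (hG : ContDiff ℝ 1 G) {u₀ : E} (h0 : ∀ u, G (0, u) = u₀)
    {S : Set E} (hS : IsClosed S) (hu₀ : u₀ ∈ S) (hmap : ∀ μ, ∀ u ∈ S, G (μ, u) ∈ S) :
    ∃ δ > 0, ∃ C > 0, ∀ μ : ℝ, |μ| < δ → ∃ u ∈ S, G (μ, u) = u ∧ ‖u - u₀‖ ≤ C * |μ| := by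
  have hd : HasStrictFDerivAt G (fderiv ℝ G (0, u₀)) (0, u₀) :=
    hG.contDiffAt.hasStrictFDerivAt one_ne_zero
  set L := fderiv ℝ G (0, u₀)
  -- `G (0, ·)` is constant, so the derivative in the direction of the unknown vanishes.
  have hL : ∀ v : E, L (0, v) = 0 := by
    intro v
    have h1 : HasFDerivAt (fun u : E => G (0, u)) (L.comp (ContinuousLinearMap.inr ℝ ℝ E)) u₀ :=
      HasFDerivAt.comp u₀ (f := fun u : E => ((0 : ℝ), u)) hd.hasFDerivAt
        (hasFDerivAt_prodMk_right 0 u₀)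
    have h2 : HasFDerivAt (fun u : E => G (0, u)) (0 : E →L[ℝ] E) u₀ := by
      simp only [h0]; exact hasFDerivAt_const _ _
    have h3 := congrArg (fun l : E →L[ℝ] E => l v) (h1.unique h2)
    simpa using h3
  -- Strict differentiability bounds the variation of `G - L` by half the distance near `(0, u₀)`.
  -- As `L` kills the second factor, each `G (μ, ·)` with `|μ|` small is itself a `1/2`-contraction
  -- there.
  obtain ⟨s, hs, hap⟩ := hd.approximates_deriv_on_nhds (c := 1 / 2) (Or.inr (by norm_num))
  obtain ⟨r, hr, hball⟩ := Metric.nhds_basis_closedBall.mem_iff.1 hs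
  have hmem : ∀ μ : ℝ, ∀ u : E, |μ| ≤ r → ‖u - u₀‖ ≤ r → ((μ, u) : ℝ × E) ∈ s := by
    intro μ u hμ hu
    refine hball ?_
    rw [Metric.mem_closedBall, Prod.dist_eq, max_le_iff, Real.dist_eq, sub_zero, dist_eq_norm]
    exact ⟨hμ, hu⟩
  set a := ‖L‖ + 1 / 2
  have ha : 0 < a := by positivity
  have hlip : ∀ μ : ℝ, ∀ u u' : E, |μ| ≤ r → ‖u - u₀‖ ≤ r → ‖u' - u₀‖ ≤ r →
      ‖G (μ, u) - G (μ, u')‖ ≤ 1 / 2 * ‖u - u'‖ := by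
    intro μ u u' hμ hu hu'
    have h := hap _ (hmem μ u hμ hu) _ (hmem μ u' hμ hu')
    have he : ((μ, u) : ℝ × E) - (μ, u') = (0, u - u') := by simp
    rw [he, hL, sub_zero, Prod.norm_mk, norm_zero, max_eq_right (norm_nonneg _)] at h
    simpa using h
  have hbd : ∀ μ : ℝ, ∀ u : E, |μ| ≤ r → ‖u - u₀‖ ≤ r →
      ‖G (μ, u) - u₀‖ ≤ a * |μ| + 1 / 2 * ‖u - u₀‖ := by
    intro μ u hμ hu
    have h := hap _ (hmem μ u₀ hμ (by simpa using hr.le)) _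
      (hmem 0 u₀ (by simpa using hr.le) (by simpa using hr.le))
    have he : ((μ, u₀) : ℝ × E) - (0, u₀) = (μ, 0) := by simp
    have h1 : ‖((μ, 0) : ℝ × E)‖ = |μ| := by
      rw [Prod.norm_mk, norm_zero, max_eq_left (norm_nonneg _), Real.norm_eq_abs]
    rw [he, h0, h1] at h
    have h2 := L.le_opNorm ((μ, 0) : ℝ × E)
    rw [h1] at h2
    have h3 := norm_add_le (G (μ, u₀) - u₀ - L (μ, 0)) (L (μ, 0))
    rw [sub_add_cancel] at h3
    have h4 := hlip μ u u₀ hμ hu (by simpa using hr.le)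
    have h5 := norm_add_le (G (μ, u) - G (μ, u₀)) (G (μ, u₀) - u₀)
    rw [sub_add_sub_cancel] at h5
    have h6 : ((1 / 2 : NNReal) : ℝ) = 1 / 2 := by norm_num
    rw [h6] at h
    simp only [a]
    linarith
  -- The first bound on `|μ|` keeps the approximation valid; the second makes `a * |μ| ≤ r / 2`, so
  -- the ball is mapped into itself. The constant `2 * a` comes from absorbing `1/2 * ‖u - u₀‖` at
  -- the fixed point.
  refine ⟨min r (r / (2 * a)), by positivity, 2 * a, by positivity, fun μ hμ => ?_⟩
  have hμr : |μ| ≤ r := (hμ.le.trans (min_le_left _ _))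
  have hμa : a * |μ| ≤ r / 2 := by
    have : |μ| ≤ r / (2 * a) := hμ.le.trans (min_le_right _ _)
    rw [le_div_iff₀ (by positivity)] at this
    linarith
  have hmaps : Set.MapsTo (fun u => G (μ, u)) (S ∩ Metric.closedBall u₀ r)
      (S ∩ Metric.closedBall u₀ r) := by
    rintro u ⟨huS, hu⟩
    rw [Metric.mem_closedBall, dist_eq_norm] at hu
    refine ⟨hmap μ u huS, ?_⟩
    rw [Metric.mem_closedBall, dist_eq_norm]
    have := hbd μ u hμr hu
    linarith
  have hcontr : ContractingWith (1 / 2) (hmaps.restrict _ _ _) := by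
    refine ⟨by norm_num, LipschitzWith.of_dist_le_mul ?_⟩
    rintro ⟨u, hu⟩ ⟨u', hu'⟩
    have h1 := hu.2
    have h2 := hu'.2
    rw [Metric.mem_closedBall, dist_eq_norm] at h1 h2
    have := hlip μ u u' hμr h1 h2
    simpa [Subtype.dist_eq, dist_eq_norm] using this
  obtain ⟨u, hu, hfix, -⟩ := hcontr.exists_fixedPoint'
    (hS.inter Metric.isClosed_closedBall).isComplete hmaps
    (x := u₀) ⟨hu₀, Metric.mem_closedBall_self hr.le⟩ (edist_ne_top _ _)
  have hu2 := hu.2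
  rw [Metric.mem_closedBall, dist_eq_norm] at hu2
  have h1 := hbd μ u hμr hu2
  have h2 : G (μ, u) = u := hfix
  rw [h2] at h1
  exact ⟨u, hu.1, h2, by linarith⟩

end StandingWave
end

noncomputable section
namespace StandingWave

/-! ### Trigonometric series -/

variable (D : StandingWaveData)

/-- First component of the wave vector. -/
def wave₁ (g : Mode) : ℝ := D.p₁ g.1 g.2.1

/-- Second component of the wave vector. -/
def wave₂ (g : Mode) : ℝ := D.p₂ g.1 g.2.1

/-- The phase `p · x + m t`. -/
def angle (x₁ x₂ t : ℝ) (g : Mode) : ℝ := wave₁ D g * x₁ + wave₂ D g * x₂ + g.2.2 * t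

theorem wave₁_add (g h : Mode) : wave₁ D (g + h) = wave₁ D g + wave₁ D h := by
  simp only [wave₁, StandingWaveData.p₁, Prod.fst_add, Prod.snd_add, Int.cast_add]; ring

theorem wave₂_add (g h : Mode) : wave₂ D (g + h) = wave₂ D g + wave₂ D h := by
  simp only [wave₂, StandingWaveData.p₂, Prod.fst_add, Prod.snd_add, Int.cast_add]; ring

theorem angle_add (x₁ x₂ t : ℝ) (g h : Mode) :
    angle D x₁ x₂ t (g + h) = angle D x₁ x₂ t g + angle D x₁ x₂ t h := by
  simp only [angle, wave₁_add, wave₂_add, Prod.snd_add, Int.cast_add]; ring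

theorem wave₁_spaceFlip (g : Mode) : wave₁ D (spaceFlip g) = -wave₁ D g := by
  simp only [wave₁, StandingWaveData.p₁, spaceFlip, Int.cast_neg]; ring

theorem wave₂_spaceFlip (g : Mode) : wave₂ D (spaceFlip g) = -wave₂ D g := by
  simp only [wave₂, StandingWaveData.p₂, spaceFlip, Int.cast_neg]; ring

theorem angle_neg (x₁ x₂ t : ℝ) (g : Mode) :
    angle D x₁ x₂ t (spaceFlip (timeFlip g)) = -angle D x₁ x₂ t g := by
  simp only [angle, wave₁_spaceFlip, wave₂_spaceFlip]
  simp only [wave₁, wave₂, spaceFlip, timeFlip, Int.cast_neg]; ring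

/-- A common bound for the symbols of the first derivatives. -/
def symbolBound : ℝ := 1 + |D.k₁| + |D.k₂| + |D.τ₁ * D.k₁| + |D.τ₂ * D.k₂|

theorem one_le_symbolBound : 1 ≤ symbolBound D := by
  unfold symbolBound
  linarith [abs_nonneg D.k₁, abs_nonneg D.k₂, abs_nonneg (D.τ₁ * D.k₁), abs_nonneg (D.τ₂ * D.k₂)]

theorem abs_linear_le {a b A x y : ℝ} (ha : |a| ≤ A) (hb : |b| ≤ A) :
    |a * x + b * y| ≤ A * (|x| + |y|) := by
  refine (abs_add_le _ _).trans ?_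
  rw [abs_mul, abs_mul, mul_add]
  exact add_le_add (mul_le_mul_of_nonneg_right ha (abs_nonneg _))
    (mul_le_mul_of_nonneg_right hb (abs_nonneg _))

theorem abs_add_abs_le_size (g : Mode) : |(g.1 : ℝ)| + |(g.2.1 : ℝ)| ≤ size g := by
  unfold size; linarith [abs_nonneg (g.2.2 : ℝ)]

theorem abs_wave₁_le (g : Mode) : |wave₁ D g| ≤ symbolBound D * size g := by
  have h0 := one_le_symbolBound D
  refine (abs_linear_le (A := symbolBound D) ?_ ?_).trans
    (mul_le_mul_of_nonneg_left (abs_add_abs_le_size g) (by linarith)) <;>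
  unfold symbolBound <;>
  linarith [abs_nonneg D.k₁, abs_nonneg D.k₂, abs_nonneg (D.τ₁ * D.k₁), abs_nonneg (D.τ₂ * D.k₂)]

theorem abs_wave₂_le (g : Mode) : |wave₂ D g| ≤ symbolBound D * size g := by
  have h0 := one_le_symbolBound D
  have h : wave₂ D g = D.τ₁ * D.k₁ * g.1 + -(D.τ₂ * D.k₂) * g.2.1 := by
    simp only [wave₂, StandingWaveData.p₂]; ring
  rw [h]
  refine (abs_linear_le (A := symbolBound D) ?_ ?_).trans
    (mul_le_mul_of_nonneg_left (abs_add_abs_le_size g) (by linarith)) <;>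
  unfold symbolBound <;> (try rw [abs_neg]) <;>
  linarith [abs_nonneg D.k₁, abs_nonneg D.k₂, abs_nonneg (D.τ₁ * D.k₁), abs_nonneg (D.τ₂ * D.k₂)]

theorem abs_time_le (g : Mode) : |(g.2.2 : ℝ)| ≤ symbolBound D * size g := by
  have h0 := one_le_symbolBound D
  have h1 := one_le_size g
  have : |(g.2.2 : ℝ)| ≤ size g := by
    unfold size; linarith [abs_nonneg (g.1 : ℝ), abs_nonneg (g.2.1 : ℝ)]
  nlinarith

/-- Summability of the coefficients against the weight `size ^ j`. -/
def Decay (j : ℕ) (c : Mode → ℝ) : Prop := Summable fun g => size g ^ j * |c g|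

variable {D}

theorem Decay.of_le {j : ℕ} {c : Mode → ℝ} (h : Decay j c) {i : ℕ} (hij : i ≤ j) : Decay i c :=
  Summable.of_nonneg_of_le
    (fun g => mul_nonneg (pow_nonneg (zero_le_one.trans (one_le_size g)) _) (abs_nonneg _))
    (fun g => mul_le_mul_of_nonneg_right (pow_le_pow_right₀ (one_le_size g) hij) (abs_nonneg _)) h

theorem Decay.summable {j : ℕ} {c : Mode → ℝ} (h : Decay j c) : Summable fun g => |c g| := by
  simpa [Decay] using h.of_le (Nat.zero_le j)

/-- Multiplication by the symbol of a first derivative costs one power of the weight. -/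
theorem Decay.mul {j : ℕ} {c f : Mode → ℝ} {L : ℝ} (h : Decay (j + 1) c)
    (hf : ∀ g, |f g| ≤ L * size g) : Decay j fun g => f g * c g := by
  refine Summable.of_nonneg_of_le
    (fun g => mul_nonneg (pow_nonneg (zero_le_one.trans (one_le_size g)) _) (abs_nonneg _))
    (fun g => ?_) (Summable.mul_left L h)
  have h0 : 0 ≤ size g := zero_le_one.trans (one_le_size g)
  rw [abs_mul, pow_succ]
  calc size g ^ j * (|f g| * |c g|) ≤ size g ^ j * (L * size g * |c g|) := by
        gcongr; exact hf g
    _ = _ := by ring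

theorem Decay.add {j : ℕ} {c d : Mode → ℝ} (hc : Decay j c) (hd : Decay j d) :
    Decay j fun g => c g + d g := by
  refine Summable.of_nonneg_of_le
    (fun g => mul_nonneg (pow_nonneg (zero_le_one.trans (one_le_size g)) _) (abs_nonneg _))
    (fun g => ?_) (Summable.add hc hd)
  rw [← mul_add]
  exact mul_le_mul_of_nonneg_left (abs_add_le _ _)
    (pow_nonneg (zero_le_one.trans (one_le_size g)) _)

theorem Decay.const_mul {j : ℕ} {c : Mode → ℝ} (hc : Decay j c) (a : ℝ) :
    Decay j fun g => a * c g := by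
  refine (Summable.mul_left |a| hc).congr fun g => ?_
  rw [abs_mul]; ring

/-- The series `∑ c g cos (p · x + m t + r π / 2)`. -/
def trig (D : StandingWaveData) (r : ℕ) (c : Mode → ℝ) (x₁ x₂ t : ℝ) : ℝ :=
  ∑' g, c g * Real.cos (angle D x₁ x₂ t g + r * (Real.pi / 2))

theorem summable_mul_cos {c : Mode → ℝ} (hc : Summable fun g => |c g|) (f : Mode → ℝ) :
    Summable fun g => c g * Real.cos (f g) :=
  Summable.of_norm_bounded hc fun g => by
    rw [norm_mul, Real.norm_eq_abs, Real.norm_eq_abs]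
    exact mul_le_of_le_one_right (abs_nonneg _) (Real.abs_cos_le_one _)

theorem summable_mul_sin {c : Mode → ℝ} (hc : Summable fun g => |c g|) (f : Mode → ℝ) :
    Summable fun g => c g * Real.sin (f g) :=
  Summable.of_norm_bounded hc fun g => by
    rw [norm_mul, Real.norm_eq_abs, Real.norm_eq_abs]
    exact mul_le_of_le_one_right (abs_nonneg _) (Real.abs_sin_le_one _)

theorem trig_add {j r : ℕ} {c d : Mode → ℝ} (hc : Decay j c) (hd : Decay j d) (x₁ x₂ t : ℝ) :
    trig D r (fun g => c g + d g) x₁ x₂ t = trig D r c x₁ x₂ t + trig D r d x₁ x₂ t := by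
  rw [trig, trig, trig,
    ← (summable_mul_cos hc.summable _).tsum_add (summable_mul_cos hd.summable _)]
  simp only [add_mul]

theorem trig_const_mul {r : ℕ} {c : Mode → ℝ} (a : ℝ) (x₁ x₂ t : ℝ) :
    trig D r (fun g => a * c g) x₁ x₂ t = a * trig D r c x₁ x₂ t := by
  rw [trig, trig, ← tsum_mul_left]
  simp only [mul_assoc]

theorem trig_add_two (r : ℕ) (c : Mode → ℝ) (x₁ x₂ t : ℝ) :
    trig D (r + 2) c x₁ x₂ t = -trig D r c x₁ x₂ t := by
  rw [trig, trig, ← tsum_neg]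
  refine tsum_congr fun g => ?_
  have : angle D x₁ x₂ t g + ((r + 2 : ℕ) : ℝ) * (Real.pi / 2)
      = angle D x₁ x₂ t g + r * (Real.pi / 2) + Real.pi := by push_cast; ring
  rw [this, Real.cos_add_pi, mul_neg]

theorem hasDerivAt_tsum_cos {a c : Mode → ℝ} (hc : Summable fun g => |c g|)
    (hac : Summable fun g => |a g * c g|) {ℓ : Mode → ℝ → ℝ} {b : Mode → ℝ}
    (hℓ : ∀ g y, ℓ g y = a g * y + b g) (y : ℝ) :
    HasDerivAt (fun y => ∑' g, c g * Real.cos (ℓ g y))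
      (∑' g, a g * c g * Real.cos (ℓ g y + Real.pi / 2)) y := by
  have hder : ∀ g y, HasDerivAt (fun y => c g * Real.cos (ℓ g y))
      (a g * c g * Real.cos (ℓ g y + Real.pi / 2)) y := by
    intro g y
    have h1 : HasDerivAt (ℓ g) (a g) y := by
      rw [funext (hℓ g)]
      simpa using ((hasDerivAt_id y).const_mul (a g)).add_const (b g)
    refine (h1.cos.const_mul (c g)).congr_deriv ?_
    rw [Real.cos_add_pi_div_two]; ring
  have hbd : ∀ g y, ‖a g * c g * Real.cos (ℓ g y + Real.pi / 2)‖ ≤ |a g * c g| := by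
    intro g y
    rw [norm_mul, Real.norm_eq_abs, Real.norm_eq_abs]
    exact mul_le_of_le_one_right (abs_nonneg _) (Real.abs_cos_le_one _)
  exact hasDerivAt_tsum hac hder hbd (summable_mul_cos hc fun g => ℓ g y) y

theorem phase_succ (θ : ℝ) (r : ℕ) :
    θ + r * (Real.pi / 2) + Real.pi / 2 = θ + ((r + 1 : ℕ) : ℝ) * (Real.pi / 2) := by
  push_cast; ring

/-- A derivative turns the phase by a quarter period, so `r` counts derivatives and no separate sine
series is needed. -/
theorem dx₁_trig {r j : ℕ} {c : Mode → ℝ} (hc : Decay (j + 1) c) :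
    StandingWaveData.dx₁ (trig D r c) = trig D (r + 1) fun g => wave₁ D g * c g := by
  funext x₁ x₂ t
  refine ((hasDerivAt_tsum_cos hc.summable (hc.mul (abs_wave₁_le D)).summable
    (ℓ := fun g y => angle D y x₂ t g + r * (Real.pi / 2))
    (b := fun g => wave₂ D g * x₂ + g.2.2 * t + r * (Real.pi / 2)) (fun g y => ?_) x₁).deriv).trans ?_
  · simp only [angle]; ring
  · simp only [phase_succ, trig]

theorem dx₂_trig {r j : ℕ} {c : Mode → ℝ} (hc : Decay (j + 1) c) :
    StandingWaveData.dx₂ (trig D r c) = trig D (r + 1) fun g => wave₂ D g * c g := by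
  funext x₁ x₂ t
  refine ((hasDerivAt_tsum_cos hc.summable (hc.mul (abs_wave₂_le D)).summable
    (ℓ := fun g y => angle D x₁ y t g + r * (Real.pi / 2))
    (b := fun g => wave₁ D g * x₁ + g.2.2 * t + r * (Real.pi / 2)) (fun g y => ?_) x₂).deriv).trans ?_
  · simp only [angle]; ring
  · simp only [phase_succ, trig]

theorem dt_trig {r j : ℕ} {c : Mode → ℝ} (hc : Decay (j + 1) c) :
    StandingWaveData.dt (trig D r c) = trig D (r + 1) fun g => g.2.2 * c g := by
  funext x₁ x₂ t
  refine ((hasDerivAt_tsum_cos hc.summable (hc.mul (abs_time_le D)).summable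
    (ℓ := fun g y => angle D x₁ x₂ y g + r * (Real.pi / 2))
    (b := fun g => wave₁ D g * x₁ + wave₂ D g * x₂ + r * (Real.pi / 2)) (fun g y => ?_) t).deriv).trans ?_
  · simp only [angle]; ring
  · simp only [phase_succ, trig]

/-- The squared length of the wave vector. -/
def waveSq (D : StandingWaveData) (g : Mode) : ℝ := wave₁ D g ^ 2 + wave₂ D g ^ 2

theorem lap_trig {r j : ℕ} {c : Mode → ℝ} (hc : Decay (j + 2) c) :
    StandingWaveData.lap (trig D r c) = trig D r fun g => -(waveSq D g) * c g := by
  have h1 : Decay (j + 1) fun g => wave₁ D g * c g := hc.mul (abs_wave₁_le D)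
  have h2 : Decay (j + 1) fun g => wave₂ D g * c g := hc.mul (abs_wave₂_le D)
  have h11 := h1.mul (abs_wave₁_le D)
  have h22 := h2.mul (abs_wave₂_le D)
  funext x₁ x₂ t
  rw [StandingWaveData.lap, dx₁_trig (j := j + 1) hc, dx₁_trig h1, dx₂_trig (j := j + 1) hc, dx₂_trig h2, trig_add_two,
    trig_add_two, ← neg_add, ← trig_add h11 h22, ← neg_one_mul, ← trig_const_mul]
  congr 1
  funext g
  simp only [waveSq]; ring

/-- Each term is a cosine composed with a linear form of norm `O(size)`. As derivatives of the
cosine are bounded by one, a derivative of order `k` of the term is `O(size ^ k * |c g|)`, summable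
for `k ≤ 3`. -/
theorem isC3_trig {r : ℕ} {c : Mode → ℝ} (hc : Decay 3 c) : StandingWaveData.IsC3 (trig D r c) := by
  let ℓ : Mode → (ℝ × ℝ × ℝ) →L[ℝ] ℝ := fun g =>
    wave₁ D g • ContinuousLinearMap.fst ℝ ℝ (ℝ × ℝ)
    + wave₂ D g • (ContinuousLinearMap.fst ℝ ℝ ℝ).comp (ContinuousLinearMap.snd ℝ ℝ (ℝ × ℝ))
    + (g.2.2 : ℝ) • (ContinuousLinearMap.snd ℝ ℝ ℝ).comp (ContinuousLinearMap.snd ℝ ℝ (ℝ × ℝ))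
  have hℓ : ∀ g, ‖ℓ g‖ ≤ 3 * symbolBound D * size g := by
    intro g
    have h0 : 0 ≤ symbolBound D * size g := (abs_nonneg _).trans (abs_wave₁_le D g)
    refine ContinuousLinearMap.opNorm_le_bound _ (by linarith) fun z => ?_
    have e1 := norm_fst_le z
    have e2 := (norm_fst_le z.2).trans (norm_snd_le z)
    have e3 := (norm_snd_le z.2).trans (norm_snd_le z)
    have b1 := mul_le_mul (abs_wave₁_le D g) e1 (norm_nonneg _) h0
    have b2 := mul_le_mul (abs_wave₂_le D g) e2 (norm_nonneg _) h0
    have b3 := mul_le_mul (abs_time_le D g) e3 (norm_nonneg _) h0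
    change |wave₁ D g * z.1 + wave₂ D g * z.2.1 + g.2.2 * z.2.2| ≤ _
    refine (abs_add_three _ _ _).trans ?_
    simp only [abs_mul, ← Real.norm_eq_abs] at *
    linarith
  let f : ℝ → ℝ := fun y => Real.cos (y + r * (Real.pi / 2))
  have hf : ContDiff ℝ 3 f := by fun_prop
  have hfun : (fun z : ℝ × ℝ × ℝ => trig D r c z.1 z.2.1 z.2.2)
      = fun z => ∑' g, c g * f (ℓ g z) := by
    funext z
    simp [trig, angle, f, ℓ]
  have hder : ∀ (k : ℕ) (y : ℝ), ‖iteratedFDeriv ℝ k f y‖ ≤ 1 := by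
    intro k y
    rw [norm_iteratedFDeriv_eq_norm_iteratedDeriv]
    have := congrFun (iteratedDeriv_comp_add_const k Real.cos (r * (Real.pi / 2))) y
    rw [show iteratedDeriv k f y = _ from this]
    exact Real.abs_iteratedDeriv_cos_le_one _ _
  rw [StandingWaveData.IsC3, hfun]
  refine contDiff_tsum (N := 3) (v := fun k g => (3 * symbolBound D) ^ k * (size g ^ k * |c g|))
    (fun g => contDiff_const.mul (hf.comp (ℓ g).contDiff)) (fun k hk => ?_) (fun k g z hk => ?_)
  · exact Summable.mul_left _ (hc.of_le (by exact_mod_cast hk))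
  · have hk' : (k : WithTop ℕ∞) ≤ 3 := by exact_mod_cast hk
    have e1 : (fun z => c g * f (ℓ g z)) = c g • (f ∘ ℓ g) := rfl
    rw [e1, iteratedFDeriv_const_smul_apply ((hf.comp (ℓ g).contDiff).contDiffAt.of_le hk'),
      (ℓ g).iteratedFDeriv_comp_right hf z hk', norm_smul, Real.norm_eq_abs]
    have e2 := ContinuousMultilinearMap.norm_compContinuousLinearMap_le
      (iteratedFDeriv ℝ k f (ℓ g z)) fun _ => ℓ g
    rw [Finset.prod_const, Finset.card_univ, Fintype.card_fin] at e2
    have e3 : ‖ℓ g‖ ^ k ≤ (3 * symbolBound D * size g) ^ k :=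
      pow_le_pow_left₀ (norm_nonneg _) (hℓ g) k
    have e4 : ‖iteratedFDeriv ℝ k f (ℓ g z)‖ * ‖ℓ g‖ ^ k ≤ 1 * (3 * symbolBound D * size g) ^ k :=
      mul_le_mul (hder k _) e3 (pow_nonneg (norm_nonneg _) _) zero_le_one
    calc |c g| * _ ≤ |c g| * (1 * (3 * symbolBound D * size g) ^ k) :=
          mul_le_mul_of_nonneg_left (e2.trans e4) (abs_nonneg _)
      _ = _ := by rw [mul_pow]; ring

end StandingWave
end

noncomputable section
namespace StandingWave

theorem hasSum_of_eq {ι α : Type*} [AddCommMonoid α] [TopologicalSpace α] {f f' : ι → α}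
    {a a' : α} (h : HasSum f a) (hf : ∀ i, f' i = f i) (ha : a' = a) : HasSum f' a' := by
  rwa [ha, funext hf]

/-! ### The fields attached to a sequence of coefficients -/

variable (D : StandingWaveData) (K : ℕ)

/-- The three components of a coefficient. -/
def comp₀ : Vec →L[ℝ] ℝ := ContinuousLinearMap.fst ℝ ℝ (ℝ × ℝ)

def comp₁ : Vec →L[ℝ] ℝ :=
  (ContinuousLinearMap.fst ℝ ℝ ℝ).comp (ContinuousLinearMap.snd ℝ ℝ (ℝ × ℝ))

def comp₂ : Vec →L[ℝ] ℝ :=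
  (ContinuousLinearMap.snd ℝ ℝ ℝ).comp (ContinuousLinearMap.snd ℝ ℝ (ℝ × ℝ))

theorem comp₀_apply (a : Vec) : comp₀ a = a.1 := rfl
theorem comp₁_apply (a : Vec) : comp₁ a = a.2.1 := rfl
theorem comp₂_apply (a : Vec) : comp₂ a = a.2.2 := rfl

theorem abs_comp₀_le (a : Vec) : |comp₀ a| ≤ ‖a‖ := norm_fst_le a
theorem abs_comp₁_le (a : Vec) : |comp₁ a| ≤ ‖a‖ := (norm_fst_le a.2).trans (norm_snd_le a)
theorem abs_comp₂_le (a : Vec) : |comp₂ a| ≤ ‖a‖ := (norm_snd_le a.2).trans (norm_snd_le a)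

/-- The real function `∑ pr (coef u g) cos (p · x + m t)`. -/
def field (pr : Vec →L[ℝ] ℝ) (u : Seq) : ℝ → ℝ → ℝ → ℝ := trig D 0 fun g => pr (coef K u g)

variable {K}

theorem wt_mul_abs_le {pr : Vec →L[ℝ] ℝ} (hpr : ∀ a, |pr a| ≤ ‖a‖) (u : Seq) (g : Mode) :
    wt K g * |pr (coef K u g)| ≤ ‖u g‖ := by
  rw [← wt_mul_norm_coef K u g]
  exact mul_le_mul_of_nonneg_left (hpr _) (wt_pos K g).le

theorem summable_wt_mul {pr : Vec →L[ℝ] ℝ} (hpr : ∀ a, |pr a| ≤ ‖a‖) (u : Seq) :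
    Summable fun g => wt K g * |pr (coef K u g)| :=
  Summable.of_nonneg_of_le (fun g => mul_nonneg (wt_pos K g).le (abs_nonneg _))
    (wt_mul_abs_le hpr u) (summable_norm_seq u)

theorem decay_coef {pr : Vec →L[ℝ] ℝ} (hpr : ∀ a, |pr a| ≤ ‖a‖) (u : Seq) :
    Decay K fun g => pr (coef K u g) := summable_wt_mul hpr u

theorem summable_abs_coef {pr : Vec →L[ℝ] ℝ} (hpr : ∀ a, |pr a| ≤ ‖a‖) (u : Seq) :
    Summable fun g => |pr (coef K u g)| := (decay_coef hpr u).summable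

variable {D}

theorem field_eq (pr : Vec →L[ℝ] ℝ) (u : Seq) (x₁ x₂ t : ℝ) :
    field D K pr u x₁ x₂ t = ∑' g, pr (coef K u g) * Real.cos (angle D x₁ x₂ t g) := by
  simp [field, trig]

theorem hasSum_field {pr : Vec →L[ℝ] ℝ} (hpr : ∀ a, |pr a| ≤ ‖a‖) (u : Seq) (x₁ x₂ t : ℝ) :
    HasSum (fun g => pr (coef K u g) * Real.cos (angle D x₁ x₂ t g))
      (field D K pr u x₁ x₂ t) := by
  rw [field_eq]
  exact (summable_mul_cos (summable_abs_coef hpr u) _).hasSum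

theorem abs_field_le {pr : Vec →L[ℝ] ℝ} (hpr : ∀ a, |pr a| ≤ ‖a‖) (u : Seq) (x₁ x₂ t : ℝ) :
    |field D K pr u x₁ x₂ t| ≤ ‖u‖ := by
  rw [field_eq, norm_seq_eq, ← Real.norm_eq_abs]
  refine tsum_of_norm_bounded (summable_norm_seq u).hasSum fun g => ?_
  rw [norm_mul, Real.norm_eq_abs, Real.norm_eq_abs]
  exact (mul_le_of_le_one_right (abs_nonneg _) (Real.abs_cos_le_one _)).trans
    ((hpr _).trans (norm_coef_le K u g))

theorem field_add {pr : Vec →L[ℝ] ℝ} (hpr : ∀ a, |pr a| ≤ ‖a‖) (u v : Seq) (x₁ x₂ t : ℝ) :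
    field D K pr (u + v) x₁ x₂ t = field D K pr u x₁ x₂ t + field D K pr v x₁ x₂ t := by
  refine (hasSum_field hpr (u + v) x₁ x₂ t).unique ?_
  refine hasSum_of_eq ((hasSum_field hpr u x₁ x₂ t).add (hasSum_field hpr v x₁ x₂ t))
    (fun g => ?_) rfl
  rw [coef_add, map_add, add_mul]

theorem field_sub {pr : Vec →L[ℝ] ℝ} (hpr : ∀ a, |pr a| ≤ ‖a‖) (u v : Seq) (x₁ x₂ t : ℝ) :
    field D K pr (u - v) x₁ x₂ t = field D K pr u x₁ x₂ t - field D K pr v x₁ x₂ t := by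
  refine (hasSum_field hpr (u - v) x₁ x₂ t).unique ?_
  refine hasSum_of_eq ((hasSum_field hpr u x₁ x₂ t).sub (hasSum_field hpr v x₁ x₂ t))
    (fun g => ?_) rfl
  rw [coef_sub, map_sub, sub_mul]

theorem field_smul {pr : Vec →L[ℝ] ℝ} (hpr : ∀ a, |pr a| ≤ ‖a‖) (c : ℝ) (u : Seq)
    (x₁ x₂ t : ℝ) : field D K pr (c • u) x₁ x₂ t = c * field D K pr u x₁ x₂ t := by
  refine (hasSum_field hpr (c • u) x₁ x₂ t).unique ?_
  refine hasSum_of_eq ((hasSum_field hpr u x₁ x₂ t).mul_left c) (fun g => ?_) rfl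
  rw [coef_smul, map_smul, smul_eq_mul, mul_assoc]

theorem field_bas (pr : Vec →L[ℝ] ℝ) (g : Mode) (a : Vec)
    (x₁ x₂ t : ℝ) : field D K pr (bas K g a) x₁ x₂ t = pr a * Real.cos (angle D x₁ x₂ t g) := by
  rw [field_eq, tsum_eq_single g]
  · rw [coef_bas, if_pos rfl]
  · intro h hh
    rw [coef_bas, if_neg hh, map_zero, zero_mul]

/-- A field as a continuous linear functional of the coefficients. -/
theorem hasSum_field_comp {ι : Type*} {f : ι → Seq} {u : Seq} (hf : HasSum f u)
    {pr : Vec →L[ℝ] ℝ} (hpr : ∀ a, |pr a| ≤ ‖a‖) (x₁ x₂ t : ℝ) :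
    HasSum (fun i => field D K pr (f i) x₁ x₂ t) (field D K pr u x₁ x₂ t) := by
  let L : Seq →L[ℝ] ℝ := LinearMap.mkContinuous
    { toFun := fun u => field D K pr u x₁ x₂ t
      map_add' := fun u v => field_add hpr u v x₁ x₂ t
      map_smul' := fun c u => field_smul hpr c u x₁ x₂ t } 1
    (fun u => by rw [one_mul]; exact abs_field_le hpr u x₁ x₂ t)
  exact hf.mapL L

theorem coef_neg_of_symSpace {u : Seq} (hu : u ∈ symSpace K) (g : Mode) :
    coef K u (spaceFlip (timeFlip g)) = coef K u g := by
  rw [hu.1, hu.2, conjVec_conjVec]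

theorem involutive_negMode : Function.Involutive fun g : Mode => spaceFlip (timeFlip g) := by
  intro g; simp [spaceFlip, timeFlip]

/-- The reflection of all three indices preserves the coefficients and changes the sign of the sine,
so the sum equals its opposite. -/
theorem hasSum_mul_sin_zero {c : Mode → ℝ} (hc : Summable fun g => |c g|)
    (hs : ∀ g, c (spaceFlip (timeFlip g)) = c g) (x₁ x₂ t : ℝ) :
    HasSum (fun g => c g * Real.sin (angle D x₁ x₂ t g)) 0 := by
  have h1 := (summable_mul_sin hc fun g => angle D x₁ x₂ t g).hasSum
  have h2 := h1.neg
  let e : Mode ≃ Mode := involutive_negMode.toPerm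
  rw [← e.hasSum_iff] at h2
  have h3 : ((fun g => -(c g * Real.sin (angle D x₁ x₂ t g))) ∘ e)
      = fun g => c g * Real.sin (angle D x₁ x₂ t g) := by
    funext g
    change -(c (spaceFlip (timeFlip g)) * Real.sin (angle D x₁ x₂ t (spaceFlip (timeFlip g)))) = _
    rw [hs, angle_neg, Real.sin_neg]; ring
  rw [h3] at h2
  have h4 := h1.unique h2
  have h5 : ∑' g, c g * Real.sin (angle D x₁ x₂ t g) = 0 := by linarith
  rwa [h5] at h1

theorem hasSum_mul_prod {f f' : Mode → ℝ} {a a' : ℝ} (hf : HasSum f a) (hf' : HasSum f' a') :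
    HasSum (fun x : Mode × Mode => f x.1 * f' x.2) (a * a') := by
  have h1 : Summable fun g => ‖f g‖ := summable_norm_iff.2 hf.summable
  have h2 : Summable fun g => ‖f' g‖ := summable_norm_iff.2 hf'.summable
  exact hf.mul hf' (summable_mul_of_summable_norm h1 h2)

/-- In `cos (a + b) = cos a cos b - sin a sin b` the product of sines sums to zero, since one of its
factors does. This is why convolving real cosine coefficients represents the pointwise product. -/
theorem hasSum_mul_cos_add {c d : Mode → ℝ} (hc : Summable fun g => |c g|)
    (hd : Summable fun g => |d g|) (hcs : ∀ g, c (spaceFlip (timeFlip g)) = c g)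
    {x₁ x₂ t a b : ℝ} (ha : HasSum (fun g => c g * Real.cos (angle D x₁ x₂ t g)) a)
    (hb : HasSum (fun g => d g * Real.cos (angle D x₁ x₂ t g)) b) :
    HasSum (fun x : Mode × Mode => c x.1 * d x.2 * Real.cos (angle D x₁ x₂ t (x.1 + x.2)))
      (a * b) := by
  have hs := summable_mul_sin hd fun g => angle D x₁ x₂ t g
  have h0 := hasSum_mul_sin_zero (D := D) hc hcs x₁ x₂ t
  have h1 := hasSum_mul_prod ha hb
  have h2 := hasSum_mul_prod h0 hs.hasSum
  refine hasSum_of_eq (h1.sub h2) (fun x => ?_) (by ring)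
  rw [angle_add, Real.cos_add]; ring

theorem field_quad_aux {u : Seq} (hu : u ∈ symSpace K) {pr pr' : Vec →L[ℝ] ℝ}
    (hpr : ∀ a, |pr a| ≤ ‖a‖) (hpr' : ∀ a, |pr' a| ≤ ‖a‖) (x₁ x₂ t : ℝ) :
    HasSum (fun x : Mode × Mode => pr (coef K u x.1) * pr' (coef K u x.2)
      * Real.cos (angle D x₁ x₂ t (x.1 + x.2)))
      (field D K pr u x₁ x₂ t * field D K pr' u x₁ x₂ t) :=
  hasSum_mul_cos_add (summable_abs_coef hpr u) (summable_abs_coef hpr' u)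
    (fun g => by rw [coef_neg_of_symSpace hu]) (hasSum_field hpr u x₁ x₂ t)
    (hasSum_field hpr' u x₁ x₂ t)

theorem hasSum_field_quad (u : Seq) {pr : Vec →L[ℝ] ℝ} (hpr : ∀ a, |pr a| ≤ ‖a‖) (x₁ x₂ t : ℝ) :
    HasSum (fun x : Mode × Mode => pr (interact (coef K u x.1) (coef K u x.2))
      * Real.cos (angle D x₁ x₂ t (x.1 + x.2))) (field D K pr (quad K u u) x₁ x₂ t) := by
  have h := hasSum_field_comp (D := D) (K := K) (hasSum_quad K u u) hpr x₁ x₂ t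
  simpa only [field_bas] using h

theorem field_comp₀_quad {u : Seq} (hu : u ∈ symSpace K) (x₁ x₂ t : ℝ) :
    field D K comp₀ (quad K u u) x₁ x₂ t
      = 1 / 2 * (field D K comp₁ u x₁ x₂ t ^ 2 + field D K comp₂ u x₁ x₂ t ^ 2) := by
  refine (hasSum_field_quad u abs_comp₀_le x₁ x₂ t).unique ?_
  refine hasSum_of_eq (((field_quad_aux hu abs_comp₁_le abs_comp₁_le x₁ x₂ t).add
    (field_quad_aux hu abs_comp₂_le abs_comp₂_le x₁ x₂ t)).mul_left (1 / 2)) (fun x => ?_) (by ring)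
  simp only [interact, comp₀_apply, comp₁_apply, comp₂_apply]; ring

theorem field_comp₁_quad {u : Seq} (hu : u ∈ symSpace K) (x₁ x₂ t : ℝ) :
    field D K comp₁ (quad K u u) x₁ x₂ t
      = field D K comp₀ u x₁ x₂ t * field D K comp₁ u x₁ x₂ t := by
  refine (hasSum_field_quad u abs_comp₁_le x₁ x₂ t).unique ?_
  refine hasSum_of_eq (((field_quad_aux hu abs_comp₀_le abs_comp₁_le x₁ x₂ t).add
    (field_quad_aux hu abs_comp₁_le abs_comp₀_le x₁ x₂ t)).mul_left (1 / 2)) (fun x => ?_) (by ring)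
  simp only [interact, comp₀_apply, comp₁_apply]; ring

theorem field_comp₂_quad {u : Seq} (hu : u ∈ symSpace K) (x₁ x₂ t : ℝ) :
    field D K comp₂ (quad K u u) x₁ x₂ t
      = field D K comp₀ u x₁ x₂ t * field D K comp₂ u x₁ x₂ t := by
  refine (hasSum_field_quad u abs_comp₂_le x₁ x₂ t).unique ?_
  refine hasSum_of_eq (((field_quad_aux hu abs_comp₀_le abs_comp₂_le x₁ x₂ t).add
    (field_quad_aux hu abs_comp₂_le abs_comp₀_le x₁ x₂ t)).mul_left (1 / 2)) (fun x => ?_) (by ring)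
  simp only [interact, comp₀_apply, comp₂_apply]; ring

/-! ### The system in Fourier variables -/

variable (D)

/-- The time frequency times the symbol of `1 - ω Δ`. -/
def disp (g : Mode) : ℝ := g.2.2 * (1 + D.ω * waveSq D g)

/-- The Boussinesq system, mode by mode. -/
def SolvesFourier (K : ℕ) (β : ℝ) (u : Seq) : Prop := ∀ g,
  disp D g * (coef K u g).1
      + β * (wave₁ D g * ((coef K u g).2.1 + (coef K (quad K u u) g).2.1)
        + wave₂ D g * ((coef K u g).2.2 + (coef K (quad K u u) g).2.2)) = 0 ∧
  disp D g * (coef K u g).2.1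
      + β * wave₁ D g * ((coef K u g).1 + (coef K (quad K u u) g).1) = 0 ∧
  disp D g * (coef K u g).2.2
      + β * wave₂ D g * ((coef K u g).1 + (coef K (quad K u u) g).1) = 0

variable {D}

theorem trig_zero (r : ℕ) (x₁ x₂ t : ℝ) : trig D r (fun _ => 0) x₁ x₂ t = 0 := by
  simp [trig]

/-- Every term has an odd number of derivatives, and a Laplacian only multiplies coefficients by
`-|p|²`. All terms thus become series with the same phase shift, and each equation reduces to the
vanishing of one combination of coefficients. -/
theorem solvesBoussinesq_of_fourier (hK : 3 ≤ K) {β : ℝ} {u : Seq} (hu : u ∈ symSpace K)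
    (h : SolvesFourier D K β u) :
    D.SolvesBoussinesq β (field D K comp₀ u) (field D K comp₁ u) (field D K comp₂ u) := by
  have dec : ∀ {pr : Vec →L[ℝ] ℝ}, (∀ a, |pr a| ≤ ‖a‖) → ∀ v : Seq,
      Decay 3 fun g => pr (coef K v g) := fun hpr v => (decay_coef hpr v).of_le hK
  have F0 : (fun x y r => field D K comp₁ u x y r ^ 2 + field D K comp₂ u x y r ^ 2)
      = trig D 0 fun g => 2 * comp₀ (coef K (quad K u u) g) := by
    funext x y r
    rw [trig_const_mul]
    have := field_comp₀_quad (D := D) hu x y r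
    rw [field] at this
    rw [this]; ring
  have F1 : (fun x y r => field D K comp₀ u x y r * field D K comp₁ u x y r)
      = field D K comp₁ (quad K u u) := by
    funext x y r; rw [field_comp₁_quad hu]
  have F2 : (fun x y r => field D K comp₀ u x y r * field D K comp₂ u x y r)
      = field D K comp₂ (quad K u u) := by
    funext x y r; rw [field_comp₂_quad hu]
  refine ⟨isC3_trig (dec abs_comp₀_le u), isC3_trig (dec abs_comp₁_le u),
    isC3_trig (dec abs_comp₂_le u), fun x₁ x₂ t => ?_⟩
  rw [F0, F1, F2]
  unfold field
  have d0 := dec abs_comp₀_le u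
  have d1 := dec abs_comp₁_le u
  have d2 := dec abs_comp₂_le u
  have q0 := (dec abs_comp₀_le (quad K u u)).const_mul 2
  have q1 := dec abs_comp₁_le (quad K u u)
  have q2 := dec abs_comp₂_le (quad K u u)
  rw [dt_trig (j := 2) d0, dt_trig (j := 2) d1, dt_trig (j := 2) d2, dx₁_trig (j := 2) d0,
    dx₂_trig (j := 2) d0, dx₁_trig (j := 2) d1, dx₂_trig (j := 2) d2, dx₁_trig (j := 2) q1,
    dx₂_trig (j := 2) q2, dx₁_trig (j := 2) q0, dx₂_trig (j := 2) q0,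
    lap_trig (j := 0) (Decay.mul (j := 2) d0 (abs_time_le D)),
    lap_trig (j := 0) (Decay.mul (j := 2) d1 (abs_time_le D)),
    lap_trig (j := 0) (Decay.mul (j := 2) d2 (abs_time_le D))]
  -- The term with `Δ ∂ₜ` has order three and uses up the whole decay.
  have dl : ∀ {c : Mode → ℝ}, Decay 3 c → Decay 0 fun g => -(waveSq D g) * (g.2.2 * c g) := by
    intro c hc
    have e1 := (((hc.mul (j := 2) (abs_time_le D)).mul (j := 1) (abs_wave₁_le D)).mul (j := 0)
      (abs_wave₁_le D)).const_mul (-1)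
    have e2 := (((hc.mul (j := 2) (abs_time_le D)).mul (j := 1) (abs_wave₂_le D)).mul (j := 0)
      (abs_wave₂_le D)).const_mul (-1)
    have e3 : (fun g : Mode => -(waveSq D g) * (g.2.2 * c g)) = fun g =>
        -1 * (wave₁ D g * (wave₁ D g * (g.2.2 * c g)))
          + -1 * (wave₂ D g * (wave₂ D g * (g.2.2 * c g))) := by
      funext g; simp only [waveSq]; ring
    rw [e3]
    exact e1.add e2
  have comb : ∀ {a b c e : Mode → ℝ} (A B C : ℝ), Decay 0 a → Decay 0 b → Decay 0 c → Decay 0 e →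
      (∀ g, a g + A * b g + B * c g - C * e g = 0) →
      trig D (0 + 1) a x₁ x₂ t + A * trig D (0 + 1) b x₁ x₂ t + B * trig D (0 + 1) c x₁ x₂ t
        - C * trig D (0 + 1) e x₁ x₂ t = 0 := by
    intro a b c e A B C ha hb hc he hz
    have e1 := trig_add (D := D) (r := 0 + 1) ((ha.add (hb.const_mul A)).add (hc.const_mul B))
      (he.const_mul (-C)) x₁ x₂ t
    rw [trig_add (ha.add (hb.const_mul A)) (hc.const_mul B), trig_add ha (hb.const_mul A),
      trig_const_mul, trig_const_mul, trig_const_mul] at e1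
    have e2 : (fun g => a g + A * b g + B * c g + -C * e g) = fun _ => 0 := by
      funext g; rw [← hz g]; ring
    rw [e2, trig_zero] at e1
    linarith
  have t0 := (d0.mul (j := 2) (abs_time_le D)).of_le (Nat.zero_le 2)
  have t1 := (d1.mul (j := 2) (abs_time_le D)).of_le (Nat.zero_le 2)
  have t2 := (d2.mul (j := 2) (abs_time_le D)).of_le (Nat.zero_le 2)
  have w1 : ∀ {c : Mode → ℝ}, Decay 3 c → Decay 0 fun g => wave₁ D g * c g := fun hc =>
    (hc.mul (j := 2) (abs_wave₁_le D)).of_le (Nat.zero_le 2)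
  have w2 : ∀ {c : Mode → ℝ}, Decay 3 c → Decay 0 fun g => wave₂ D g * c g := fun hc =>
    (hc.mul (j := 2) (abs_wave₂_le D)).of_le (Nat.zero_le 2)
  refine ⟨?_, ?_, ?_⟩
  · rw [← trig_add (w1 d1) (w2 d2), ← trig_add (w1 q1) (w2 q2)]
    refine comb _ _ _ t0 ((w1 d1).add (w2 d2)) ((w1 q1).add (w2 q2)) (dl d0) fun g => ?_
    have := (h g).1
    simp only [comp₀_apply, comp₁_apply, comp₂_apply]
    rw [← this, disp]; ring
  · refine comb _ _ _ t1 (w1 d0) (w1 q0) (dl d1) fun g => ?_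
    have := (h g).2.1
    simp only [comp₀_apply, comp₁_apply]
    rw [← this, disp]; ring
  · refine comb _ _ _ t2 (w2 d0) (w2 q0) (dl d2) fun g => ?_
    have := (h g).2.2
    simp only [comp₀_apply, comp₂_apply]
    rw [← this, disp]; ring

end StandingWave
end

noncomputable section
namespace StandingWave

/-! ### Membership in the Sobolev spaces -/

variable {D : StandingWaveData} {K : ℕ}

/-- A time frequency `m > 0` comes from the two modes `m` and `-m`, but `m = 0` from a single one;
hence the weights `2` and `1`. -/
theorem hasSum_fold {f : ℤ × ℤ × ℕ → ℂ} {S : ℂ}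
    (h : HasSum (fun g : Mode => f (g.1, g.2.1, g.2.2.natAbs)) S) :
    HasSum (fun n : ℤ × ℤ × ℕ => (if n.2.2 = 0 then 1 else 2) * f n) S := by
  let π : Mode → ℤ × ℤ × ℕ := fun g => (g.1, g.2.1, g.2.2.natAbs)
  rw [← (Equiv.sigmaFiberEquiv π).hasSum_iff] at h
  refine h.sigma fun n => ?_
  change HasSum ((fun g : Mode => f (π g)) ∘ ((↑) : {g : Mode | π g = n} → Mode)) _
  rw [hasSum_subtype_iff_indicator]
  obtain ⟨a, b, m⟩ := n
  have hout : ∀ g ∉ ({(a, b, (m : ℤ)), (a, b, -(m : ℤ))} : Finset Mode),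
      Set.indicator {g : Mode | π g = (a, b, m)} (fun g => f (π g)) g = 0 := by
    rintro ⟨a', b', m'⟩ hg
    refine Set.indicator_of_notMem (fun hmem => hg ?_) _
    simp only [π, Set.mem_ofPred_eq, Prod.mk.injEq] at hmem
    obtain ⟨rfl, rfl, hm⟩ := hmem
    simp only [Finset.mem_insert, Finset.mem_singleton, Prod.mk.injEq, true_and]
    omega
  refine hasSum_of_eq (hasSum_sum_of_ne_finset_zero hout) (fun _ => rfl) ?_
  have hin : ∀ g ∈ ({(a, b, (m : ℤ)), (a, b, -(m : ℤ))} : Finset Mode),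
      Set.indicator {g : Mode | π g = (a, b, m)} (fun g => f (π g)) g = f (a, b, m) := by
    intro g hg
    have : π g = (a, b, m) := by
      simp only [Finset.mem_insert, Finset.mem_singleton] at hg
      rcases hg with rfl | rfl <;> simp [π]
    rw [Set.indicator_of_mem (by exact this), this]
  rw [Finset.sum_congr rfl hin, Finset.sum_const]
  by_cases hm : m = 0
  · simp [hm]
  · rw [Finset.card_pair]
    · simp [hm]
    · intro hh
      simp only [Prod.mk.injEq, true_and] at hh
      omega

theorem phase_mul_exp (g : Mode) (x₁ x₂ t : ℝ) :
    D.phase g.1 g.2.1 x₁ x₂ * Complex.exp (Complex.I * (g.2.2 * t))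
      = Real.cos (angle D x₁ x₂ t g) + Complex.I * Real.sin (angle D x₁ x₂ t g) := by
  rw [StandingWaveData.phase, ← Complex.exp_add, Complex.ofReal_cos, Complex.ofReal_sin,
    mul_comm Complex.I (Complex.sin _), ← Complex.exp_mul_I]
  congr 1
  simp only [angle, wave₁, wave₂]
  push_cast; ring

theorem hasSum_exp {c : Mode → ℝ} (hc : Summable fun g => |c g|)
    (hs : ∀ g, c (spaceFlip (timeFlip g)) = c g) (x₁ x₂ t : ℝ) :
    HasSum (fun g => (c g : ℂ) * (D.phase g.1 g.2.1 x₁ x₂ * Complex.exp (Complex.I * (g.2.2 * t))))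
      (trig D 0 c x₁ x₂ t : ℂ) := by
  have h1 : HasSum (fun g => c g * Real.cos (angle D x₁ x₂ t g)) (trig D 0 c x₁ x₂ t) := by
    have := (summable_mul_cos hc fun g => angle D x₁ x₂ t g).hasSum
    simpa [trig] using this
  have h2 := hasSum_mul_sin_zero (D := D) hc hs x₁ x₂ t
  have h3 := (Complex.hasSum_ofReal.2 h1).add ((Complex.hasSum_ofReal.2 h2).mul_left Complex.I)
  rw [Complex.ofReal_zero, mul_zero, add_zero] at h3
  refine h3.congr_fun fun g => ?_
  rw [phase_mul_exp]; push_cast; ring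

/-- Coefficients of the series over `m ≥ 0` obtained by grouping the modes `m` and `-m`. -/
def foldCoef (ε : ℂ) (c : Mode → ℝ) (n : ℤ × ℤ × ℕ) : ℂ :=
  (if n.2.2 = 0 then 1 else 2) * (ε * c (n.1, n.2.1, n.2.2))

/-- The same series reindexed by time reflection. Its average with the original one replaces the
time exponentials by cosines, or by `I` times sines when the coefficients are odd in time. -/
theorem hasSum_exp_timeFlip {c : Mode → ℝ} (hc : Summable fun g => |c g|)
    (hs : ∀ g, c (spaceFlip (timeFlip g)) = c g) (x₁ x₂ t : ℝ) :
    HasSum (fun g => (c (timeFlip g) : ℂ) * (D.phase g.1 g.2.1 x₁ x₂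
      * Complex.exp (-(Complex.I * (g.2.2 * t))))) (trig D 0 c x₁ x₂ t : ℂ) := by
  have h := hasSum_exp (D := D) hc hs x₁ x₂ t
  let e : Mode ≃ Mode := ⟨timeFlip, timeFlip, timeFlip_timeFlip, timeFlip_timeFlip⟩
  rw [← e.hasSum_iff] at h
  refine h.congr_fun fun g => ?_
  change _ = (c (timeFlip g) : ℂ) * (D.phase g.1 g.2.1 x₁ x₂
      * Complex.exp (Complex.I * (((-g.2.2 : ℤ) : ℂ) * t)))
  push_cast
  rw [neg_mul, mul_neg]

theorem hasSum_half_add {ι : Type*} {f f' : ι → ℂ} {a : ℂ} (h : HasSum f a) (h' : HasSum f' a) :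
    HasSum (fun i => 1 / 2 * (f i + f' i)) a := by
  have h2 : HasSum (fun i => 1 / 2 * (f i + f' i)) (1 / 2 * (a + a)) := (h.add h').mul_left (1 / 2)
  have h3 : 1 / 2 * (a + a) = a := by ring
  rwa [h3] at h2

theorem coef_mul_cos_natAbs {c : Mode → ℝ} (ht : ∀ g, c (timeFlip g) = c g) (a b m : ℤ) (t : ℝ) :
    c (a, b, (m.natAbs : ℤ)) * Real.cos ((m.natAbs : ℝ) * t) = c (a, b, m) * Real.cos (m * t) := by
  rcases Int.natAbs_eq m with hm | hm
  · generalize m.natAbs = k at hm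
    subst hm
    simp
  · generalize m.natAbs = k at hm
    subst hm
    rw [show c (a, b, -(k : ℤ)) = c (a, b, k) from ht (a, b, k)]
    push_cast
    rw [neg_mul, Real.cos_neg]

theorem coef_mul_sin_natAbs {c : Mode → ℝ} (ht : ∀ g, c (timeFlip g) = -c g) (a b m : ℤ) (t : ℝ) :
    c (a, b, (m.natAbs : ℤ)) * Real.sin ((m.natAbs : ℝ) * t) = c (a, b, m) * Real.sin (m * t) := by
  rcases Int.natAbs_eq m with hm | hm
  · generalize m.natAbs = k at hm
    subst hm
    simp
  · generalize m.natAbs = k at hm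
    subst hm
    rw [show c (a, b, -(k : ℤ)) = -c (a, b, k) from ht (a, b, k)]
    push_cast
    rw [neg_mul _ t, Real.sin_neg, neg_mul_neg]

theorem half_exp_add (z : ℂ) :
    1 / 2 * (Complex.exp (Complex.I * z) + Complex.exp (-(Complex.I * z))) = Complex.cos z := by
  rw [Complex.cos, neg_mul, mul_comm Complex.I z]; ring

theorem half_exp_sub (z : ℂ) :
    1 / 2 * (Complex.exp (Complex.I * z) - Complex.exp (-(Complex.I * z)))
      = Complex.I * Complex.sin z := by
  rw [Complex.sin, neg_mul, mul_comm Complex.I z]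
  linear_combination (-(1 / 2) * (Complex.exp (-(z * Complex.I)) - Complex.exp (z * Complex.I))) *
    Complex.I_mul_I

theorem hasCosSeries_fold {c : Mode → ℝ} (hc : Summable fun g => |c g|)
    (hs : ∀ g, c (spaceFlip g) = c g) (ht : ∀ g, c (timeFlip g) = c g) :
    D.HasCosSeries (foldCoef 1 c) (trig D 0 c) := by
  intro x₁ x₂ t
  have hst : ∀ g, c (spaceFlip (timeFlip g)) = c g := fun g => by rw [hs, ht]
  have h := hasSum_half_add (hasSum_exp (D := D) hc hst x₁ x₂ t)
    (hasSum_exp_timeFlip (D := D) hc hst x₁ x₂ t)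
  let f : ℤ × ℤ × ℕ → ℂ := fun n => D.phase n.1 n.2.1 x₁ x₂
    * ((c (n.1, n.2.1, n.2.2) * Real.cos ((n.2.2 : ℝ) * t) : ℝ) : ℂ)
  have h' : HasSum (fun g : Mode => f (g.1, g.2.1, g.2.2.natAbs)) (trig D 0 c x₁ x₂ t : ℂ) := by
    refine h.congr_fun fun g => ?_
    change D.phase g.1 g.2.1 x₁ x₂
      * ((c (g.1, g.2.1, (g.2.2.natAbs : ℤ)) * Real.cos ((g.2.2.natAbs : ℝ) * t) : ℝ) : ℂ) = _
    rw [coef_mul_cos_natAbs ht, ht g]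
    push_cast
    rw [← half_exp_add]
    ring
  refine (hasSum_fold (f := f) h').congr_fun fun n => ?_
  simp only [f, foldCoef, Complex.ofReal_mul]; ring

theorem hasSinSeries_fold {c : Mode → ℝ} (hc : Summable fun g => |c g|)
    (hs : ∀ g, c (spaceFlip g) = -c g) (ht : ∀ g, c (timeFlip g) = -c g) :
    D.HasSinSeries (foldCoef Complex.I c) (trig D 0 c) := by
  refine ⟨fun a b => ?_, fun x₁ x₂ t => ?_⟩
  · have := ht (a, b, 0)
    simp only [timeFlip, neg_zero] at this
    have h0 : c (a, b, 0) = 0 := by linarith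
    simp [foldCoef, h0]
  have hst : ∀ g, c (spaceFlip (timeFlip g)) = c g := fun g => by rw [hs, ht, neg_neg]
  have h := hasSum_half_add (hasSum_exp (D := D) hc hst x₁ x₂ t)
    (hasSum_exp_timeFlip (D := D) hc hst x₁ x₂ t)
  let f : ℤ × ℤ × ℕ → ℂ := fun n => Complex.I * D.phase n.1 n.2.1 x₁ x₂
    * ((c (n.1, n.2.1, n.2.2) * Real.sin ((n.2.2 : ℝ) * t) : ℝ) : ℂ)
  have h' : HasSum (fun g : Mode => f (g.1, g.2.1, g.2.2.natAbs)) (trig D 0 c x₁ x₂ t : ℂ) := by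
    refine h.congr_fun fun g => ?_
    change Complex.I * D.phase g.1 g.2.1 x₁ x₂
      * ((c (g.1, g.2.1, (g.2.2.natAbs : ℤ)) * Real.sin ((g.2.2.natAbs : ℝ) * t) : ℝ) : ℂ) = _
    rw [coef_mul_sin_natAbs ht, ht g]
    push_cast
    linear_combination -(D.phase g.1 g.2.1 x₁ x₂ * c (g.1, g.2.1, g.2.2))
      * half_exp_sub (g.2.2 * t)
  refine (hasSum_fold (f := f) h').congr_fun fun n => ?_
  simp only [f, foldCoef, Complex.ofReal_mul]; ring

theorem norm_foldCoef_le {ε : ℂ} (hε : ‖ε‖ = 1) (c : Mode → ℝ) (n : ℤ × ℤ × ℕ) :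
    ‖foldCoef ε c n‖ ≤ 2 * |c (n.1, n.2.1, n.2.2)| := by
  rw [foldCoef, norm_mul, norm_mul, hε, one_mul, Complex.norm_real, Real.norm_eq_abs]
  refine mul_le_mul_of_nonneg_right ?_ (abs_nonneg _)
  split_ifs <;> simp

/-- Comparison constant between the weighted summable norm and the Sobolev norm. -/
def sobolevConst (D : StandingWaveData) (s : ℝ) : ℝ := 2 * (2 * symbolBound D) ^ s

theorem sobolevConst_pos (D : StandingWaveData) (s : ℝ) : 0 < sobolevConst D s := by
  have := one_le_symbolBound D
  unfold sobolevConst; positivity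

/-- Each of the four terms of the Sobolev weight is at most `(symbolBound D * size) ^ 2`, so their
sum is at most the square of `2 * symbolBound D * size`. The remaining factor `2` in `sobolevConst`
comes from folding `m` and `-m`. -/
theorem sobolevTerm_fold_le {s : ℝ} (hs : 0 ≤ s) (hsK : s ≤ K) {ε : ℂ} (hε : ‖ε‖ = 1)
    (c : Mode → ℝ) (n : ℤ × ℤ × ℕ) :
    D.sobolevTerm s (foldCoef ε c) n ≤
      (sobolevConst D s * (wt K (n.1, n.2.1, n.2.2) * |c (n.1, n.2.1, n.2.2)|)) ^ 2 := by
  set g : Mode := (n.1, n.2.1, n.2.2)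
  have hB := one_le_symbolBound D
  have hg := one_le_size g
  have e1 := sq_le_sq' (neg_le_of_abs_le (abs_wave₁_le D g)) (le_of_abs_le (abs_wave₁_le D g))
  have e2 := sq_le_sq' (neg_le_of_abs_le (abs_wave₂_le D g)) (le_of_abs_le (abs_wave₂_le D g))
  have e3 := sq_le_sq' (neg_le_of_abs_le (abs_time_le D g)) (le_of_abs_le (abs_time_le D g))
  have e4 : 1 ≤ (symbolBound D * size g) ^ 2 :=
    one_le_pow₀ (one_le_mul_of_one_le_of_one_le hB hg)
  have hbase : 1 + D.p₁ n.1 n.2.1 ^ 2 + D.p₂ n.1 n.2.1 ^ 2 + (n.2.2 : ℝ) ^ 2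
      ≤ (2 * symbolBound D * size g) ^ 2 := by
    have : ((g.2.2 : ℤ) : ℝ) = (n.2.2 : ℝ) := by simp [g]
    rw [this] at e3
    change D.p₁ n.1 n.2.1 ^ 2 ≤ _ at e1
    change D.p₂ n.1 n.2.1 ^ 2 ≤ _ at e2
    linarith
  have hpos : 0 ≤ 2 * symbolBound D * size g := by positivity
  have h1 : (1 + D.p₁ n.1 n.2.1 ^ 2 + D.p₂ n.1 n.2.1 ^ 2 + (n.2.2 : ℝ) ^ 2) ^ s
      ≤ ((2 * symbolBound D) ^ s * wt K g) ^ 2 := by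
    refine (Real.rpow_le_rpow (by positivity) hbase hs).trans ?_
    rw [← Real.rpow_natCast, ← Real.rpow_mul hpos, mul_comm _ s, Real.rpow_mul hpos,
      Real.rpow_natCast]
    refine pow_le_pow_left₀ (Real.rpow_nonneg hpos _) ?_ 2
    rw [Real.mul_rpow (by positivity) (by positivity)]
    refine mul_le_mul_of_nonneg_left ?_ (by positivity)
    rw [wt, ← Real.rpow_natCast]
    exact Real.rpow_le_rpow_of_exponent_le hg hsK
  have h2 : ‖foldCoef ε c n‖ ^ 2 ≤ (2 * |c g|) ^ 2 :=
    pow_le_pow_left₀ (norm_nonneg _) (norm_foldCoef_le hε c n) 2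
  calc D.sobolevTerm s (foldCoef ε c) n
      ≤ ((2 * symbolBound D) ^ s * wt K g) ^ 2 * (2 * |c g|) ^ 2 :=
        mul_le_mul h1 h2 (by positivity) (by positivity)
    _ = _ := by rw [sobolevConst]; ring

/-- The embedding of ℓ¹ in ℓ²: the sum of the squares is at most the supremum times the sum, both of
which are bounded by `‖u‖`. -/
theorem sobolev_fold {s : ℝ} (hs : 0 ≤ s) (hsK : s ≤ K) {ε : ℂ} (hε : ‖ε‖ = 1)
    {pr : Vec →L[ℝ] ℝ} (hpr : ∀ a, |pr a| ≤ ‖a‖) (u : Seq) :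
    Summable (D.sobolevTerm s (foldCoef ε fun g => pr (coef K u g))) ∧
      √(∑' n, D.sobolevTerm s (foldCoef ε fun g => pr (coef K u g)) n)
        ≤ sobolevConst D s * ‖u‖ := by
  let j : ℤ × ℤ × ℕ → Mode := fun n => (n.1, n.2.1, n.2.2)
  have hj : Function.Injective j := by
    rintro ⟨a, b, m⟩ ⟨a', b', m'⟩ h
    simpa [j] using h
  let f : Mode → ℝ := fun g => wt K g * |pr (coef K u g)|
  have hf0 : ∀ g, 0 ≤ f g := fun g => mul_nonneg (wt_pos K g).le (abs_nonneg _)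
  have hf : Summable f := summable_wt_mul hpr u
  have hfu : ∑' g, f g ≤ ‖u‖ := by
    rw [norm_seq_eq]
    exact hf.tsum_le_tsum (wt_mul_abs_le hpr u) (summable_norm_seq u)
  have hle : ∀ n, f (j n) ≤ ‖u‖ := fun n => (hf.le_tsum (j n) fun g _ => hf0 g).trans hfu
  have hfj : Summable fun n => f (j n) := hf.comp_injective hj
  have hfju : ∑' n, f (j n) ≤ ‖u‖ := (tsum_comp_le_tsum_of_inj hf hf0 hj).trans hfu
  have hb : ∀ n, D.sobolevTerm s (foldCoef ε fun g => pr (coef K u g)) n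
      ≤ sobolevConst D s ^ 2 * ‖u‖ * f (j n) := by
    intro n
    refine (sobolevTerm_fold_le hs hsK hε _ n).trans ?_
    change (sobolevConst D s * f (j n)) ^ 2 ≤ _
    rw [mul_pow, mul_assoc, sq (f (j n))]
    exact mul_le_mul_of_nonneg_left (mul_le_mul_of_nonneg_right (hle n) (hf0 _)) (sq_nonneg _)
  have hn : ∀ n, 0 ≤ D.sobolevTerm s (foldCoef ε fun g => pr (coef K u g)) n := fun n => by
    unfold StandingWaveData.sobolevTerm; positivity
  have hsum := Summable.of_nonneg_of_le hn hb (hfj.mul_left _)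
  refine ⟨hsum, Real.sqrt_le_iff.2 ⟨mul_nonneg (sobolevConst_pos D s).le (norm_nonneg _), ?_⟩⟩
  calc _ ≤ ∑' n, sobolevConst D s ^ 2 * ‖u‖ * f (j n) := hsum.tsum_le_tsum hb (hfj.mul_left _)
    _ = sobolevConst D s ^ 2 * ‖u‖ * ∑' n, f (j n) := tsum_mul_left
    _ ≤ sobolevConst D s ^ 2 * ‖u‖ * ‖u‖ := mul_le_mul_of_nonneg_left hfju (by positivity)
    _ = _ := by ring

theorem hasCosSeries_field {u : Seq} (hu : u ∈ symSpace K) :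
    D.HasCosSeries (foldCoef 1 fun g => comp₀ (coef K u g))
    (field D K comp₀ u) :=
  hasCosSeries_fold (summable_abs_coef abs_comp₀_le u) (fun g => by rw [hu.1]; rfl)
    (fun g => by rw [hu.2]; rfl)

theorem hasSinSeries_field₁ {u : Seq} (hu : u ∈ symSpace K) :
    D.HasSinSeries (foldCoef Complex.I fun g => comp₁ (coef K u g))
    (field D K comp₁ u) :=
  hasSinSeries_fold (summable_abs_coef abs_comp₁_le u) (fun g => by rw [hu.1]; rfl)
    (fun g => by rw [hu.2]; rfl)

theorem hasSinSeries_field₂ {u : Seq} (hu : u ∈ symSpace K) :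
    D.HasSinSeries (foldCoef Complex.I fun g => comp₂ (coef K u g))
    (field D K comp₂ u) :=
  hasSinSeries_fold (summable_abs_coef abs_comp₂_le u) (fun g => by rw [hu.1]; rfl)
    (fun g => by rw [hu.2]; rfl)

end StandingWave
end

noncomputable section
namespace StandingWave

/-! ### The bifurcation problem in abstract form -/

section
variable {V : Type*} [NormedAddCommGroup V] [NormedSpace ℝ V]

/-- The unknowns: the sequences `W, y, Z₁, Z₂` and the squared amplitudes `b₁, b₂`. -/
abbrev Unknown (V : Type*) := (V × V) × (V × V) × (ℝ × ℝ)

/-- Operators and vectors entering the bifurcation problem. -/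
structure Bifurcation (V : Type*) [NormedAddCommGroup V] [NormedSpace ℝ V] where
  T : V →L[ℝ] V
  Q : V →L[ℝ] V →L[ℝ] V
  κ₁ : V →L[ℝ] ℝ
  κ₂ : V →L[ℝ] ℝ
  φ₁ : V
  φ₂ : V
  β₀ : ℝ
  e₁ : ℝ
  e₂ : ℝ

namespace Bifurcation
variable (B : Bifurcation V)

/-- Right-hand side for the component of mixed parity. -/
def mixed (μ : ℝ) (X₁ X₂ y W : V) : V :=
  B.T (μ • W + (B.β₀ + μ) • ((2 : ℝ) • B.Q X₁ X₂ + (2 * μ) • B.Q y W))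

/-- Right-hand side for the component of even parity. -/
def even (μ : ℝ) (X₁ X₂ y W : V) (b₁ b₂ : ℝ) : V :=
  B.T (μ • y + (B.β₀ + μ) • (b₁ • B.Q X₁ X₁ + b₂ • B.Q X₂ X₂ + μ • B.Q y y
    + (μ * b₁ * b₂) • B.Q W W))

/-- Right-hand side for a critical component `X`, the other one being `X'`. -/
def critical (μ : ℝ) (X X' y W : V) (b' : ℝ) : V :=
  X + (B.β₀ + μ) • ((2 : ℝ) • B.Q X y + (2 * b') • B.Q X' W)

/-- When `μ = 0` and `y`, `W` are given by their equations, `κ_j (critical) + e_j * b_j` is affine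
in `(b₁, b₂)`. The four numbers `m_ij` form the matrix of its linear part. -/
def m₁₁ : ℝ := 2 * B.β₀ ^ 2 * B.κ₁ (B.Q B.φ₁ (B.T (B.Q B.φ₁ B.φ₁))) + B.e₁

def m₁₂ : ℝ := 2 * B.β₀ ^ 2 * B.κ₁ (B.Q B.φ₁ (B.T (B.Q B.φ₂ B.φ₂)))
  + 4 * B.β₀ ^ 2 * B.κ₁ (B.Q B.φ₂ (B.T (B.Q B.φ₁ B.φ₂)))

def m₂₁ : ℝ := 2 * B.β₀ ^ 2 * B.κ₂ (B.Q B.φ₂ (B.T (B.Q B.φ₁ B.φ₁)))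
  + 4 * B.β₀ ^ 2 * B.κ₂ (B.Q B.φ₁ (B.T (B.Q B.φ₁ B.φ₂)))

def m₂₂ : ℝ := 2 * B.β₀ ^ 2 * B.κ₂ (B.Q B.φ₂ (B.T (B.Q B.φ₂ B.φ₂))) + B.e₂

def det : ℝ := B.m₁₁ * B.m₂₂ - B.m₁₂ * B.m₂₁

/-- The correction to the critical vector carries a factor `μ`, so that for `μ = 0` it does not
depend on the unknowns. -/
def X₁ (x : ℝ × Unknown V) : V := B.φ₁ + x.1 • x.2.2.1.1

def X₂ (x : ℝ × Unknown V) : V := B.φ₂ + x.1 • x.2.2.1.2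

def stepW (x : ℝ × Unknown V) : V := B.mixed x.1 (B.X₁ x) (B.X₂ x) x.2.1.2 x.2.1.1

def stepY (x : ℝ × Unknown V) (b₁ b₂ : ℝ) : V :=
  B.even x.1 (B.X₁ x) (B.X₂ x) x.2.1.2 x.2.1.1 b₁ b₂

/-- The updated `y` and `W` are used here: for `μ = 0` they depend on the unknowns through `b₁, b₂`
only, and so does the residual. -/
def resid₁ (x : ℝ × Unknown V) : ℝ :=
  B.κ₁ (B.critical x.1 (B.X₁ x) (B.X₂ x) (B.stepY x x.2.2.2.1 x.2.2.2.2) (B.stepW x) x.2.2.2.2)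
    + B.e₁ * x.2.2.2.1

def resid₂ (x : ℝ × Unknown V) : ℝ :=
  B.κ₂ (B.critical x.1 (B.X₂ x) (B.X₁ x) (B.stepY x x.2.2.2.1 x.2.2.2.2) (B.stepW x) x.2.2.2.1)
    + B.e₂ * x.2.2.2.2

/-- First component of a Newton step with the matrix frozen at `μ = 0`, inverted by Cramer's rule.
For `μ = 0` the residual is affine in `(b₁, b₂)`, so one step reaches the solution from any starting
point. -/
def stepB₁ (x : ℝ × Unknown V) : ℝ :=
  x.2.2.2.1 - (B.det)⁻¹ * (B.m₂₂ * B.resid₁ x - B.m₁₂ * B.resid₂ x)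

def stepB₂ (x : ℝ × Unknown V) : ℝ :=
  x.2.2.2.2 - (B.det)⁻¹ * (B.m₁₁ * B.resid₂ x - B.m₂₁ * B.resid₁ x)

/-- Recomputed with the new amplitudes, since with the old ones its value at `μ = 0` would still
depend on the unknowns. -/
def newY (x : ℝ × Unknown V) : V := B.stepY x (B.stepB₁ x) (B.stepB₂ x)

/-- The fixed point map. -/
def step (x : ℝ × Unknown V) : Unknown V :=
  ((B.stepW x, B.newY x),
    (B.T (B.critical x.1 (B.X₁ x) (B.X₂ x) (B.newY x) (B.stepW x) (B.stepB₂ x)),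
      B.T (B.critical x.1 (B.X₂ x) (B.X₁ x) (B.newY x) (B.stepW x) (B.stepB₁ x))),
    (B.stepB₁ x, B.stepB₂ x))

theorem contDiff_X₁ : ContDiff ℝ 1 B.X₁ := by unfold X₁; fun_prop

theorem contDiff_X₂ : ContDiff ℝ 1 B.X₂ := by unfold X₂; fun_prop

theorem contDiff_Q {E : Type*} [NormedAddCommGroup E] [NormedSpace ℝ E] {f g : E → V}
    (hf : ContDiff ℝ 1 f) (hg : ContDiff ℝ 1 g) : ContDiff ℝ 1 fun x => B.Q (f x) (g x) :=
  (B.Q.contDiff.comp hf).clm_apply hg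

theorem contDiff_stepW : ContDiff ℝ 1 B.stepW := by
  unfold stepW mixed
  have h1 := B.contDiff_Q B.contDiff_X₁ B.contDiff_X₂
  have h2 : ContDiff ℝ 1 fun x : ℝ × Unknown V => B.Q x.2.1.2 x.2.1.1 :=
    B.contDiff_Q (by fun_prop) (by fun_prop)
  refine B.T.contDiff.comp ?_
  fun_prop

theorem contDiff_stepY {b₁ b₂ : ℝ × Unknown V → ℝ} (hb₁ : ContDiff ℝ 1 b₁)
    (hb₂ : ContDiff ℝ 1 b₂) : ContDiff ℝ 1 fun x => B.stepY x (b₁ x) (b₂ x) := by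
  unfold stepY even
  have h1 := B.contDiff_Q B.contDiff_X₁ B.contDiff_X₁
  have h2 := B.contDiff_Q B.contDiff_X₂ B.contDiff_X₂
  have h3 : ContDiff ℝ 1 fun x : ℝ × Unknown V => B.Q x.2.1.2 x.2.1.2 :=
    B.contDiff_Q (by fun_prop) (by fun_prop)
  have h4 : ContDiff ℝ 1 fun x : ℝ × Unknown V => B.Q x.2.1.1 x.2.1.1 :=
    B.contDiff_Q (by fun_prop) (by fun_prop)
  refine B.T.contDiff.comp ?_
  fun_prop

theorem contDiff_critical {X X' y W : ℝ × Unknown V → V} {b' : ℝ × Unknown V → ℝ}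
    (hX : ContDiff ℝ 1 X) (hX' : ContDiff ℝ 1 X') (hy : ContDiff ℝ 1 y) (hW : ContDiff ℝ 1 W)
    (hb : ContDiff ℝ 1 b') :
    ContDiff ℝ 1 fun x => B.critical x.1 (X x) (X' x) (y x) (W x) (b' x) := by
  unfold critical
  have h1 := B.contDiff_Q hX hy
  have h2 := B.contDiff_Q hX' hW
  fun_prop

theorem contDiff_resid₁ : ContDiff ℝ 1 B.resid₁ := by
  unfold resid₁
  have h1 := B.contDiff_critical B.contDiff_X₁ B.contDiff_X₂
    (B.contDiff_stepY (b₁ := fun x => x.2.2.2.1) (b₂ := fun x => x.2.2.2.2) (by fun_prop)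
      (by fun_prop)) B.contDiff_stepW (b' := fun x => x.2.2.2.2) (by fun_prop)
  exact (B.κ₁.contDiff.comp h1).add (by fun_prop)

theorem contDiff_resid₂ : ContDiff ℝ 1 B.resid₂ := by
  unfold resid₂
  have h1 := B.contDiff_critical B.contDiff_X₂ B.contDiff_X₁
    (B.contDiff_stepY (b₁ := fun x => x.2.2.2.1) (b₂ := fun x => x.2.2.2.2) (by fun_prop)
      (by fun_prop)) B.contDiff_stepW (b' := fun x => x.2.2.2.1) (by fun_prop)
  exact (B.κ₂.contDiff.comp h1).add (by fun_prop)

theorem contDiff_step : ContDiff ℝ 1 B.step := by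
  have r1 := B.contDiff_resid₁
  have r2 := B.contDiff_resid₂
  have b1 : ContDiff ℝ 1 B.stepB₁ := by unfold stepB₁; fun_prop
  have b2 : ContDiff ℝ 1 B.stepB₂ := by unfold stepB₂; fun_prop
  have hy : ContDiff ℝ 1 B.newY := B.contDiff_stepY b1 b2
  have hW := B.contDiff_stepW
  have z1 := B.T.contDiff.comp (B.contDiff_critical B.contDiff_X₁ B.contDiff_X₂ hy hW b2)
  have z2 := B.T.contDiff.comp (B.contDiff_critical B.contDiff_X₂ B.contDiff_X₁ hy hW b1)
  exact (hW.prodMk hy).prodMk ((z1.prodMk z2).prodMk (b1.prodMk b2))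

variable {B} {c₁ c₂ : ℝ}

/-- The value of the fixed point map for `μ = 0`. -/
def start (B : Bifurcation V) (c₁ c₂ : ℝ) : Unknown V :=
  ((B.T (B.β₀ • ((2 : ℝ) • B.Q B.φ₁ B.φ₂)),
      B.T (B.β₀ • (c₁ • B.Q B.φ₁ B.φ₁ + c₂ • B.Q B.φ₂ B.φ₂))),
    (B.T (B.critical 0 B.φ₁ B.φ₂ (B.T (B.β₀ • (c₁ • B.Q B.φ₁ B.φ₁ + c₂ • B.Q B.φ₂ B.φ₂)))
      (B.T (B.β₀ • ((2 : ℝ) • B.Q B.φ₁ B.φ₂))) c₂),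
    B.T (B.critical 0 B.φ₂ B.φ₁ (B.T (B.β₀ • (c₁ • B.Q B.φ₁ B.φ₁ + c₂ • B.Q B.φ₂ B.φ₂)))
      (B.T (B.β₀ • ((2 : ℝ) • B.Q B.φ₁ B.φ₂))) c₁)), (c₁, c₂))

/-- All products with the old `W, y, Z₁, Z₂` carry a factor `μ`, and the Newton step forgets the old
amplitudes. This constancy is the hypothesis of `exists_fixedPoint_of_const`. -/
theorem step_zero (hdet : B.det ≠ 0) (h₁ : B.m₁₁ * c₁ + B.m₁₂ * c₂ = -B.κ₁ B.φ₁)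
    (h₂ : B.m₂₁ * c₁ + B.m₂₂ * c₂ = -B.κ₂ B.φ₂) (u : Unknown V) :
    B.step (0, u) = B.start c₁ c₂ := by
  have hX₁ : B.X₁ (0, u) = B.φ₁ := by simp [X₁]
  have hX₂ : B.X₂ (0, u) = B.φ₂ := by simp [X₂]
  have hW : B.stepW (0, u) = B.T (B.β₀ • ((2 : ℝ) • B.Q B.φ₁ B.φ₂)) := by
    simp [stepW, mixed, hX₁, hX₂]
  have hY : ∀ b₁ b₂, B.stepY (0, u) b₁ b₂
      = B.T (B.β₀ • (b₁ • B.Q B.φ₁ B.φ₁ + b₂ • B.Q B.φ₂ B.φ₂)) := by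
    intro b₁ b₂
    simp [stepY, even, hX₁, hX₂]
  have hr₁ : B.resid₁ (0, u) = B.m₁₁ * (u.2.2.1 - c₁) + B.m₁₂ * (u.2.2.2 - c₂) := by
    simp only [resid₁, hX₁, hX₂, hY, hW, critical, map_add, map_smul, add_zero, smul_eq_mul]
    have := h₁
    simp only [m₁₁, m₁₂] at this ⊢
    linear_combination this
  have hr₂ : B.resid₂ (0, u) = B.m₂₁ * (u.2.2.1 - c₁) + B.m₂₂ * (u.2.2.2 - c₂) := by
    simp only [resid₂, hX₁, hX₂, hY, hW, critical, map_add, map_smul, add_zero, smul_eq_mul]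
    have := h₂
    simp only [m₂₁, m₂₂] at this ⊢
    linear_combination this
  have hb₁ : B.stepB₁ (0, u) = c₁ := by
    rw [stepB₁, hr₁, hr₂]
    field_simp
    simp only [det]; ring
  have hb₂ : B.stepB₂ (0, u) = c₂ := by
    rw [stepB₂, hr₁, hr₂]
    field_simp
    simp only [det]; ring
  simp only [step, newY, hb₁, hb₂, hX₁, hX₂, hY, hW, start]

variable {S : ZMod 2 → ZMod 2 → Submodule ℝ V}

/-- The unknowns with prescribed parities. -/
def admissible (S : ZMod 2 → ZMod 2 → Submodule ℝ V) : Submodule ℝ (Unknown V) :=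
  ((S 1 1).prod (S 0 0)).prod (((S 1 0).prod (S 0 1)).prod ⊤)

theorem isClosed_admissible (hS : ∀ i j, IsClosed (S i j : Set V)) :
    IsClosed (admissible S : Set (Unknown V)) :=
  ((hS 1 1).prod (hS 0 0)).prod (((hS 1 0).prod (hS 0 1)).prod isClosed_univ)

/-- The operators respect a grading modulo two. -/
structure Graded (B : Bifurcation V) (S : ZMod 2 → ZMod 2 → Submodule ℝ V) : Prop where
  T_mem : ∀ {i j u}, u ∈ S i j → B.T u ∈ S i j
  Q_mem : ∀ {i j i' j' u v}, u ∈ S i j → v ∈ S i' j' → B.Q u v ∈ S (i + i') (j + j')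
  φ₁_mem : B.φ₁ ∈ S 1 0
  φ₂_mem : B.φ₂ ∈ S 0 1

theorem Graded.mixed_mem (h : Graded B S) {X₁ X₂ y W : V} (h₁ : X₁ ∈ S 1 0) (h₂ : X₂ ∈ S 0 1)
    (hy : y ∈ S 0 0) (hW : W ∈ S 1 1) (μ : ℝ) : B.mixed μ X₁ X₂ y W ∈ S 1 1 :=
  h.T_mem (add_mem (Submodule.smul_mem _ _ hW) (Submodule.smul_mem _ _ (add_mem
    (Submodule.smul_mem _ _ (h.Q_mem h₁ h₂)) (Submodule.smul_mem _ _ (h.Q_mem hy hW)))))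

theorem Graded.even_mem (h : Graded B S) {X₁ X₂ y W : V} (h₁ : X₁ ∈ S 1 0) (h₂ : X₂ ∈ S 0 1)
    (hy : y ∈ S 0 0) (hW : W ∈ S 1 1) (μ b₁ b₂ : ℝ) : B.even μ X₁ X₂ y W b₁ b₂ ∈ S 0 0 :=
  h.T_mem (add_mem (Submodule.smul_mem _ _ hy) (Submodule.smul_mem _ _ (add_mem (add_mem (add_mem
    (Submodule.smul_mem _ _ (h.Q_mem h₁ h₁)) (Submodule.smul_mem _ _ (h.Q_mem h₂ h₂)))
    (Submodule.smul_mem _ _ (h.Q_mem hy hy))) (Submodule.smul_mem _ _ (h.Q_mem hW hW)))))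

theorem Graded.critical₁_mem (h : Graded B S) {X₁ X₂ y W : V} (h₁ : X₁ ∈ S 1 0) (h₂ : X₂ ∈ S 0 1)
    (hy : y ∈ S 0 0) (hW : W ∈ S 1 1) (μ b : ℝ) : B.critical μ X₁ X₂ y W b ∈ S 1 0 :=
  add_mem h₁ (Submodule.smul_mem _ _ (add_mem
    (Submodule.smul_mem _ _ (h.Q_mem h₁ hy)) (Submodule.smul_mem _ _ (h.Q_mem h₂ hW))))

theorem Graded.critical₂_mem (h : Graded B S) {X₁ X₂ y W : V} (h₁ : X₁ ∈ S 1 0) (h₂ : X₂ ∈ S 0 1)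
    (hy : y ∈ S 0 0) (hW : W ∈ S 1 1) (μ b : ℝ) : B.critical μ X₂ X₁ y W b ∈ S 0 1 :=
  add_mem h₂ (Submodule.smul_mem _ _ (add_mem
    (Submodule.smul_mem _ _ (h.Q_mem h₂ hy)) (Submodule.smul_mem _ _ (h.Q_mem h₁ hW))))

theorem Graded.step_mem (h : Graded B S) (μ : ℝ) {u : Unknown V} (hu : u ∈ admissible S) :
    B.step (μ, u) ∈ admissible S := by
  obtain ⟨⟨hW, hy⟩, ⟨hZ₁, hZ₂⟩, -⟩ := hu
  have h₁ : B.X₁ (μ, u) ∈ S 1 0 := add_mem h.φ₁_mem (Submodule.smul_mem _ _ hZ₁)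
  have h₂ : B.X₂ (μ, u) ∈ S 0 1 := add_mem h.φ₂_mem (Submodule.smul_mem _ _ hZ₂)
  have hW' : B.stepW (μ, u) ∈ S 1 1 := h.mixed_mem h₁ h₂ hy hW _
  have hy' : B.newY (μ, u) ∈ S 0 0 := h.even_mem h₁ h₂ hy hW _ _ _
  exact ⟨⟨hW', hy'⟩, ⟨h.T_mem (h.critical₁_mem h₁ h₂ hy' hW' _ _),
    h.T_mem (h.critical₂_mem h₁ h₂ hy' hW' _ _)⟩, trivial⟩

variable [CompleteSpace V]

/-- Solvability of the bifurcation problem. -/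
theorem exists_solution (hdet : B.det ≠ 0) (h₁ : B.m₁₁ * c₁ + B.m₁₂ * c₂ = -B.κ₁ B.φ₁)
    (h₂ : B.m₂₁ * c₁ + B.m₂₂ * c₂ = -B.κ₂ B.φ₂) (hgr : Graded B S)
    (hS : ∀ i j, IsClosed (S i j : Set V)) :
    ∃ δ > 0, ∃ C > 0, ∀ μ : ℝ, |μ| < δ → ∃ W ∈ S 1 1, ∃ y ∈ S 0 0, ∃ X₁ ∈ S 1 0, ∃ X₂ ∈ S 0 1,
      ∃ b₁ b₂ : ℝ,
        W = B.mixed μ X₁ X₂ y W ∧ y = B.even μ X₁ X₂ y W b₁ b₂ ∧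
        X₁ = B.φ₁ + μ • B.T (B.critical μ X₁ X₂ y W b₂) ∧
        X₂ = B.φ₂ + μ • B.T (B.critical μ X₂ X₁ y W b₁) ∧
        B.κ₁ (B.critical μ X₁ X₂ y W b₂) + B.e₁ * b₁ = 0 ∧
        B.κ₂ (B.critical μ X₂ X₁ y W b₁) + B.e₂ * b₂ = 0 ∧
        ‖W - B.T (B.β₀ • ((2 : ℝ) • B.Q B.φ₁ B.φ₂))‖ ≤ C * |μ| ∧
        ‖y - B.T (B.β₀ • (c₁ • B.Q B.φ₁ B.φ₁ + c₂ • B.Q B.φ₂ B.φ₂))‖ ≤ C * |μ| ∧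
        ‖X₁ - B.φ₁‖ ≤ C * |μ| ∧ ‖X₂ - B.φ₂‖ ≤ C * |μ| ∧
        |b₁ - c₁| ≤ C * |μ| ∧ |b₂ - c₂| ≤ C * |μ| := by
  have h0 := step_zero hdet h₁ h₂
  have hstart : B.start c₁ c₂ ∈ admissible S := h0 0 ▸ hgr.step_mem 0 (zero_mem _)
  obtain ⟨δ, hδ, C, hC, hfix⟩ := exists_fixedPoint_of_const B.contDiff_step h0
    (isClosed_admissible hS) hstart fun μ u hu => hgr.step_mem μ hu
  -- The constant serves twice: it exceeds `C`, and it bounds `‖u‖`, hence `‖Z_j‖`, which controls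
  -- `X_j - φ_j = μ Z_j`.
  refine ⟨δ, hδ, C * (δ + 1) + ‖B.start c₁ c₂‖, by positivity, fun μ hμ => ?_⟩
  obtain ⟨u, hu, hGu, hnorm⟩ := hfix μ hμ
  have hCle : C * |μ| ≤ (C * (δ + 1) + ‖B.start c₁ c₂‖) * |μ| := by
    refine mul_le_mul_of_nonneg_right ?_ (abs_nonneg _)
    have := norm_nonneg (B.start c₁ c₂)
    nlinarith
  have hu' : ‖u‖ ≤ C * (δ + 1) + ‖B.start c₁ c₂‖ := by
    have e1 := norm_add_le (u - B.start c₁ c₂) (B.start c₁ c₂)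
    rw [sub_add_cancel] at e1
    nlinarith
  have hb₁ : B.stepB₁ (μ, u) = u.2.2.1 := congrArg (fun v : Unknown V => v.2.2.1) hGu
  have hb₂ : B.stepB₂ (μ, u) = u.2.2.2 := congrArg (fun v : Unknown V => v.2.2.2) hGu
  have hW : B.stepW (μ, u) = u.1.1 := congrArg (fun v : Unknown V => v.1.1) hGu
  have hy : B.stepY (μ, u) u.2.2.1 u.2.2.2 = u.1.2 := by
    have := congrArg (fun v : Unknown V => v.1.2) hGu
    rw [← hb₁, ← hb₂]; exact this
  have hZ₁ : B.T (B.critical μ (B.X₁ (μ, u)) (B.X₂ (μ, u)) u.1.2 u.1.1 u.2.2.2) = u.2.1.1 := by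
    have := congrArg (fun v : Unknown V => v.2.1.1) hGu
    simp only [step, newY, hb₁, hb₂, hy, hW] at this
    exact this
  have hZ₂ : B.T (B.critical μ (B.X₂ (μ, u)) (B.X₁ (μ, u)) u.1.2 u.1.1 u.2.2.1) = u.2.1.2 := by
    have := congrArg (fun v : Unknown V => v.2.1.2) hGu
    simp only [step, newY, hb₁, hb₂, hy, hW] at this
    exact this
  -- At a fixed point the Newton correction vanishes; the adjugate matrix being invertible, so do
  -- the residuals.
  have hr : B.resid₁ (μ, u) = 0 ∧ B.resid₂ (μ, u) = 0 := by
    have i1 : B.m₂₂ * B.resid₁ (μ, u) - B.m₁₂ * B.resid₂ (μ, u) = 0 := by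
      have : (B.det)⁻¹ * (B.m₂₂ * B.resid₁ (μ, u) - B.m₁₂ * B.resid₂ (μ, u)) = 0 := by
        rw [stepB₁] at hb₁; linarith
      exact (mul_eq_zero.1 this).resolve_left (inv_ne_zero hdet)
    have i2 : B.m₁₁ * B.resid₂ (μ, u) - B.m₂₁ * B.resid₁ (μ, u) = 0 := by
      have : (B.det)⁻¹ * (B.m₁₁ * B.resid₂ (μ, u) - B.m₂₁ * B.resid₁ (μ, u)) = 0 := by
        rw [stepB₂] at hb₂; linarith
      exact (mul_eq_zero.1 this).resolve_left (inv_ne_zero hdet)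
    constructor
    · refine (mul_eq_zero.1 (?_ : B.det * B.resid₁ (μ, u) = 0)).resolve_left hdet
      simp only [det]; linear_combination B.m₁₁ * i1 + B.m₁₂ * i2
    · refine (mul_eq_zero.1 (?_ : B.det * B.resid₂ (μ, u) = 0)).resolve_left hdet
      simp only [det]; linear_combination B.m₂₁ * i1 + B.m₂₂ * i2
  obtain ⟨hr₁, hr₂⟩ := hr
  simp only [resid₁, hy, hW] at hr₁
  simp only [resid₂, hy, hW] at hr₂
  have n1 := (norm_fst_le (u - B.start c₁ c₂)).trans hnorm
  have n2 := (norm_snd_le (u - B.start c₁ c₂)).trans hnorm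
  have n22 := (norm_snd_le (u - B.start c₁ c₂).2).trans n2
  have v1 : ‖u.2.1‖ ≤ ‖u‖ := (norm_fst_le u.2).trans (norm_snd_le u)
  refine ⟨u.1.1, hu.1.1, u.1.2, hu.1.2, B.X₁ (μ, u),
    add_mem hgr.φ₁_mem (Submodule.smul_mem _ _ hu.2.1.1), B.X₂ (μ, u),
    add_mem hgr.φ₂_mem (Submodule.smul_mem _ _ hu.2.1.2), u.2.2.1, u.2.2.2, hW.symm, hy.symm,
    by rw [hZ₁]; rfl, by rw [hZ₂]; rfl, hr₁, hr₂, ?_, ?_, ?_, ?_, ?_, ?_⟩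
  · exact ((norm_fst_le (u - B.start c₁ c₂).1).trans n1).trans hCle
  · exact ((norm_snd_le (u - B.start c₁ c₂).1).trans n1).trans hCle
  · rw [X₁, add_sub_cancel_left, norm_smul, Real.norm_eq_abs, mul_comm]
    exact mul_le_mul_of_nonneg_right (((norm_fst_le u.2.1).trans v1).trans hu') (abs_nonneg _)
  · rw [X₂, add_sub_cancel_left, norm_smul, Real.norm_eq_abs, mul_comm]
    exact mul_le_mul_of_nonneg_right (((norm_snd_le u.2.1).trans v1).trans hu') (abs_nonneg _)
  · exact ((norm_fst_le (u - B.start c₁ c₂).2.2).trans n22).trans hCle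
  · exact ((norm_snd_le (u - B.start c₁ c₂).2.2).trans n22).trans hCle

end Bifurcation
end

end StandingWave
end

noncomputable section
namespace StandingWave

/-! ### The linearized system and its partial inverse -/

variable (D : StandingWaveData)

/-- The determinant of the linearized system at a mode. -/
def disc (g : Mode) : ℝ := disp D g ^ 2 - D.β₀ ^ 2 * waveSq D g

/-- The modes at which the linearized system is singular for time dependent functions. -/
def Resonant (g : Mode) : Prop := g.2.2 ≠ 0 ∧ disc D g = 0

theorem wave₁_timeFlip (g : Mode) : wave₁ D (timeFlip g) = wave₁ D g := rfl
theorem wave₂_timeFlip (g : Mode) : wave₂ D (timeFlip g) = wave₂ D g := rfl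

theorem waveSq_spaceFlip (g : Mode) : waveSq D (spaceFlip g) = waveSq D g := by
  rw [waveSq, wave₁_spaceFlip, wave₂_spaceFlip, neg_sq, neg_sq, waveSq]

theorem waveSq_timeFlip (g : Mode) : waveSq D (timeFlip g) = waveSq D g := rfl

theorem disp_spaceFlip (g : Mode) : disp D (spaceFlip g) = disp D g := by
  rw [disp, waveSq_spaceFlip, disp]; rfl

theorem disp_timeFlip (g : Mode) : disp D (timeFlip g) = -disp D g := by
  rw [disp, waveSq_timeFlip, disp, timeFlip, Int.cast_neg, neg_mul]

theorem disc_spaceFlip (g : Mode) : disc D (spaceFlip g) = disc D g := by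
  rw [disc, disp_spaceFlip, waveSq_spaceFlip, disc]

theorem disc_timeFlip (g : Mode) : disc D (timeFlip g) = disc D g := by
  rw [disc, disp_timeFlip, waveSq_timeFlip, neg_sq, disc]

theorem resonant_spaceFlip (g : Mode) : Resonant D (spaceFlip g) ↔ Resonant D g := by
  rw [Resonant, disc_spaceFlip, Resonant]; rfl

theorem resonant_timeFlip (g : Mode) : Resonant D (timeFlip g) ↔ Resonant D g := by
  rw [Resonant, disc_timeFlip, Resonant, timeFlip, ne_eq, neg_eq_zero]

open Classical in
/-- The partial inverse at a mode: the opposite of the inverse of the linearized system applied to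
the gradient and divergence of the data `(k, F)`. -/
def invSymbol (g : Mode) : Vec →ₗ[ℝ] Vec where
  toFun f := if Resonant D g then (-f.1 / D.β₀, 0, 0) else
    ((-(disp D g) * (wave₁ D g * f.2.1 + wave₂ D g * f.2.2) + D.β₀ * waveSq D g * f.1) / disc D g,
      wave₁ D g * ((-(disp D g) * f.1 + D.β₀ * (wave₁ D g * f.2.1 + wave₂ D g * f.2.2)) / disc D g),
      wave₂ D g * ((-(disp D g) * f.1 + D.β₀ * (wave₁ D g * f.2.1 + wave₂ D g * f.2.2)) / disc D g))
  map_add' a b := by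
    split_ifs <;> ext <;> simp <;> ring
  map_smul' c a := by
    split_ifs <;> ext <;> simp <;> ring

theorem invSymbol_resonant {g : Mode} (h : Resonant D g) (f : Vec) :
    invSymbol D g f = (-f.1 / D.β₀, 0, 0) := by
  simp only [invSymbol, LinearMap.coe_mk, AddHom.coe_mk, if_pos h]

theorem invSymbol_of_not_resonant {g : Mode} (h : ¬Resonant D g) (f : Vec) :
    invSymbol D g f =
    ((-(disp D g) * (wave₁ D g * f.2.1 + wave₂ D g * f.2.2) + D.β₀ * waveSq D g * f.1) / disc D g,
      wave₁ D g * ((-(disp D g) * f.1 + D.β₀ * (wave₁ D g * f.2.1 + wave₂ D g * f.2.2)) / disc D g),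
      wave₂ D g * ((-(disp D g) * f.1 + D.β₀ * (wave₁ D g * f.2.1 + wave₂ D g * f.2.2)) / disc D g))
    := by
  simp only [invSymbol, LinearMap.coe_mk, AddHom.coe_mk, if_neg h]

theorem invSymbol_spaceFlip (g : Mode) (f : Vec) :
    invSymbol D (spaceFlip g) (conjVec f) = conjVec (invSymbol D g f) := by
  by_cases h : Resonant D g
  · rw [invSymbol_resonant D h, invSymbol_resonant D ((resonant_spaceFlip D g).2 h)]
    simp [conjVec_apply]
  · rw [invSymbol_of_not_resonant D h,
      invSymbol_of_not_resonant D (fun h' => h ((resonant_spaceFlip D g).1 h'))]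
    simp only [conjVec_apply, disp_spaceFlip, disc_spaceFlip, waveSq_spaceFlip, wave₁_spaceFlip,
      wave₂_spaceFlip]
    ext <;> dsimp only <;> ring

theorem invSymbol_timeFlip (g : Mode) (f : Vec) :
    invSymbol D (timeFlip g) (conjVec f) = conjVec (invSymbol D g f) := by
  by_cases h : Resonant D g
  · rw [invSymbol_resonant D h, invSymbol_resonant D ((resonant_timeFlip D g).2 h)]
    simp [conjVec_apply]
  · rw [invSymbol_of_not_resonant D h,
      invSymbol_of_not_resonant D (fun h' => h ((resonant_timeFlip D g).1 h'))]
    simp only [conjVec_apply, disp_timeFlip, disc_timeFlip, waveSq_timeFlip, wave₁_timeFlip,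
      wave₂_timeFlip]
    ext <;> dsimp only <;> ring

/-! ### Bounds away from the resonances -/

variable {D}

theorem waveSq_nonneg (g : Mode) : 0 ≤ waveSq D g := by unfold waveSq; positivity

/-- The combination `τ₂ p₁ + p₂` eliminates `n₂`; Cauchy–Schwarz then controls `n₁` by `|p|`. This
gives finiteness of the sets of modes with bounded wave vector and frequency. -/
theorem sq_index₁_le (g : Mode) :
    (D.k₁ * (D.τ₁ + D.τ₂) * g.1) ^ 2 ≤ (D.τ₂ ^ 2 + 1) * waveSq D g := by
  have h : D.k₁ * (D.τ₁ + D.τ₂) * g.1 = D.τ₂ * wave₁ D g + wave₂ D g := by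
    simp only [wave₁, wave₂, StandingWaveData.p₁, StandingWaveData.p₂]; ring
  rw [h, waveSq]
  nlinarith [sq_nonneg (wave₁ D g - D.τ₂ * wave₂ D g)]

theorem sq_index₂_le (g : Mode) :
    (D.k₂ * (D.τ₁ + D.τ₂) * g.2.1) ^ 2 ≤ (D.τ₁ ^ 2 + 1) * waveSq D g := by
  have h : D.k₂ * (D.τ₁ + D.τ₂) * g.2.1 = D.τ₁ * wave₁ D g - wave₂ D g := by
    simp only [wave₁, wave₂, StandingWaveData.p₁, StandingWaveData.p₂]; ring
  rw [h, waveSq]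
  nlinarith [sq_nonneg (wave₁ D g + D.τ₁ * wave₂ D g)]

theorem finite_of_sq_le (R : ℝ) :
    {g : Mode | (g.1 : ℝ) ^ 2 ≤ R ∧ (g.2.1 : ℝ) ^ 2 ≤ R ∧ (g.2.2 : ℝ) ^ 2 ≤ R}.Finite := by
  obtain ⟨N, hN⟩ := exists_nat_ge R
  have key : ∀ n : ℤ, (n : ℝ) ^ 2 ≤ R → -(N : ℤ) ≤ n ∧ n ≤ N := by
    intro n hn
    have h1 : n ^ 2 ≤ N := by exact_mod_cast hn.trans hN
    constructor <;> nlinarith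
  refine (Set.finite_Icc ((-(N : ℤ), -(N : ℤ), -(N : ℤ)) : Mode) (N, N, N)).subset ?_
  rintro ⟨a, b, m⟩ ⟨h1, h2, h3⟩
  exact ⟨⟨(key a h1).1, (key b h2).1, (key m h3).1⟩, ⟨(key a h1).2, (key b h2).2, (key m h3).2⟩⟩

theorem one_le_sq_cast {m : ℤ} (hm : m ≠ 0) : 1 ≤ (m : ℝ) ^ 2 := by
  have : 0 < m ^ 2 := by positivity
  exact_mod_cast this

theorem symbol_sq_le_sq_disp {g : Mode} (hm : g.2.2 ≠ 0) :
    (1 + D.ω * waveSq D g) ^ 2 ≤ disp D g ^ 2 := by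
  rw [disp, mul_pow]
  nlinarith [sq_nonneg (1 + D.ω * waveSq D g), one_le_sq_cast hm]

variable (hω : 0 < D.ω) (hk₁ : 0 < D.k₁) (hk₂ : 0 < D.k₂) (hτ₁ : 0 < D.τ₁) (hτ₂ : 0 < D.τ₂)
  (hβ₀ : 0 < D.β₀)
include hω

theorem sq_time_le_sq_disp (g : Mode) : (g.2.2 : ℝ) ^ 2 ≤ disp D g ^ 2 := by
  have hP := waveSq_nonneg (D := D) g
  rw [disp, mul_pow]
  have : 1 ≤ (1 + D.ω * waveSq D g) ^ 2 := one_le_pow₀ (by nlinarith)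
  nlinarith [sq_nonneg (g.2.2 : ℝ)]

include hk₁ hk₂ hτ₁ hτ₂ hβ₀

/-- For `m ≠ 0`, `disp²` is at least `ω² |p|⁴`, which beats `2 β₀² |p|²` as soon as `|p|² ≥ 2 β₀² /
ω²`. The wave vector is therefore bounded by `R₀`, and then so are both space indices and, through
`m² ≤ disp²`, the frequency. -/
theorem finite_small_disp :
    {g : Mode | g.2.2 ≠ 0 ∧ disp D g ^ 2 < 2 * D.β₀ ^ 2 * waveSq D g}.Finite := by
  let R₀ : ℝ := 2 * D.β₀ ^ 2 / D.ω ^ 2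
  let R₁ : ℝ := (D.τ₂ ^ 2 + 1) * R₀ / (D.k₁ * (D.τ₁ + D.τ₂)) ^ 2
  let R₂ : ℝ := (D.τ₁ ^ 2 + 1) * R₀ / (D.k₂ * (D.τ₁ + D.τ₂)) ^ 2
  let R₃ : ℝ := 2 * D.β₀ ^ 2 * R₀
  have p1 : 0 ≤ R₁ := by positivity
  have p2 : 0 ≤ R₂ := by positivity
  have p3 : 0 ≤ R₃ := by positivity
  refine (finite_of_sq_le (R₁ + R₂ + R₃)).subset ?_
  rintro g ⟨hm, hlt⟩
  have hP := waveSq_nonneg (D := D) g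
  have h1 := symbol_sq_le_sq_disp (D := D) hm
  have h2 := sq_time_le_sq_disp hω g
  have hP0 : waveSq D g ≤ R₀ := by
    rw [le_div_iff₀ (by positivity)]
    by_contra hcon
    push Not at hcon
    have h3 : (D.ω * waveSq D g) ^ 2 ≤ (1 + D.ω * waveSq D g) ^ 2 :=
      pow_le_pow_left₀ (by positivity) (by linarith) 2
    nlinarith
  have h4 : (g.1 : ℝ) ^ 2 ≤ R₁ := by
    rw [le_div_iff₀ (by positivity)]
    have := sq_index₁_le (D := D) g
    have h5 : (D.τ₂ ^ 2 + 1) * waveSq D g ≤ (D.τ₂ ^ 2 + 1) * R₀ :=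
      mul_le_mul_of_nonneg_left hP0 (by positivity)
    calc _ = (D.k₁ * (D.τ₁ + D.τ₂) * g.1) ^ 2 := by ring
      _ ≤ _ := this.trans h5
  have h5 : (g.2.1 : ℝ) ^ 2 ≤ R₂ := by
    rw [le_div_iff₀ (by positivity)]
    have := sq_index₂_le (D := D) g
    have h5 : (D.τ₁ ^ 2 + 1) * waveSq D g ≤ (D.τ₁ ^ 2 + 1) * R₀ :=
      mul_le_mul_of_nonneg_left hP0 (by positivity)
    calc _ = (D.k₂ * (D.τ₁ + D.τ₂) * g.2.1) ^ 2 := by ring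
      _ ≤ _ := this.trans h5
  have h6 : (g.2.2 : ℝ) ^ 2 ≤ R₃ :=
    (h2.trans hlt.le).trans (mul_le_mul_of_nonneg_left hP0 (by positivity))
  exact ⟨by linarith, by linarith, by linarith⟩

/-- Absence of small divisors. For `m ≠ 0` outside the finite set above, `disp² ≤ 2 disc`; on this
set `disc` is nonzero away from resonances and a maximum over finitely many ratios suffices. For `m
= 0`, `disc` is exactly `-β₀² |p|²`. -/
theorem exists_disp_bound : ∃ C : ℝ, 0 ≤ C ∧ ∀ g, ¬Resonant D g →
    disp D g ^ 2 ≤ C * |disc D g| ∧ waveSq D g ≤ C * |disc D g| := by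
  obtain ⟨R, hR⟩ := ((finite_small_disp hω hk₁ hk₂ hτ₁ hτ₂ hβ₀).image
    fun g => disp D g ^ 2 / |disc D g|).bddAbove
  let C₁ : ℝ := max 2 R
  have hC₁ : 2 ≤ C₁ := le_max_left _ _
  have key : ∀ g, ¬Resonant D g → g.2.2 ≠ 0 → disp D g ^ 2 ≤ C₁ * |disc D g| := by
    intro g hg hm
    have hd : 0 < |disc D g| := abs_pos.2 fun h => hg ⟨hm, h⟩
    by_cases hlt : disp D g ^ 2 < 2 * D.β₀ ^ 2 * waveSq D g
    · have h1 : disp D g ^ 2 / |disc D g| ≤ R := hR ⟨g, ⟨hm, hlt⟩, rfl⟩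
      rw [div_le_iff₀ hd] at h1
      exact h1.trans (mul_le_mul_of_nonneg_right (le_max_right _ _) hd.le)
    · push Not at hlt
      have h1 : disc D g ≤ |disc D g| := le_abs_self _
      have h2 : disp D g ^ 2 ≤ 2 * disc D g := by rw [disc]; linarith
      nlinarith
  have hmul : ∀ a b : ℝ, 0 ≤ a → 0 ≤ b → ∀ g, C₁ * |disc D g| ≤ (C₁ + a + b) * |disc D g| := by
    intro a b ha hb g
    exact mul_le_mul_of_nonneg_right (by linarith) (abs_nonneg _)
  -- The three terms handle `disp²` for `m ≠ 0`, `|p|²` for `m ≠ 0` through `4 ω |p|² ≤ (1 + ω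
  -- |p|²)²`, and `|p|²` for `m = 0`.
  refine ⟨C₁ + C₁ / (4 * D.ω) + 1 / D.β₀ ^ 2, by positivity, fun g hg => ?_⟩
  have hP := waveSq_nonneg (D := D) g
  by_cases hm : g.2.2 = 0
  · have h0 : disp D g = 0 := by rw [disp, hm]; simp
    have h1 : |disc D g| = D.β₀ ^ 2 * waveSq D g := by
      rw [disc, h0, zero_pow two_ne_zero, zero_sub, abs_neg, abs_of_nonneg (by positivity)]
    rw [h0, h1]
    refine ⟨by rw [zero_pow two_ne_zero]; positivity, ?_⟩
    have h2 : 1 / D.β₀ ^ 2 * (D.β₀ ^ 2 * waveSq D g) = waveSq D g := by field_simp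
    have h3 : 0 ≤ (C₁ + C₁ / (4 * D.ω)) * (D.β₀ ^ 2 * waveSq D g) := by positivity
    linarith
  · have h1 := key g hg hm
    refine ⟨h1.trans (hmul _ _ (by positivity) (by positivity) g), ?_⟩
    have h2 := symbol_sq_le_sq_disp (D := D) hm
    have h3 : 4 * D.ω * waveSq D g ≤ (1 + D.ω * waveSq D g) ^ 2 := by
      nlinarith [sq_nonneg (1 - D.ω * waveSq D g)]
    have h4 : waveSq D g ≤ C₁ / (4 * D.ω) * |disc D g| := by
      rw [div_mul_eq_mul_div, le_div_iff₀ (by positivity)]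
      linarith
    have h5 : 0 ≤ (C₁ + 1 / D.β₀ ^ 2) * |disc D g| := by positivity
    linarith

/-- Away from resonances every entry is a sum of terms `a b x / disc` with `a, b` among `disp, p₁,
p₂`, and `|a b| ≤ (a² + b²) / 2 ≤ C |disc|`. The partial inverse, derivatives of the data included,
thus loses no regularity, and a plain contraction argument is enough. -/
theorem exists_invSymbol_bound : ∃ C : ℝ, 0 ≤ C ∧ ∀ g,
    ‖LinearMap.toContinuousLinearMap (invSymbol D g)‖ ≤ C := by
  obtain ⟨C, hC, hb⟩ := exists_disp_bound hω hk₁ hk₂ hτ₁ hτ₂ hβ₀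
  refine ⟨2 * C + 2 * D.β₀ * C + 1 / D.β₀, by positivity, fun g => ?_⟩
  refine ContinuousLinearMap.opNorm_le_bound _ (by positivity) fun f => ?_
  rw [LinearMap.coe_toContinuousLinearMap']
  have f0 : |f.1| ≤ ‖f‖ := abs_comp₀_le f
  have f1 : |f.2.1| ≤ ‖f‖ := abs_comp₁_le f
  have f2 : |f.2.2| ≤ ‖f‖ := abs_comp₂_le f
  have hf := norm_nonneg f
  have hc1 : 0 ≤ C * ‖f‖ := by positivity
  have hc2 : 0 ≤ D.β₀ * C * ‖f‖ := by positivity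
  by_cases h : Resonant D g
  · rw [invSymbol_resonant D h]
    have h1 : ‖-f.1 / D.β₀‖ ≤ 1 / D.β₀ * ‖f‖ := by
      rw [norm_div, norm_neg, Real.norm_of_nonneg hβ₀.le, div_mul_eq_mul_div, one_mul]
      exact div_le_div_of_nonneg_right f0 hβ₀.le
    have h2 : 0 ≤ 1 / D.β₀ * ‖f‖ := by positivity
    simp only [Prod.norm_mk, norm_zero, max_self]
    refine max_le ?_ ?_ <;> nlinarith
  · obtain ⟨b1, b2⟩ := hb g h
    rw [invSymbol_of_not_resonant D h]
    have hd := abs_nonneg (disc D g)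
    -- A non-resonant mode with `disc = 0` has `m = 0` and `p = 0`; the symbol is zero there because
    -- division by zero gives zero.
    rcases hd.eq_or_lt with hd0 | hd0
    · rw [abs_eq_zero.1 hd0.symm]
      simp only [div_zero, mul_zero]
      simp only [Prod.norm_mk, norm_zero, max_self]
      positivity
    have w1 : wave₁ D g ^ 2 ≤ waveSq D g := by rw [waveSq]; nlinarith [sq_nonneg (wave₂ D g)]
    have w2 : wave₂ D g ^ 2 ≤ waveSq D g := by rw [waveSq]; nlinarith [sq_nonneg (wave₁ D g)]
    have prod : ∀ a b : ℝ, a ^ 2 ≤ C * |disc D g| → b ^ 2 ≤ C * |disc D g| →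
        ∀ x : ℝ, |x| ≤ ‖f‖ → |a * b * x / disc D g| ≤ C * ‖f‖ := by
      intro a b ha hb x hx
      have h1 : |a * b| ≤ C * |disc D g| := by
        rw [abs_mul]
        nlinarith [sq_nonneg (|a| - |b|), sq_abs a, sq_abs b]
      rw [abs_div, abs_mul, div_le_iff₀ hd0]
      calc |a * b| * |x| ≤ (C * |disc D g|) * ‖f‖ :=
            mul_le_mul h1 hx (abs_nonneg _) (by positivity)
        _ = _ := by ring
    have w1' := w1.trans b2
    have w2' := w2.trans b2
    have mulβ : ∀ x : ℝ, |x| ≤ C * ‖f‖ → |D.β₀ * x| ≤ D.β₀ * C * ‖f‖ := by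
      intro x hx
      rw [abs_mul, abs_of_pos hβ₀, mul_assoc]
      exact mul_le_mul_of_nonneg_left hx hβ₀.le
    have tot : ∀ x : ℝ, |x| ≤ 2 * (C * ‖f‖) + 2 * (D.β₀ * C * ‖f‖) →
        ‖x‖ ≤ (2 * C + 2 * D.β₀ * C + 1 / D.β₀) * ‖f‖ := by
      intro x hx
      have h2 : 0 ≤ 1 / D.β₀ * ‖f‖ := by positivity
      rw [Real.norm_eq_abs]
      linarith
    refine norm_prod_le_iff.2 ⟨tot _ ?_, norm_prod_le_iff.2 ⟨tot _ ?_, tot _ ?_⟩⟩ <;> dsimp only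
    · have e : (-(disp D g) * (wave₁ D g * f.2.1 + wave₂ D g * f.2.2) + D.β₀ * waveSq D g * f.1)
          / disc D g = -(disp D g * wave₁ D g * f.2.1 / disc D g)
          + -(disp D g * wave₂ D g * f.2.2 / disc D g)
          + (D.β₀ * (wave₁ D g * wave₁ D g * f.1 / disc D g)
            + D.β₀ * (wave₂ D g * wave₂ D g * f.1 / disc D g)) := by
        rw [waveSq]; ring
      rw [e]
      have a1 := prod _ _ b1 w1' _ f1
      have a2 := prod _ _ b1 w2' _ f2
      have a3 := mulβ _ (prod _ _ w1' w1' _ f0)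
      have a4 := mulβ _ (prod _ _ w2' w2' _ f0)
      rw [← abs_neg] at a1 a2
      refine (abs_add_le _ _).trans ?_
      refine (add_le_add (abs_add_le _ _) (abs_add_le _ _)).trans ?_
      linarith
    · have e : wave₁ D g * ((-(disp D g) * f.1 + D.β₀ * (wave₁ D g * f.2.1 + wave₂ D g * f.2.2))
          / disc D g) = -(disp D g * wave₁ D g * f.1 / disc D g)
          + (D.β₀ * (wave₁ D g * wave₁ D g * f.2.1 / disc D g)
            + D.β₀ * (wave₁ D g * wave₂ D g * f.2.2 / disc D g)) := by ring
      rw [e]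
      have a1 := prod _ _ b1 w1' _ f0
      have a3 := mulβ _ (prod _ _ w1' w1' _ f1)
      have a4 := mulβ _ (prod _ _ w1' w2' _ f2)
      rw [← abs_neg] at a1
      refine (abs_add_le _ _).trans ?_
      refine (add_le_add le_rfl (abs_add_le _ _)).trans ?_
      linarith
    · have e : wave₂ D g * ((-(disp D g) * f.1 + D.β₀ * (wave₁ D g * f.2.1 + wave₂ D g * f.2.2))
          / disc D g) = -(disp D g * wave₂ D g * f.1 / disc D g)
          + (D.β₀ * (wave₂ D g * wave₁ D g * f.2.1 / disc D g)
            + D.β₀ * (wave₂ D g * wave₂ D g * f.2.2 / disc D g)) := by ring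
      rw [e]
      have a1 := prod _ _ b1 w2' _ f0
      have a3 := mulβ _ (prod _ _ w2' w1' _ f1)
      have a4 := mulβ _ (prod _ _ w2' w2' _ f2)
      rw [← abs_neg] at a1
      refine (abs_add_le _ _).trans ?_
      refine (add_le_add le_rfl (abs_add_le _ _)).trans ?_
      linarith

end StandingWave
end

noncomputable section
namespace StandingWave

/-! ### Solvability of the linearized system -/

variable (D : StandingWaveData) (K : ℕ)

/-- `u` solves the linearized system with data `f = (k, F)`. -/
def Balanced (u f : Seq) : Prop := ∀ g,
  disp D g * (coef K u g).1
      + D.β₀ * (wave₁ D g * (coef K u g).2.1 + wave₂ D g * (coef K u g).2.2)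
    = -(wave₁ D g * (coef K f g).2.1 + wave₂ D g * (coef K f g).2.2) ∧
  disp D g * (coef K u g).2.1 + D.β₀ * wave₁ D g * (coef K u g).1
    = -(wave₁ D g * (coef K f g).1) ∧
  disp D g * (coef K u g).2.2 + D.β₀ * wave₂ D g * (coef K u g).1
    = -(wave₂ D g * (coef K f g).1)

variable {D K}

theorem Balanced.add {u u' f f' : Seq} (h : Balanced D K u f) (h' : Balanced D K u' f') :
    Balanced D K (u + u') (f + f') := by
  intro g
  obtain ⟨a1, a2, a3⟩ := h g
  obtain ⟨b1, b2, b3⟩ := h' g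
  simp only [coef_add, Prod.fst_add, Prod.snd_add]
  exact ⟨by linear_combination a1 + b1, by linear_combination a2 + b2,
    by linear_combination a3 + b3⟩

theorem Balanced.smul {u f : Seq} (h : Balanced D K u f) (c : ℝ) :
    Balanced D K (c • u) (c • f) := by
  intro g
  obtain ⟨a1, a2, a3⟩ := h g
  simp only [coef_smul, Prod.smul_fst, Prod.smul_snd, smul_eq_mul]
  exact ⟨by linear_combination c * a1, by linear_combination c * a2,
    by linear_combination c * a3⟩

/-- The excess `μ` of the parameter and the nonlinearity enter through the same divergence and
gradient as the data `(k, F)`, so both can be moved to the right-hand side. -/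
theorem Balanced.solvesFourier {u : Seq} {μ : ℝ}
    (h : Balanced D K u (μ • u + (D.β₀ + μ) • quad K u u)) :
    SolvesFourier D K (D.β₀ + μ) u := by
  intro g
  obtain ⟨a1, a2, a3⟩ := h g
  simp only [coef_add, coef_smul, Prod.fst_add, Prod.snd_add, Prod.smul_fst, Prod.smul_snd,
    smul_eq_mul] at a1 a2 a3
  exact ⟨by linear_combination a1, by linear_combination a2, by linear_combination a3⟩

variable {C : ℝ} (hC : 0 ≤ C)
  (hb : ∀ g, ‖LinearMap.toContinuousLinearMap (invSymbol D g)‖ ≤ C)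

/-- The partial inverse of the linearized system. -/
def partialInv : Seq →L[ℝ] Seq :=
  multiplier (fun g => LinearMap.toContinuousLinearMap (invSymbol D g)) hC hb

theorem coef_partialInv (f : Seq) (g : Mode) :
    coef K (partialInv hC hb f) g = invSymbol D g (coef K f g) :=
  coef_multiplier K hC hb f g

theorem partialInv_bas (g : Mode) (a : Vec) :
    partialInv hC hb (bas K g a) = bas K g (invSymbol D g a) :=
  multiplier_bas K hC hb g a

theorem partialInv_mem_symSpace {f : Seq} (hf : f ∈ symSpace K) :
    partialInv hC hb f ∈ symSpace K :=
  multiplier_mem_symSpace hC hb (invSymbol_spaceFlip D) (invSymbol_timeFlip D) hf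

theorem partialInv_mem_parSpace {i j : ZMod 2} {f : Seq} (hf : f ∈ parSpace K i j) :
    partialInv hC hb f ∈ parSpace K i j := multiplier_mem_parSpace hC hb hf

/-- Where `disc ≠ 0` this is Cramer's rule. At the mode with `m = 0`, `p = 0` both sides vanish. At
a resonance the solvability condition `β₀ p · F = disp k` is exactly what makes `(-k / β₀, 0, 0)` a
solution. -/
theorem balanced_partialInv (hβ₀ : D.β₀ ≠ 0) {f : Seq}
    (hf : ∀ g, Resonant D g → D.β₀ * (wave₁ D g * (coef K f g).2.1 + wave₂ D g * (coef K f g).2.2)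
      = disp D g * (coef K f g).1) : Balanced D K (partialInv hC hb f) f := by
  intro g
  rw [coef_partialInv]
  generalize hfg : coef K f g = a
  by_cases h : Resonant D g
  · have hs := hf g h
    rw [hfg] at hs
    rw [invSymbol_resonant D h]
    refine ⟨?_, ?_, ?_⟩
    · field_simp; linear_combination hs
    · dsimp only; field_simp; ring
    · dsimp only; field_simp; ring
  · rw [invSymbol_of_not_resonant D h]
    by_cases hd : disc D g = 0
    · have hm : g.2.2 = 0 := by
        by_contra hm; exact h ⟨hm, hd⟩
      have h0 : disp D g = 0 := by rw [disp, hm]; simp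
      have hP : waveSq D g = 0 := by
        rw [disc, h0] at hd
        have : D.β₀ ^ 2 * waveSq D g = 0 := by linarith
        exact (mul_eq_zero.1 this).resolve_left (pow_ne_zero 2 hβ₀)
      have h1 : wave₁ D g = 0 := by
        rw [waveSq] at hP
        nlinarith [sq_nonneg (wave₁ D g), sq_nonneg (wave₂ D g)]
      have h2 : wave₂ D g = 0 := by
        rw [waveSq] at hP
        nlinarith [sq_nonneg (wave₁ D g), sq_nonneg (wave₂ D g)]
      simp [h0, h1, h2]
    · have hdd : disp D g ^ 2 = disc D g + D.β₀ ^ 2 * waveSq D g := by rw [disc]; ring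
      have hw : wave₁ D g ^ 2 = waveSq D g - wave₂ D g ^ 2 := by rw [waveSq]; ring
      generalize disc D g = d at *
      generalize disp D g = l at *
      generalize wave₁ D g = p at *
      generalize wave₂ D g = r at *
      generalize waveSq D g = P at *
      refine ⟨?_, ?_, ?_⟩ <;> dsimp only <;> field_simp
      · linear_combination (-(p * a.2.1 + r * a.2.2)) * hdd
          + (D.β₀ * (-l * a.1 + D.β₀ * (p * a.2.1 + r * a.2.2))) * hw
      · linear_combination (-p * a.1) * hdd
      · linear_combination (-r * a.1) * hdd

/-! ### The resonant modes -/

variable (D) in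
/-- `k₁ √(1 + τ₁²)`, the length of the first generator of the lattice. -/
def R₁ : ℝ := D.k₁ * D.s₁

variable (D) in
/-- `k₂ √(1 + τ₂²)`, the length of the second generator of the lattice. -/
def R₂ : ℝ := D.k₂ * D.s₂

theorem s₁_sq : D.s₁ ^ 2 = 1 + D.τ₁ ^ 2 := Real.sq_sqrt (by positivity)
theorem s₂_sq : D.s₂ ^ 2 = 1 + D.τ₂ ^ 2 := Real.sq_sqrt (by positivity)
theorem s₁_pos : 0 < D.s₁ := Real.sqrt_pos.2 (by positivity)
theorem s₂_pos : 0 < D.s₂ := Real.sqrt_pos.2 (by positivity)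

theorem R₁_pos (hk₁ : 0 < D.k₁) : 0 < R₁ D := mul_pos hk₁ s₁_pos
theorem R₂_pos (hk₂ : 0 < D.k₂) : 0 < R₂ D := mul_pos hk₂ s₂_pos

theorem waveSq_e₁ (m : ℤ) : waveSq D (1, 0, m) = R₁ D ^ 2 := by
  simp only [waveSq, wave₁, wave₂, StandingWaveData.p₁, StandingWaveData.p₂, R₁, mul_pow, s₁_sq]
  push_cast; ring

theorem waveSq_e₂ (m : ℤ) : waveSq D (0, 1, m) = R₂ D ^ 2 := by
  simp only [waveSq, wave₁, wave₂, StandingWaveData.p₁, StandingWaveData.p₂, R₂, mul_pow, s₂_sq]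
  push_cast; ring

variable (hω : 0 < D.ω) (hk₁ : 0 < D.k₁) (hk₂ : 0 < D.k₂) (hβ₀ : 0 < D.β₀)
  (hΩ : D.Omega D.β₀ = {(1, 0, D.q), (-1, 0, D.q), (0, 1, D.q), (0, -1, D.q)})

theorem mem_Omega_iff (g : Mode) :
    g ∈ D.Omega D.β₀ ↔ 0 < g.2.2 ∧ disp D g = D.β₀ * √(waveSq D g) := by
  rw [← sub_eq_zero (a := disp D g)]; rfl

include hΩ

theorem q_pos : 0 < D.q := by
  have h : ((1, 0, D.q) : Mode) ∈ D.Omega D.β₀ := by rw [hΩ]; simp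
  exact ((mem_Omega_iff _).1 h).1

theorem disp_e₁ (hk₁ : 0 < D.k₁) : disp D (1, 0, D.q) = D.β₀ * R₁ D := by
  have h : ((1, 0, D.q) : Mode) ∈ D.Omega D.β₀ := by rw [hΩ]; simp
  rw [((mem_Omega_iff _).1 h).2, waveSq_e₁, Real.sqrt_sq (R₁_pos hk₁).le]

theorem disp_e₂ (hk₂ : 0 < D.k₂) : disp D (0, 1, D.q) = D.β₀ * R₂ D := by
  have h : ((0, 1, D.q) : Mode) ∈ D.Omega D.β₀ := by rw [hΩ]; simp
  rw [((mem_Omega_iff _).1 h).2, waveSq_e₂, Real.sqrt_sq (R₂_pos hk₂).le]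

include hω hβ₀

/-- For `m > 0`, `disp ≥ 0`, so `disc = 0` forces `disp = β₀ |p|`, which is membership in `Ω`; time
reflection handles `m < 0`. -/
theorem resonant_cases {g : Mode} (hg : Resonant D g) :
    ∃ g₀ ∈ ({(1, 0, D.q), (0, 1, D.q)} : Set Mode), g = g₀ ∨ g = spaceFlip g₀ ∨
      g = timeFlip g₀ ∨ g = spaceFlip (timeFlip g₀) := by
  have pos : ∀ g, Resonant D g → 0 < g.2.2 → ∃ g₀ ∈ ({(1, 0, D.q), (0, 1, D.q)} : Set Mode),
      g = g₀ ∨ g = spaceFlip g₀ := by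
    intro g hg hm
    have h1 : g ∈ D.Omega D.β₀ := by
      refine (mem_Omega_iff g).2 ⟨hm, ?_⟩
      have hm' : (0 : ℝ) < g.2.2 := by exact_mod_cast hm
      have hP := waveSq_nonneg (D := D) g
      have hpos : 0 ≤ disp D g := by unfold disp; positivity
      have h2 := hg.2
      rw [disc, sub_eq_zero] at h2
      rw [← Real.sqrt_sq hpos, h2, Real.sqrt_mul (sq_nonneg _), Real.sqrt_sq hβ₀.le]
    rw [hΩ] at h1
    simp only [Set.mem_insert_iff, Set.mem_singleton_iff] at h1
    rcases h1 with rfl | rfl | rfl | rfl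
    · exact ⟨_, Or.inl rfl, Or.inl rfl⟩
    · exact ⟨_, Or.inl rfl, Or.inr (by simp [spaceFlip])⟩
    · exact ⟨_, Or.inr rfl, Or.inl rfl⟩
    · exact ⟨_, Or.inr rfl, Or.inr (by simp [spaceFlip])⟩
  rcases lt_or_gt_of_ne hg.1 with hm | hm
  · obtain ⟨g₀, h0, h⟩ := pos (timeFlip g) ((resonant_timeFlip D g).2 hg)
      (by simpa [timeFlip] using hm)
    refine ⟨g₀, h0, ?_⟩
    rcases h with h | h
    · exact Or.inr (Or.inr (Or.inl (by rw [← h, timeFlip_timeFlip])))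
    · refine Or.inr (Or.inr (Or.inr ?_))
      have : timeFlip (timeFlip g) = timeFlip (spaceFlip g₀) := by rw [h]
      rw [timeFlip_timeFlip] at this
      exact this
  · obtain ⟨g₀, h0, h⟩ := pos g hg hm
    exact ⟨g₀, h0, h.imp id Or.inl⟩

omit hω hβ₀ hΩ

variable (K)

/-- The functional `p · F - |p| k` at the mode `g`, where `|p| = R`. -/
def kernelFun (D : StandingWaveData) (R : ℝ) (g : Mode) : Seq →L[ℝ] ℝ :=
  (wave₁ D g • comp₁ + wave₂ D g • comp₂ - R • comp₀).comp (coefL K g)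

theorem kernelFun_apply (R : ℝ) (g : Mode) (f : Seq) : kernelFun K D R g f =
    wave₁ D g * (coef K f g).2.1 + wave₂ D g * (coef K f g).2.2 - R * (coef K f g).1 := rfl

variable {K}

/-- The solvability conditions at the eight resonant modes are exchanged by the two reflections, so
on symmetric data only two of them are independent. -/
theorem balanced_of_kernelFun (hω : 0 < D.ω) (hβ₀ : 0 < D.β₀) (hk₁ : 0 < D.k₁) (hk₂ : 0 < D.k₂)
    (hΩ : D.Omega D.β₀ = {(1, 0, D.q), (-1, 0, D.q), (0, 1, D.q), (0, -1, D.q)}) {f : Seq}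
    (hf : f ∈ symSpace K) (h₁ : kernelFun K D (R₁ D) (1, 0, D.q) f = 0)
    (h₂ : kernelFun K D (R₂ D) (0, 1, D.q) f = 0) : Balanced D K (partialInv hC hb f) f := by
  refine balanced_partialInv hC hb hβ₀.ne' fun g hg => ?_
  obtain ⟨g₀, hg₀, hcase⟩ := resonant_cases hω hβ₀ hΩ hg
  have key : D.β₀ * (wave₁ D g₀ * (coef K f g₀).2.1 + wave₂ D g₀ * (coef K f g₀).2.2)
      = disp D g₀ * (coef K f g₀).1 := by
    rcases hg₀ with rfl | hg₀
    · rw [kernelFun_apply] at h₁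
      rw [disp_e₁ hΩ hk₁]; linear_combination D.β₀ * h₁
    · rw [Set.mem_singleton_iff] at hg₀
      subst hg₀
      rw [kernelFun_apply] at h₂
      rw [disp_e₂ hΩ hk₂]; linear_combination D.β₀ * h₂
  rcases hcase with rfl | rfl | rfl | rfl
  · exact key
  · rw [hf.1, wave₁_spaceFlip, wave₂_spaceFlip, disp_spaceFlip, conjVec_apply]
    linear_combination key
  · rw [hf.2, wave₁_timeFlip, wave₂_timeFlip, disp_timeFlip, conjVec_apply]
    linear_combination -key
  · rw [hf.1, hf.2, wave₁_spaceFlip, wave₂_spaceFlip, disp_spaceFlip, wave₁_timeFlip,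
      wave₂_timeFlip, disp_timeFlip, conjVec_conjVec]
    linear_combination -key

theorem kernelFun_eq_zero {i j : ZMod 2} {f : Seq} (hf : f ∈ parSpace K i j) {g : Mode}
    (hg : ¬((g.1 : ZMod 2) = i ∧ (g.2.1 : ZMod 2) = j)) (R : ℝ) : kernelFun K D R g f = 0 := by
  rw [kernelFun_apply, hf g hg]; simp

end StandingWave
end

noncomputable section
namespace StandingWave

/-! ### Symmetric trigonometric monomials -/

variable {D : StandingWaveData} (K : ℕ)

/-- The symmetric sequence generated by the coefficient `a` at the mode `g`. -/
def sbas (g : Mode) (a : Vec) : Seq :=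
  bas K g a + bas K (spaceFlip g) (conjVec a) + bas K (timeFlip g) (conjVec a)
    + bas K (spaceFlip (timeFlip g)) a

theorem coef_sbas (g : Mode) (a : Vec) (h : Mode) : coef K (sbas K g a) h =
    (if h = g then a else 0) + (if h = spaceFlip g then conjVec a else 0)
      + (if h = timeFlip g then conjVec a else 0)
      + (if h = spaceFlip (timeFlip g) then a else 0) := by
  simp only [sbas, coef_add, coef_bas]

theorem sbas_mem_symSpace (g : Mode) (a : Vec) : sbas K g a ∈ symSpace K := by
  have hs : ∀ x y : Mode, spaceFlip x = y ↔ x = spaceFlip y := fun x y =>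
    ⟨fun h => by rw [← h, spaceFlip_spaceFlip], fun h => by rw [h, spaceFlip_spaceFlip]⟩
  have ht : ∀ x y : Mode, timeFlip x = y ↔ x = timeFlip y := fun x y =>
    ⟨fun h => by rw [← h, timeFlip_timeFlip], fun h => by rw [h, timeFlip_timeFlip]⟩
  have hc : ∀ x : Mode, timeFlip (spaceFlip x) = spaceFlip (timeFlip x) := fun x => rfl
  constructor <;> intro h
  · simp only [coef_sbas, hs, spaceFlip_spaceFlip, map_add, apply_ite conjVec, map_zero,
      conjVec_conjVec]
    abel
  · simp only [coef_sbas, ht, timeFlip_timeFlip, hc, map_add, apply_ite conjVec, map_zero,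
      conjVec_conjVec]
    abel

theorem sbas_mem_parSpace {g : Mode} {i j : ZMod 2} (hi : (g.1 : ZMod 2) = i)
    (hj : (g.2.1 : ZMod 2) = j) (a : Vec) : sbas K g a ∈ parSpace K i j := by
  intro h hh
  have hn : ∀ n : ZMod 2, -n = n := by decide
  rw [coef_sbas, if_neg, if_neg, if_neg, if_neg]
  · simp
  all_goals
    rintro rfl
    simp only [spaceFlip, timeFlip, Int.cast_neg, hn, hi, hj, and_self, not_true_eq_false] at hh

/-- The sixteen products of monomials form four orbits under the two reflections. -/
theorem quad_sbas (g h : Mode) (a b : Vec) : quad K (sbas K g a) (sbas K h b) =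
    sbas K (g + h) (interact a b) + sbas K (g + spaceFlip h) (interact a (conjVec b))
      + sbas K (g + timeFlip h) (interact a (conjVec b))
      + sbas K (g + spaceFlip (timeFlip h)) (interact a b) := by
  have hs : ∀ x y, spaceFlip (x + y) = spaceFlip x + spaceFlip y := fun x y => by
    ext <;> simp [spaceFlip] <;> ring
  have ht : ∀ x y, timeFlip (x + y) = timeFlip x + timeFlip y := fun x y => by
    ext <;> simp [timeFlip]; ring
  have hc : ∀ x : Mode, timeFlip (spaceFlip x) = spaceFlip (timeFlip x) := fun x => rfl
  simp only [sbas, map_add, add_apply, quad_bas_bas, hs, ht,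
    spaceFlip_spaceFlip, timeFlip_timeFlip, hc, ← interact_conjVec, conjVec_conjVec]
  abel

/-- At zero frequency the time reflection fixes the mode, so the vector parts cancel in pairs. -/
theorem sbas_time_zero (i j : ℤ) (a : Vec) :
    sbas K (i, j, 0) a = sbas K (i, j, 0) (a.1, 0, 0) := by
  have h0 : timeFlip (i, j, 0) = (i, j, 0) := by simp [timeFlip]
  have key : ∀ b : Vec, sbas K (i, j, 0) b
      = bas K (i, j, 0) (b + conjVec b) + bas K (spaceFlip (i, j, 0)) (b + conjVec b) := by
    intro b
    rw [sbas, h0, bas_add, bas_add]; abel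
  rw [key, key]
  have : a + conjVec a = ((a.1, 0, 0) : Vec) + conjVec (a.1, 0, 0) := by
    ext <;> simp [conjVec_apply]
  rw [this]

theorem balanced_sbas {g : Mode} {a : Vec}
    (h0 : disp D g * a.1 + D.β₀ * (wave₁ D g * a.2.1 + wave₂ D g * a.2.2) = 0)
    (h1 : disp D g * a.2.1 + D.β₀ * wave₁ D g * a.1 = 0)
    (h2 : disp D g * a.2.2 + D.β₀ * wave₂ D g * a.1 = 0) : Balanced D K (sbas K g a) 0 := by
  have key : ∀ g a, disp D g * a.1 + D.β₀ * (wave₁ D g * a.2.1 + wave₂ D g * a.2.2) = 0 →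
      disp D g * a.2.1 + D.β₀ * wave₁ D g * a.1 = 0 →
      disp D g * a.2.2 + D.β₀ * wave₂ D g * a.1 = 0 → Balanced D K (bas K g a) 0 := by
    intro g a h0 h1 h2 h
    rw [coef_bas, coef_zero]
    split_ifs with hh
    · subst hh
      simp only [Prod.fst_zero, Prod.snd_zero, mul_zero, add_zero, neg_zero]
      exact ⟨h0, h1, h2⟩
    · simp
  have hS : Balanced D K (bas K (spaceFlip g) (conjVec a)) 0 := by
    apply key <;> simp only [disp_spaceFlip, wave₁_spaceFlip, wave₂_spaceFlip, conjVec_apply]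
    · linear_combination h0
    · linear_combination -h1
    · linear_combination -h2
  have hT : Balanced D K (bas K (timeFlip g) (conjVec a)) 0 := by
    apply key <;> simp only [disp_timeFlip, wave₁_timeFlip, wave₂_timeFlip, conjVec_apply]
    · linear_combination -h0
    · linear_combination h1
    · linear_combination h2
  have hST : Balanced D K (bas K (spaceFlip (timeFlip g)) a) 0 := by
    apply key <;> simp only [disp_spaceFlip, wave₁_spaceFlip, wave₂_spaceFlip, disp_timeFlip,
      wave₁_timeFlip, wave₂_timeFlip]
    · linear_combination -h0
    · linear_combination -h1
    · linear_combination -h2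
  have h := (((key g a h0 h1 h2).add hS).add hT).add hST
  rw [add_zero, add_zero, add_zero] at h
  exact h

theorem field_comp₀_sbas (g : Mode) (a : Vec) (x₁ x₂ t : ℝ) :
    field D K comp₀ (sbas K g a) x₁ x₂ t
      = 4 * a.1 * Real.cos (wave₁ D g * x₁ + wave₂ D g * x₂) * Real.cos (g.2.2 * t) := by
  simp only [sbas, field_add abs_comp₀_le, field_bas, comp₀_apply, conjVec_apply, angle,
    wave₁_spaceFlip, wave₂_spaceFlip, wave₁_timeFlip, wave₂_timeFlip]
  simp only [spaceFlip, timeFlip, Int.cast_neg, neg_mul]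
  rw [show -(wave₁ D g * x₁) + -(wave₂ D g * x₂) = -(wave₁ D g * x₁ + wave₂ D g * x₂) by ring]
  simp only [Real.cos_add, Real.cos_neg, Real.sin_neg]
  ring

theorem field_comp₁_sbas (g : Mode) (a : Vec) (x₁ x₂ t : ℝ) :
    field D K comp₁ (sbas K g a) x₁ x₂ t
      = -(4 * a.2.1 * Real.sin (wave₁ D g * x₁ + wave₂ D g * x₂) * Real.sin (g.2.2 * t)) := by
  simp only [sbas, field_add abs_comp₁_le, field_bas, comp₁_apply, conjVec_apply, angle,
    wave₁_spaceFlip, wave₂_spaceFlip, wave₁_timeFlip, wave₂_timeFlip]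
  simp only [spaceFlip, timeFlip, Int.cast_neg, neg_mul]
  rw [show -(wave₁ D g * x₁) + -(wave₂ D g * x₂) = -(wave₁ D g * x₁ + wave₂ D g * x₂) by ring]
  simp only [Real.cos_add _ (_ * t), Real.cos_add _ (-(_ * t)), Real.cos_neg, Real.sin_neg]
  ring

theorem field_comp₂_sbas (g : Mode) (a : Vec) (x₁ x₂ t : ℝ) :
    field D K comp₂ (sbas K g a) x₁ x₂ t
      = -(4 * a.2.2 * Real.sin (wave₁ D g * x₁ + wave₂ D g * x₂) * Real.sin (g.2.2 * t)) := by
  simp only [sbas, field_add abs_comp₂_le, field_bas, comp₂_apply, conjVec_apply, angle,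
    wave₁_spaceFlip, wave₂_spaceFlip, wave₁_timeFlip, wave₂_timeFlip]
  simp only [spaceFlip, timeFlip, Int.cast_neg, neg_mul]
  rw [show -(wave₁ D g * x₁) + -(wave₂ D g * x₂) = -(wave₁ D g * x₁ + wave₂ D g * x₂) by ring]
  simp only [Real.cos_add _ (_ * t), Real.cos_add _ (-(_ * t)), Real.cos_neg, Real.sin_neg]
  ring

section
variable {C : ℝ} (hC : 0 ≤ C)
  (hb : ∀ g, ‖LinearMap.toContinuousLinearMap (invSymbol D g)‖ ≤ C)

theorem partialInv_sbas (g : Mode) (a : Vec) :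
    partialInv hC hb (sbas K g a) = sbas K g (invSymbol D g a) := by
  simp only [sbas, map_add, partialInv_bas, invSymbol_spaceFlip, invSymbol_timeFlip]
  rw [← conjVec_conjVec a, invSymbol_spaceFlip, invSymbol_timeFlip, conjVec_conjVec,
    conjVec_conjVec]

end

/-! ### The critical modes -/

variable (D) in
/-- The coefficient of the first critical mode. -/
def amp₁ : Vec := (R₁ D / 2, -(D.k₁ / 2), -(D.k₁ * D.τ₁ / 2))

variable (D) in
/-- The coefficient of the second critical mode. -/
def amp₂ : Vec := (R₂ D / 2, -(D.k₂ / 2), D.k₂ * D.τ₂ / 2)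

-- By `field_comp₀_sbas` and its analogues the amplitude is normalised so that the elevation is `2
-- k₁ s₁ cos θ₁ cos qt` and the velocity `2 k₁ (1, τ₁) sin θ₁ sin qt`.
variable (D) in
def crit₁ : Seq := sbas K (1, 0, D.q) (amp₁ D)

variable (D) in
def crit₂ : Seq := sbas K (0, 1, D.q) (amp₂ D)

theorem crit₁_mem_symSpace : crit₁ D K ∈ symSpace K := sbas_mem_symSpace K _ _
theorem crit₂_mem_symSpace : crit₂ D K ∈ symSpace K := sbas_mem_symSpace K _ _

theorem crit₁_mem_parSpace : crit₁ D K ∈ parSpace K 1 0 :=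
  sbas_mem_parSpace K (by simp) (by simp) _

theorem crit₂_mem_parSpace : crit₂ D K ∈ parSpace K 0 1 :=
  sbas_mem_parSpace K (by simp) (by simp) _

theorem wave₁_mk (i j m : ℤ) : wave₁ D (i, j, m) = D.k₁ * i + D.k₂ * j := rfl

theorem wave₂_mk (i j m : ℤ) : wave₂ D (i, j, m) = D.τ₁ * D.k₁ * i - D.τ₂ * D.k₂ * j := rfl

theorem R₁_sq : R₁ D ^ 2 = D.k₁ ^ 2 * (1 + D.τ₁ ^ 2) := by rw [R₁, mul_pow, s₁_sq]
theorem R₂_sq : R₂ D ^ 2 = D.k₂ ^ 2 * (1 + D.τ₂ ^ 2) := by rw [R₂, mul_pow, s₂_sq]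

/-- The coefficients at zero frequency of the partial inverse. -/
theorem invSymbol_time_zero (hβ₀ : D.β₀ ≠ 0) {i j : ℤ} (hP : waveSq D (i, j, 0) ≠ 0) (x : ℝ) :
    invSymbol D (i, j, 0) (x, 0, 0) = (-x / D.β₀, 0, 0) := by
  have h0 : disp D (i, j, 0) = 0 := by simp [disp]
  have hr : ¬Resonant D (i, j, 0) := fun h => h.1 rfl
  rw [invSymbol_of_not_resonant D hr, disc, h0]
  ext
  · dsimp only; field_simp; ring
  · simp
  · simp

/-- The data act only through `p · F` and `p k`, which vanish for `p = 0`. This discards the purely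
temporal products and later keeps the average of the solution equal to zero. -/
theorem invSymbol_wave_zero (m : ℤ) (a : Vec) : invSymbol D (0, 0, m) a = 0 := by
  have h1 : wave₁ D (0, 0, m) = 0 := by simp [wave₁_mk]
  have h2 : wave₂ D (0, 0, m) = 0 := by simp [wave₂_mk]
  have h3 : waveSq D (0, 0, m) = 0 := by simp [waveSq, h1, h2]
  have hr : ¬Resonant D (0, 0, m) := by
    rintro ⟨hm, hd⟩
    simp only [disc, disp, h3] at hd
    simp at hd
    exact hm hd
  rw [invSymbol_of_not_resonant D hr, h1, h2, h3]
  simp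

section
variable (hω : 0 < D.ω) (hk₁ : 0 < D.k₁) (hk₂ : 0 < D.k₂) (hτ₁ : 0 < D.τ₁) (hτ₂ : 0 < D.τ₂)
  (hβ₀ : 0 < D.β₀) (hΩ : D.Omega D.β₀ = {(1, 0, D.q), (-1, 0, D.q), (0, 1, D.q), (0, -1, D.q)})
include hΩ

theorem balanced_crit₁ (hk₁ : 0 < D.k₁) : Balanced D K (crit₁ D K) 0 := by
  refine balanced_sbas K ?_ ?_ ?_ <;>
    simp only [disp_e₁ hΩ hk₁, wave₁_mk, wave₂_mk, amp₁] <;> push_cast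
  · linear_combination D.β₀ / 2 * R₁_sq (D := D)
  · ring
  · ring

theorem balanced_crit₂ (hk₂ : 0 < D.k₂) : Balanced D K (crit₂ D K) 0 := by
  refine balanced_sbas K ?_ ?_ ?_ <;>
    simp only [disp_e₂ hΩ hk₂, wave₁_mk, wave₂_mk, amp₂] <;> push_cast
  · linear_combination D.β₀ / 2 * R₂_sq (D := D)
  · ring
  · ring

include hω hβ₀

/-- Resonant modes have frequency `q` or `-q`, and `2 q` is neither since `q > 0`. The denominators
of the coefficients `a_i` and `b_i` are thus nonzero. -/
theorem disc_ne_zero {i j : ℤ} (h : ¬(i = 0 ∨ j = 0) ∨ i = 2 ∨ j = 2) :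
    disc D (i, j, 2 * D.q) ≠ 0 := by
  have hq := q_pos hΩ
  intro hd
  have hm : 2 * D.q ≠ 0 := by omega
  obtain ⟨g₀, hg₀, hc⟩ := resonant_cases hω hβ₀ hΩ (g := (i, j, 2 * D.q)) ⟨hm, hd⟩
  simp only [Set.mem_insert_iff, Set.mem_singleton_iff] at hg₀
  rcases hg₀ with rfl | rfl <;>
  simp only [spaceFlip, timeFlip, Prod.mk.injEq] at hc <;> omega

end

end StandingWave
end

noncomputable section
namespace StandingWave

/-! ### The quadratic response to the critical modes -/

variable {D : StandingWaveData} (K : ℕ)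

theorem sbas_zero (g : Mode) : sbas K g 0 = 0 := by
  simp only [sbas, bas_zero, map_zero, add_zero]

theorem coef_sbas_mk (i j m i' j' m' : ℤ) (a : Vec) : coef K (sbas K (i, j, m) a) (i', j', m') =
    (if i' = i ∧ j' = j ∧ m' = m then a else 0)
      + (if i' = -i ∧ j' = -j ∧ m' = m then conjVec a else 0)
      + (if i' = i ∧ j' = j ∧ m' = -m then conjVec a else 0)
      + (if i' = -i ∧ j' = -j ∧ m' = -m then a else 0) := by
  simp only [coef_sbas, spaceFlip, timeFlip, Prod.mk.injEq]

theorem quad_sbas_mk (i j m i' j' m' : ℤ) (a b : Vec) :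
    quad K (sbas K (i, j, m) a) (sbas K (i', j', m') b) =
    sbas K (i + i', j + j', m + m') (interact a b)
      + sbas K (i - i', j - j', m + m') (interact a (conjVec b))
      + sbas K (i + i', j + j', m - m') (interact a (conjVec b))
      + sbas K (i - i', j - j', m - m') (interact a b) := by
  rw [quad_sbas]
  simp only [spaceFlip, timeFlip, Prod.mk_add_mk, sub_eq_add_neg]

theorem invSymbol_eq {g : Mode} (h : ¬Resonant D g) {l P d x y : ℝ} (hl : disp D g = l)
    (hP : waveSq D g = P) (hd : disc D g = d) {a : Vec} (hx : a.1 = x)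
    (hy : wave₁ D g * a.2.1 + wave₂ D g * a.2.2 = y) :
    invSymbol D g a = ((-l * y + D.β₀ * P * x) / d, wave₁ D g * ((-l * x + D.β₀ * y) / d),
      wave₂ D g * ((-l * x + D.β₀ * y) / d)) := by
  rw [invSymbol_of_not_resonant D h, hl, hP, hd, hx, hy]

theorem waveSq_ne_zero (hk₁ : 0 < D.k₁) (hk₂ : 0 < D.k₂) (hτ₁ : 0 < D.τ₁) (hτ₂ : 0 < D.τ₂)
    {g : Mode} (h : g.1 ≠ 0 ∨ g.2.1 ≠ 0) : waveSq D g ≠ 0 := by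
  intro h0
  rcases h with h | h
  · have h1 := sq_index₁_le (D := D) g
    rw [h0, mul_zero] at h1
    have h2 : D.k₁ * (D.τ₁ + D.τ₂) * (g.1 : ℝ) ≠ 0 :=
      mul_ne_zero (by positivity) (by exact_mod_cast h)
    exact absurd h1 (not_le.2 (by positivity))
  · have h1 := sq_index₂_le (D := D) g
    rw [h0, mul_zero] at h1
    have h2 : D.k₂ * (D.τ₁ + D.τ₂) * (g.2.1 : ℝ) ≠ 0 :=
      mul_ne_zero (by positivity) (by exact_mod_cast h)
    exact absurd h1 (not_le.2 (by positivity))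

theorem waveSq_two_zero (m : ℤ) : waveSq D (2, 0, m) = 4 * R₁ D ^ 2 := by
  rw [waveSq, wave₁_mk, wave₂_mk, R₁_sq]; push_cast; ring

theorem waveSq_zero_two (m : ℤ) : waveSq D (0, 2, m) = 4 * R₂ D ^ 2 := by
  rw [waveSq, wave₁_mk, wave₂_mk, R₂_sq]; push_cast; ring

theorem waveSq_plus (m : ℤ) : waveSq D (1, 1, m) = D.sqPlus := by
  rw [waveSq, wave₁_mk, wave₂_mk, StandingWaveData.sqPlus]; push_cast; ring

theorem waveSq_minus (m : ℤ) : waveSq D (1, -1, m) = D.sqMinus := by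
  rw [waveSq, wave₁_mk, wave₂_mk, StandingWaveData.sqMinus]; push_cast; ring

theorem disp_two_q (i j : ℤ) :
    disp D (i, j, 2 * D.q) = 2 * D.q * (1 + D.ω * waveSq D (i, j, 2 * D.q)) := by
  rw [disp]; push_cast; ring

section
variable (hω : 0 < D.ω) (hβ₀ : 0 < D.β₀)
  (hΩ : D.Omega D.β₀ = {(1, 0, D.q), (-1, 0, D.q), (0, 1, D.q), (0, -1, D.q)})
include hω hβ₀ hΩ

/-- For the self-interaction of the first critical mode, `x` and `y` are the values of `k` and `p ·
F`; Cramer's rule then produces `a₁` and `a₂`. The three analogues below produce the other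
coefficients. -/
theorem invSymbol_two_zero : invSymbol D (2, 0, 2 * D.q) (interact (amp₁ D) (amp₁ D))
    = (-D.a₁ / 2, -D.a₂ / 2, -(D.τ₁ * D.a₂) / 2) := by
  have hd := disc_ne_zero hω hβ₀ hΩ (i := 2) (j := 0) (by simp)
  have hl : disp D (2, 0, 2 * D.q) = 2 * D.q * (1 + 4 * D.ω * D.k₁ ^ 2 * D.s₁ ^ 2) := by
    rw [disp_two_q, waveSq_two_zero, R₁]; ring
  have hE : disc D (2, 0, 2 * D.q) = 4 * D.q ^ 2 * (1 + 4 * D.ω * D.k₁ ^ 2 * D.s₁ ^ 2) ^ 2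
      - 4 * D.β₀ ^ 2 * D.k₁ ^ 2 * D.s₁ ^ 2 := by
    rw [disc, hl, waveSq_two_zero, R₁]; ring
  have hs := s₁_sq (D := D)
  rw [invSymbol_eq (fun h => hd h.2) hl (waveSq_two_zero _) rfl
    (x := D.k₁ ^ 2 * D.s₁ ^ 2 / 8) (y := -(D.k₁ ^ 3 * D.s₁ ^ 3 / 2)), StandingWaveData.a₁,
    StandingWaveData.a₂, ← hE]
  · generalize disc D (2, 0, 2 * D.q) = d at hd
    simp only [wave₁_mk, wave₂_mk, R₁]
    ext <;> dsimp only <;> field_simp <;> push_cast <;> ring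
  · simp only [interact, amp₁]; rw [hs]; ring
  · simp only [interact, amp₁, wave₁_mk, wave₂_mk, R₁]; push_cast
    linear_combination (D.k₁ ^ 3 * D.s₁ / 2) * hs

theorem invSymbol_zero_two : invSymbol D (0, 2, 2 * D.q) (interact (amp₂ D) (amp₂ D))
    = (-D.a₃ / 2, -D.a₄ / 2, D.τ₂ * D.a₄ / 2) := by
  have hd := disc_ne_zero hω hβ₀ hΩ (i := 0) (j := 2) (by simp)
  have hl : disp D (0, 2, 2 * D.q) = 2 * D.q * (1 + 4 * D.ω * D.k₂ ^ 2 * D.s₂ ^ 2) := by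
    rw [disp_two_q, waveSq_zero_two, R₂]; ring
  have hE : disc D (0, 2, 2 * D.q) = 4 * D.q ^ 2 * (1 + 4 * D.ω * D.k₂ ^ 2 * D.s₂ ^ 2) ^ 2
      - 4 * D.β₀ ^ 2 * D.k₂ ^ 2 * D.s₂ ^ 2 := by
    rw [disc, hl, waveSq_zero_two, R₂]; ring
  have hs := s₂_sq (D := D)
  rw [invSymbol_eq (fun h => hd h.2) hl (waveSq_zero_two _) rfl
    (x := D.k₂ ^ 2 * D.s₂ ^ 2 / 8) (y := -(D.k₂ ^ 3 * D.s₂ ^ 3 / 2)), StandingWaveData.a₃,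
    StandingWaveData.a₄, ← hE]
  · generalize disc D (0, 2, 2 * D.q) = d at hd
    simp only [wave₁_mk, wave₂_mk, R₂]
    ext <;> dsimp only <;> field_simp <;> push_cast <;> ring
  · simp only [interact, amp₂]; rw [hs]; ring
  · simp only [interact, amp₂, wave₁_mk, wave₂_mk, R₂]; push_cast
    linear_combination (D.k₂ ^ 3 * D.s₂ / 2) * hs

theorem invSymbol_plus : invSymbol D (1, 1, 2 * D.q) (interact (amp₁ D) (amp₂ D))
    = (-D.b₁ / 4, -D.b₂ / 4, -D.b₃ / 4) := by
  have hd := disc_ne_zero hω hβ₀ hΩ (i := 1) (j := 1) (by simp)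
  have hl : disp D (1, 1, 2 * D.q) = 2 * D.q * (1 + D.ω * D.sqPlus) := by
    rw [disp_two_q, waveSq_plus]
  have hE : disc D (1, 1, 2 * D.q) = D.d₁ := by
    rw [disc, hl, waveSq_plus, StandingWaveData.d₁]; ring
  rw [invSymbol_eq (fun h => hd h.2) hl (waveSq_plus _) hE
    (x := D.dot / 8) (y := -(D.bracketPlus / 8)), StandingWaveData.b₁,
    StandingWaveData.b₂, StandingWaveData.b₃]
  · rw [hE] at hd
    simp only [wave₁_mk, wave₂_mk]
    ext <;> dsimp only <;> field_simp <;> push_cast <;> ring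
  · simp only [interact, amp₁, amp₂, StandingWaveData.dot]; ring
  · simp only [interact, amp₁, amp₂, wave₁_mk, wave₂_mk, R₁, R₂, StandingWaveData.bracketPlus]
    push_cast; ring

theorem invSymbol_minus : invSymbol D (1, -1, 2 * D.q) (interact (amp₁ D) (conjVec (amp₂ D)))
    = (-D.b₄ / 4, -D.b₅ / 4, -D.b₆ / 4) := by
  have hd := disc_ne_zero hω hβ₀ hΩ (i := 1) (j := -1) (by simp)
  have hl : disp D (1, -1, 2 * D.q) = 2 * D.q * (1 + D.ω * D.sqMinus) := by
    rw [disp_two_q, waveSq_minus]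
  have hE : disc D (1, -1, 2 * D.q) = D.d₂ := by
    rw [disc, hl, waveSq_minus, StandingWaveData.d₂]; ring
  rw [invSymbol_eq (fun h => hd h.2) hl (waveSq_minus _) hE
    (x := -(D.dot / 8)) (y := D.bracketMinus / 8), StandingWaveData.b₄,
    StandingWaveData.b₅, StandingWaveData.b₆]
  · rw [hE] at hd
    simp only [wave₁_mk, wave₂_mk]
    ext <;> dsimp only <;> field_simp <;> push_cast <;> ring
  · simp only [interact, amp₁, amp₂, conjVec_apply, StandingWaveData.dot]; ring
  · simp only [interact, amp₁, amp₂, conjVec_apply, wave₁_mk, wave₂_mk, R₁, R₂,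
      StandingWaveData.bracketMinus]
    push_cast; ring

variable (hk₁ : 0 < D.k₁) (hk₂ : 0 < D.k₂) (hτ₁ : 0 < D.τ₁) (hτ₂ : 0 < D.τ₂)
  {C : ℝ} (hC : 0 ≤ C) (hb : ∀ g, ‖LinearMap.toContinuousLinearMap (invSymbol D g)‖ ≤ C)

omit hω hΩ in
include hk₁ hk₂ hτ₁ hτ₂ in
theorem partialInv_sbas_time_zero {i j : ℤ} (h : i ≠ 0 ∨ j ≠ 0) (a : Vec) :
    partialInv hC hb (sbas K (i, j, 0) a) = sbas K (i, j, 0) (-a.1 / D.β₀, 0, 0) := by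
  rw [sbas_time_zero, partialInv_sbas,
    invSymbol_time_zero hβ₀.ne' (waveSq_ne_zero hk₁ hk₂ hτ₁ hτ₂ h)]

omit hω hβ₀ hΩ in
theorem partialInv_sbas_wave_zero (m : ℤ) (a : Vec) :
    partialInv hC hb (sbas K (0, 0, m) a) = 0 := by
  rw [partialInv_sbas, invSymbol_wave_zero, sbas_zero]

include hk₁ hk₂ hτ₁ hτ₂

/-- Among the four orbits of the square, those with `p = 0` are annihilated. A second harmonic and a
steady deformation remain. -/
theorem partialInv_quad_crit₁ : partialInv hC hb (quad K (crit₁ D K) (crit₁ D K))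
    = sbas K (2, 0, 2 * D.q) (-D.a₁ / 2, -D.a₂ / 2, -(D.τ₁ * D.a₂) / 2)
      + sbas K (2, 0, 0) (R₁ D ^ 2 / (8 * D.β₀), 0, 0) := by
  have h : -(interact (amp₁ D) (conjVec (amp₁ D))).1 / D.β₀ = R₁ D ^ 2 / (8 * D.β₀) := by
    simp only [interact, amp₁, conjVec_apply, R₁_sq]; field_simp; ring
  rw [crit₁, quad_sbas_mk]
  norm_num only [map_add]
  rw [← two_mul D.q, sub_self, partialInv_sbas_wave_zero, partialInv_sbas_wave_zero,
    partialInv_sbas_time_zero K hβ₀ hk₁ hk₂ hτ₁ hτ₂ hC hb (by simp), partialInv_sbas,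
    invSymbol_two_zero hω hβ₀ hΩ, h, add_zero, add_zero]

theorem partialInv_quad_crit₂ : partialInv hC hb (quad K (crit₂ D K) (crit₂ D K))
    = sbas K (0, 2, 2 * D.q) (-D.a₃ / 2, -D.a₄ / 2, D.τ₂ * D.a₄ / 2)
      + sbas K (0, 2, 0) (R₂ D ^ 2 / (8 * D.β₀), 0, 0) := by
  have h : -(interact (amp₂ D) (conjVec (amp₂ D))).1 / D.β₀ = R₂ D ^ 2 / (8 * D.β₀) := by
    simp only [interact, amp₂, conjVec_apply, R₂_sq]; field_simp; ring
  rw [crit₂, quad_sbas_mk]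
  norm_num only [map_add]
  rw [← two_mul D.q, sub_self, partialInv_sbas_wave_zero, partialInv_sbas_wave_zero,
    partialInv_sbas_time_zero K hβ₀ hk₁ hk₂ hτ₁ hτ₂ hC hb (by simp), partialInv_sbas,
    invSymbol_zero_two hω hβ₀ hΩ, h, add_zero, add_zero]

theorem partialInv_quad_crit₁_crit₂ : partialInv hC hb (quad K (crit₁ D K) (crit₂ D K))
    = sbas K (1, 1, 2 * D.q) (-D.b₁ / 4, -D.b₂ / 4, -D.b₃ / 4)
      + sbas K (1, -1, 2 * D.q) (-D.b₄ / 4, -D.b₅ / 4, -D.b₆ / 4)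
      + sbas K (1, 1, 0) (D.dot / (8 * D.β₀), 0, 0)
      + sbas K (1, -1, 0) (-(D.dot / (8 * D.β₀)), 0, 0) := by
  have h1 : -(interact (amp₁ D) (conjVec (amp₂ D))).1 / D.β₀ = D.dot / (8 * D.β₀) := by
    simp only [interact, amp₁, amp₂, conjVec_apply, StandingWaveData.dot]; field_simp; ring
  have h2 : -(interact (amp₁ D) (amp₂ D)).1 / D.β₀ = -(D.dot / (8 * D.β₀)) := by
    simp only [interact, amp₁, amp₂, StandingWaveData.dot]; field_simp; ring
  rw [crit₁, crit₂, quad_sbas_mk]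
  norm_num only [map_add]
  rw [← two_mul D.q, sub_self, partialInv_sbas_time_zero K hβ₀ hk₁ hk₂ hτ₁ hτ₂ hC hb (by simp),
    partialInv_sbas_time_zero K hβ₀ hk₁ hk₂ hτ₁ hτ₂ hC hb (by simp), partialInv_sbas,
    partialInv_sbas, invSymbol_plus hω hβ₀ hΩ, invSymbol_minus hω hβ₀ hΩ, h1, h2]

end

end StandingWave
end

noncomputable section
namespace StandingWave

/-! ### The cubic coefficients -/

variable {D : StandingWaveData} (K : ℕ)

theorem kernelFun_crit₁ (hq : 0 < D.q) :
    kernelFun K D (R₁ D) (1, 0, D.q) (crit₁ D K) = -R₁ D ^ 2 := by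
  rw [kernelFun_apply, crit₁, coef_sbas_mk]
  simp (disch := omega) only [if_neg, and_self, if_true, add_zero]
  simp only [wave₁_mk, wave₂_mk, amp₁]
  push_cast
  linear_combination 1 / 2 * R₁_sq (D := D)

theorem kernelFun_crit₂ (hq : 0 < D.q) :
    kernelFun K D (R₂ D) (0, 1, D.q) (crit₂ D K) = -R₂ D ^ 2 := by
  rw [kernelFun_apply, crit₂, coef_sbas_mk]
  simp (disch := omega) only [if_neg, and_self, if_true, add_zero]
  simp only [wave₁_mk, wave₂_mk, amp₂]
  push_cast
  linear_combination 1 / 2 * R₂_sq (D := D)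

variable (hω : 0 < D.ω) (hβ₀ : 0 < D.β₀)
  (hΩ : D.Omega D.β₀ = {(1, 0, D.q), (-1, 0, D.q), (0, 1, D.q), (0, -1, D.q)})
  (hk₁ : 0 < D.k₁) (hk₂ : 0 < D.k₂) (hτ₁ : 0 < D.τ₁) (hτ₂ : 0 < D.τ₂)
  {C : ℝ} (hC : 0 ≤ C) (hb : ∀ g, ‖LinearMap.toContinuousLinearMap (invSymbol D g)‖ ≤ C)
include hω hβ₀ hΩ hk₁ hk₂ hτ₁ hτ₂

/-- The mode `(1, 0, q)` is reached from the quadratic response only through `(2, 0, 2q)` and `(2,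
0, 0)`; their contributions add up to a multiple of `l₁`. -/
theorem kernelFun_crit₁_crit₁ : kernelFun K D (R₁ D) (1, 0, D.q)
    (quad K (crit₁ D K) (partialInv hC hb (quad K (crit₁ D K) (crit₁ D K))))
      = D.l₁ / (4 * D.β₀) := by
  have hq := q_pos hΩ
  have hs := s₁_sq (D := D)
  rw [partialInv_quad_crit₁ K hω hβ₀ hΩ hk₁ hk₂ hτ₁ hτ₂, crit₁, map_add, quad_sbas_mk,
    quad_sbas_mk, kernelFun_apply]
  simp only [coef_add, coef_sbas_mk]
  simp (disch := omega) only [if_neg, if_pos, add_zero, zero_add]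
  simp only [wave₁_mk, wave₂_mk, amp₁, interact, conjVec_apply, Prod.fst_add, Prod.snd_add,
    StandingWaveData.l₁, R₁]
  push_cast
  field_simp
  grind

/-- The response to the second mode alone has `n₂ = ±2`, and multiplication by the first critical
mode leaves `n₂` unchanged, so `(1, 0, q)` is not reached. -/
theorem kernelFun_crit₁_crit₂ : kernelFun K D (R₁ D) (1, 0, D.q)
    (quad K (crit₁ D K) (partialInv hC hb (quad K (crit₂ D K) (crit₂ D K)))) = 0 := by
  have hq := q_pos hΩ
  rw [partialInv_quad_crit₂ K hω hβ₀ hΩ hk₁ hk₂ hτ₁ hτ₂, crit₁, map_add, quad_sbas_mk,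
    quad_sbas_mk, kernelFun_apply]
  simp only [coef_add, coef_sbas_mk]
  simp (disch := omega) only [if_neg, add_zero, zero_add]
  simp

theorem kernelFun_crit₂_crit₁ : kernelFun K D (R₂ D) (0, 1, D.q)
    (quad K (crit₂ D K) (partialInv hC hb (quad K (crit₁ D K) (crit₁ D K)))) = 0 := by
  have hq := q_pos hΩ
  rw [partialInv_quad_crit₁ K hω hβ₀ hΩ hk₁ hk₂ hτ₁ hτ₂, crit₂, map_add, quad_sbas_mk,
    quad_sbas_mk, kernelFun_apply]
  simp only [coef_add, coef_sbas_mk]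
  simp (disch := omega) only [if_neg, add_zero, zero_add]
  simp

theorem kernelFun_crit₂_crit₂ : kernelFun K D (R₂ D) (0, 1, D.q)
    (quad K (crit₂ D K) (partialInv hC hb (quad K (crit₂ D K) (crit₂ D K))))
      = D.l₃ / (4 * D.β₀) := by
  have hq := q_pos hΩ
  have hs := s₂_sq (D := D)
  rw [partialInv_quad_crit₂ K hω hβ₀ hΩ hk₁ hk₂ hτ₁ hτ₂, crit₂, map_add, quad_sbas_mk,
    quad_sbas_mk, kernelFun_apply]
  simp only [coef_add, coef_sbas_mk]
  simp (disch := omega) only [if_neg, if_pos, add_zero, zero_add]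
  simp only [wave₁_mk, wave₂_mk, amp₂, interact, conjVec_apply, Prod.fst_add, Prod.snd_add,
    StandingWaveData.l₃, R₂]
  push_cast
  field_simp
  grind

/-- The coupling of the amplitudes passes through the mixed modes `(1, ±1)`. This value and that of
`kernelFun_mixed₂` agree, so the limiting matrix is symmetric. -/
theorem kernelFun_mixed₁ : kernelFun K D (R₁ D) (1, 0, D.q)
    (quad K (crit₂ D K) (partialInv hC hb (quad K (crit₁ D K) (crit₂ D K))))
      = D.l₂ / (8 * D.β₀) := by
  have hq := q_pos hΩ
  have hs := s₁_sq (D := D)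
  rw [partialInv_quad_crit₁_crit₂ K hω hβ₀ hΩ hk₁ hk₂ hτ₁ hτ₂, crit₂]
  simp only [map_add, quad_sbas_mk, kernelFun_apply, coef_sbas_mk]
  simp (disch := omega) only [if_neg, if_pos, add_zero, zero_add]
  simp only [wave₁_mk, wave₂_mk, amp₂, interact, conjVec_apply,
    StandingWaveData.l₂, StandingWaveData.dot, R₁, R₂,
    Prod.fst_zero, Prod.snd_zero]
  push_cast
  simp only [mul_zero, mul_one, add_zero, zero_add, sub_zero, neg_zero]
  field_simp
  grind

theorem kernelFun_mixed₂ : kernelFun K D (R₂ D) (0, 1, D.q)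
    (quad K (crit₁ D K) (partialInv hC hb (quad K (crit₁ D K) (crit₂ D K))))
      = D.l₂ / (8 * D.β₀) := by
  have hq := q_pos hΩ
  have hs := s₂_sq (D := D)
  rw [partialInv_quad_crit₁_crit₂ K hω hβ₀ hΩ hk₁ hk₂ hτ₁ hτ₂, crit₁]
  simp only [map_add, quad_sbas_mk, kernelFun_apply, coef_sbas_mk]
  simp (disch := omega) only [if_neg, if_pos, add_zero, zero_add]
  simp only [wave₁_mk, wave₂_mk, amp₁, interact, conjVec_apply,
    StandingWaveData.l₂, StandingWaveData.dot, R₁, R₂,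
    Prod.fst_zero, Prod.snd_zero]
  push_cast
  simp only [mul_zero, mul_one, add_zero, zero_add, sub_zero, neg_zero, zero_sub]
  field_simp
  grind

end StandingWave
end

noncomputable section
namespace StandingWave

open StandingWaveData

/-! ### Space shifts -/

variable {D : StandingWaveData}

theorem phase_add (n₁ n₂ : ℤ) (x₁ x₂ σ₁ σ₂ : ℝ) : D.phase n₁ n₂ (x₁ + σ₁) (x₂ + σ₂)
    = D.phase n₁ n₂ σ₁ σ₂ * D.phase n₁ n₂ x₁ x₂ := by
  rw [phase, phase, phase, ← Complex.exp_add]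
  congr 1
  push_cast
  ring

theorem norm_phase (n₁ n₂ : ℤ) (x₁ x₂ : ℝ) : ‖D.phase n₁ n₂ x₁ x₂‖ = 1 := by
  rw [phase, mul_comm, Complex.norm_exp_ofReal_mul_I]

theorem sobolevTerm_mul_phase (s σ₁ σ₂ : ℝ) (c : ℤ × ℤ × ℕ → ℂ) :
    D.sobolevTerm s (fun n => c n * D.phase n.1 n.2.1 σ₁ σ₂) = D.sobolevTerm s c := by
  funext n
  rw [sobolevTerm, norm_mul, norm_phase, mul_one, sobolevTerm]

theorem memEven_shift {s C : ℝ} {u : ℝ → ℝ → ℝ → ℝ} (h : D.MemEven s C u) (σ₁ σ₂ : ℝ) :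
    D.MemEven s C (shift σ₁ σ₂ u) := by
  obtain ⟨c, h1, h2, h3⟩ := h
  refine ⟨fun n => c n * D.phase n.1 n.2.1 σ₁ σ₂, fun x₁ x₂ t => ?_, ?_, ?_⟩
  · refine hasSum_of_eq (h1 (x₁ + σ₁) (x₂ + σ₂) t) (fun n => ?_) rfl
    rw [phase_add]; ring
  · rwa [sobolevTerm_mul_phase]
  · simp [h3, phase, p₁, p₂]

theorem memOdd_shift {s : ℝ} {u : ℝ → ℝ → ℝ → ℝ} (h : D.MemOdd s u) (σ₁ σ₂ : ℝ) :
    D.MemOdd s (shift σ₁ σ₂ u) := by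
  obtain ⟨c, ⟨h0, h1⟩, h2⟩ := h
  refine ⟨fun n => c n * D.phase n.1 n.2.1 σ₁ σ₂, ⟨fun n₁ n₂ => ?_, fun x₁ x₂ t => ?_⟩, ?_⟩
  · simp [h0]
  · refine hasSum_of_eq (h1 (x₁ + σ₁) (x₂ + σ₂) t) (fun n => ?_) rfl
    rw [phase_add]; ring
  · rwa [sobolevTerm_mul_phase]

theorem dx₁_shift (σ₁ σ₂ : ℝ) (u : ℝ → ℝ → ℝ → ℝ) :
    dx₁ (shift σ₁ σ₂ u) = shift σ₁ σ₂ (dx₁ u) := by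
  funext x₁ x₂ t
  exact deriv_comp_add_const (f := fun y => u y (x₂ + σ₂) t) σ₁ x₁

theorem dx₂_shift (σ₁ σ₂ : ℝ) (u : ℝ → ℝ → ℝ → ℝ) :
    dx₂ (shift σ₁ σ₂ u) = shift σ₁ σ₂ (dx₂ u) := by
  funext x₁ x₂ t
  exact deriv_comp_add_const (f := fun y => u (x₁ + σ₁) y t) σ₂ x₂

theorem lap_shift (σ₁ σ₂ : ℝ) (u : ℝ → ℝ → ℝ → ℝ) :
    lap (shift σ₁ σ₂ u) = shift σ₁ σ₂ (lap u) := by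
  funext x₁ x₂ t
  simp only [lap, dx₁_shift, dx₂_shift]
  rfl

theorem isC3_shift {u : ℝ → ℝ → ℝ → ℝ} (h : IsC3 u) (σ₁ σ₂ : ℝ) : IsC3 (shift σ₁ σ₂ u) := by
  have h1 : ContDiff ℝ 3 fun z : ℝ × ℝ × ℝ => (z.1 + σ₁, z.2.1 + σ₂, z.2.2) := by fun_prop
  exact ContDiff.comp (g := fun z : ℝ × ℝ × ℝ => u z.1 z.2.1 z.2.2) h h1

theorem solvesBoussinesq_shift {β : ℝ} {η v₁ v₂ : ℝ → ℝ → ℝ → ℝ}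
    (h : D.SolvesBoussinesq β η v₁ v₂) (σ₁ σ₂ : ℝ) :
    D.SolvesBoussinesq β (shift σ₁ σ₂ η) (shift σ₁ σ₂ v₁) (shift σ₁ σ₂ v₂) := by
  obtain ⟨h0, h1, h2, h3⟩ := h
  refine ⟨isC3_shift h0 _ _, isC3_shift h1 _ _, isC3_shift h2 _ _, fun x₁ x₂ t => ?_⟩
  have e1 : dx₁ (fun x y r => shift σ₁ σ₂ η x y r * shift σ₁ σ₂ v₁ x y r)
      = shift σ₁ σ₂ (dx₁ fun x y r => η x y r * v₁ x y r) :=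
    dx₁_shift _ _ (fun x y r => η x y r * v₁ x y r)
  have e2 : dx₂ (fun x y r => shift σ₁ σ₂ η x y r * shift σ₁ σ₂ v₂ x y r)
      = shift σ₁ σ₂ (dx₂ fun x y r => η x y r * v₂ x y r) :=
    dx₂_shift _ _ (fun x y r => η x y r * v₂ x y r)
  have e3 : dx₁ (fun x y r => shift σ₁ σ₂ v₁ x y r ^ 2 + shift σ₁ σ₂ v₂ x y r ^ 2)
      = shift σ₁ σ₂ (dx₁ fun x y r => v₁ x y r ^ 2 + v₂ x y r ^ 2) :=
    dx₁_shift _ _ (fun x y r => v₁ x y r ^ 2 + v₂ x y r ^ 2)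
  have e4 : dx₂ (fun x y r => shift σ₁ σ₂ v₁ x y r ^ 2 + shift σ₁ σ₂ v₂ x y r ^ 2)
      = shift σ₁ σ₂ (dx₂ fun x y r => v₁ x y r ^ 2 + v₂ x y r ^ 2) :=
    dx₂_shift _ _ (fun x y r => v₁ x y r ^ 2 + v₂ x y r ^ 2)
  have e5 : ∀ u, dt (shift σ₁ σ₂ u) = shift σ₁ σ₂ (dt u) := fun u => rfl
  rw [e1, e2, e3, e4, e5, e5, e5, lap_shift, lap_shift, lap_shift, dx₁_shift, dx₂_shift,
    dx₁_shift, dx₂_shift]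
  exact h3 (x₁ + σ₁) (x₂ + σ₂) t

theorem isStandingWave_shift {β s C : ℝ} {η v₁ v₂ : ℝ → ℝ → ℝ → ℝ}
    (h : D.IsStandingWave β s C η v₁ v₂) (σ₁ σ₂ : ℝ) :
    D.IsStandingWave β s C (shift σ₁ σ₂ η) (shift σ₁ σ₂ v₁) (shift σ₁ σ₂ v₂) :=
  ⟨memEven_shift h.1 _ _, memOdd_shift h.2.1 _ _, memOdd_shift h.2.2.1 _ _,
    solvesBoussinesq_shift h.2.2.2 _ _⟩

/-! ### Fields of symmetric sequences -/

variable {K : ℕ} {s : ℝ}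

theorem isStandingWave_field (hK : 3 ≤ K) (hs : 0 ≤ s) (hsK : s ≤ K) {u : Seq}
    (hu : u ∈ symSpace K) (h0 : (coef K u (0, 0, 0)).1 = 0) {β : ℝ}
    (h : SolvesFourier D K β u) :
    D.IsStandingWave β s 0 (field D K comp₀ u) (field D K comp₁ u) (field D K comp₂ u) := by
  refine ⟨⟨_, hasCosSeries_field hu, (sobolev_fold hs hsK norm_one abs_comp₀_le u).1, ?_⟩,
    ⟨_, hasSinSeries_field₁ hu, (sobolev_fold hs hsK Complex.norm_I abs_comp₁_le u).1⟩,
    ⟨_, hasSinSeries_field₂ hu, (sobolev_fold hs hsK Complex.norm_I abs_comp₂_le u).1⟩,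
    solvesBoussinesq_of_fourier hK hu h⟩
  simp only [foldCoef, Nat.cast_zero, comp₀_apply, h0]
  simp

theorem evenNormLE_field (hs : 0 ≤ s) (hsK : s ≤ K) {u : Seq} (hu : u ∈ symSpace K) {B : ℝ}
    (hB : sobolevConst D s * ‖u‖ ≤ B) : D.EvenNormLE s (field D K comp₀ u) B :=
  ⟨_, hasCosSeries_field hu, (sobolev_fold hs hsK norm_one abs_comp₀_le u).1,
    (sobolev_fold hs hsK norm_one abs_comp₀_le u).2.trans hB⟩

theorem oddNormLE_field₁ (hs : 0 ≤ s) (hsK : s ≤ K) {u : Seq} (hu : u ∈ symSpace K) {B : ℝ}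
    (hB : sobolevConst D s * ‖u‖ ≤ B) : D.OddNormLE s (field D K comp₁ u) B :=
  ⟨_, hasSinSeries_field₁ hu, (sobolev_fold hs hsK Complex.norm_I abs_comp₁_le u).1,
    (sobolev_fold hs hsK Complex.norm_I abs_comp₁_le u).2.trans hB⟩

theorem oddNormLE_field₂ (hs : 0 ≤ s) (hsK : s ≤ K) {u : Seq} (hu : u ∈ symSpace K) {B : ℝ}
    (hB : sobolevConst D s * ‖u‖ ≤ B) : D.OddNormLE s (field D K comp₂ u) B :=
  ⟨_, hasSinSeries_field₂ hu, (sobolev_fold hs hsK Complex.norm_I abs_comp₂_le u).1,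
    (sobolev_fold hs hsK Complex.norm_I abs_comp₂_le u).2.trans hB⟩

/-! ### The explicit expansion -/

variable (K)

theorem velocity₁_eq_field (A₁ A₂ x₁ x₂ t : ℝ) : D.velocity₁ A₁ A₂ x₁ x₂ t
    = field D K comp₁ (A₁ • crit₁ D K + A₂ • crit₂ D K) x₁ x₂ t := by
  rw [field_add abs_comp₁_le, field_smul abs_comp₁_le, field_smul abs_comp₁_le, crit₁, crit₂,
    field_comp₁_sbas, field_comp₁_sbas]
  simp only [wave₁_mk, wave₂_mk, amp₁, amp₂, velocity₁]
  push_cast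
  ring_nf

theorem velocity₂_eq_field (A₁ A₂ x₁ x₂ t : ℝ) : D.velocity₂ A₁ A₂ x₁ x₂ t
    = field D K comp₂ (A₁ • crit₁ D K + A₂ • crit₂ D K) x₁ x₂ t := by
  rw [field_add abs_comp₂_le, field_smul abs_comp₂_le, field_smul abs_comp₂_le, crit₁, crit₂,
    field_comp₂_sbas, field_comp₂_sbas]
  simp only [wave₁_mk, wave₂_mk, amp₁, amp₂, velocity₂]
  push_cast
  ring_nf

theorem surface_eq_field (hω : 0 < D.ω) (hβ₀ : 0 < D.β₀)
    (hΩ : D.Omega D.β₀ = {(1, 0, D.q), (-1, 0, D.q), (0, 1, D.q), (0, -1, D.q)})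
    (hk₁ : 0 < D.k₁) (hk₂ : 0 < D.k₂) (hτ₁ : 0 < D.τ₁) (hτ₂ : 0 < D.τ₂)
    {C : ℝ} (hC : 0 ≤ C) (hb : ∀ g, ‖LinearMap.toContinuousLinearMap (invSymbol D g)‖ ≤ C)
    (A₁ A₂ x₁ x₂ t : ℝ) : D.surface A₁ A₂ x₁ x₂ t = field D K comp₀
      (A₁ • crit₁ D K + A₂ • crit₂ D K
        + (D.β₀ * A₁ ^ 2) • partialInv hC hb (quad K (crit₁ D K) (crit₁ D K))
        + (D.β₀ * A₂ ^ 2) • partialInv hC hb (quad K (crit₂ D K) (crit₂ D K))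
        + (2 * D.β₀ * (A₁ * A₂)) • partialInv hC hb (quad K (crit₁ D K) (crit₂ D K))) x₁ x₂ t := by
  rw [partialInv_quad_crit₁ K hω hβ₀ hΩ hk₁ hk₂ hτ₁ hτ₂,
    partialInv_quad_crit₂ K hω hβ₀ hΩ hk₁ hk₂ hτ₁ hτ₂,
    partialInv_quad_crit₁_crit₂ K hω hβ₀ hΩ hk₁ hk₂ hτ₁ hτ₂, crit₁, crit₂]
  simp only [field_add abs_comp₀_le, field_smul abs_comp₀_le, field_comp₀_sbas]
  have e1 : √(1 + D.τ₁ ^ 2) = D.s₁ := rfl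
  have e2 : √(1 + D.τ₂ ^ 2) = D.s₂ := rfl
  simp only [wave₁_mk, wave₂_mk, amp₁, amp₂, surface, e1, e2, R₁_sq, R₂_sq, Int.cast_zero,
    zero_mul, Real.cos_zero, dot]
  push_cast
  field_simp
  rw [R₁, R₂]
  ring_nf

end StandingWave
end

noncomputable section
namespace StandingWave

/-! ### Superposition of the components -/

section
variable {V : Type*} [NormedAddCommGroup V] [NormedSpace ℝ V]

/-- Expanding `Q (U, U)` and replacing `A_j²` by `μ b_j` leaves each parity class with a common
prefactor. After its removal only `μ, b₁, b₂` and the components remain, so the reduced system is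
smooth in `μ`. -/
theorem Bifurcation.superposition (B : Bifurcation V) (hQ : ∀ u v, B.Q u v = B.Q v u)
    (μ b₁ b₂ A₁ A₂ : ℝ) (h₁ : A₁ ^ 2 = μ * b₁) (h₂ : A₂ ^ 2 = μ * b₂) (X₁ X₂ y W U : V)
    (hU : U = A₁ • X₁ + A₂ • X₂ + μ • y + (A₁ * A₂) • W) :
    μ • U + (B.β₀ + μ) • B.Q U U =
      (A₁ * μ) • B.critical μ X₁ X₂ y W b₂ + (A₂ * μ) • B.critical μ X₂ X₁ y W b₁
      + μ • (μ • y + (B.β₀ + μ) • (b₁ • B.Q X₁ X₁ + b₂ • B.Q X₂ X₂ + μ • B.Q y y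
        + (μ * b₁ * b₂) • B.Q W W))
      + (A₁ * A₂) • (μ • W + (B.β₀ + μ) • ((2 : ℝ) • B.Q X₁ X₂ + (2 * μ) • B.Q y W)) := by
  subst hU
  simp only [Bifurcation.critical, map_add, map_smul, add_apply, smul_apply, hQ X₂ X₁, hQ y X₁,
    hQ W X₁, hQ y X₂, hQ W X₂, hQ W y]
  have h₁₂ : (A₁ * A₂) ^ 2 = μ * (μ * b₁ * b₂) := by rw [mul_pow, h₁, h₂]; ring
  linear_combination (norm := module) ((B.β₀ + μ) * h₁) • B.Q X₁ X₁ + ((B.β₀ + μ) * h₂) • B.Q X₂ X₂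
    + ((B.β₀ + μ) * h₁₂) • B.Q W W + (2 * (B.β₀ + μ) * A₂ * h₁) • B.Q X₁ W
    + (2 * (B.β₀ + μ) * A₁ * h₂) • B.Q X₂ W

/-- Here `ν = √|μ|`. In the telescoped difference each `X_j` contributes two terms of size `G² ν³`,
`y` one of size `G ν⁴` and `W` three of size `G³ ν⁴`: eight in all, each at most `G³ ν³`. -/
theorem norm_sub_expansion_le {φ₁ φ₂ X₁ X₂ y y₀ W w₀ : V} {A₁ A₂ a₁ a₂ μ ν G : ℝ}
    (hν : 0 ≤ ν) (hν1 : ν ≤ 1) (hG : 1 ≤ G) (hμ : |μ| = ν ^ 2)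
    (hA₁ : |A₁| ≤ G * ν) (hA₂ : |A₂| ≤ G * ν) (ha₂ : |a₂| ≤ G * ν)
    (hd₁ : |A₁ - a₁| ≤ G * ν ^ 3) (hd₂ : |A₂ - a₂| ≤ G * ν ^ 3)
    (hX₁ : ‖X₁ - φ₁‖ ≤ G * ν ^ 2) (hX₂ : ‖X₂ - φ₂‖ ≤ G * ν ^ 2)
    (hy : ‖y - y₀‖ ≤ G * ν ^ 2) (hW : ‖W - w₀‖ ≤ G * ν ^ 2)
    (hφ₁ : ‖φ₁‖ ≤ G) (hφ₂ : ‖φ₂‖ ≤ G) (hw₀ : ‖w₀‖ ≤ G) :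
    ‖A₁ • X₁ + A₂ • X₂ + μ • y + (A₁ * A₂) • W
      - (a₁ • φ₁ + a₂ • φ₂ + μ • y₀ + (a₁ * a₂) • w₀)‖ ≤ 8 * G ^ 3 * ν ^ 3 := by
  have e : A₁ • X₁ + A₂ • X₂ + μ • y + (A₁ * A₂) • W
      - (a₁ • φ₁ + a₂ • φ₂ + μ • y₀ + (a₁ * a₂) • w₀)
      = (A₁ • (X₁ - φ₁) + (A₁ - a₁) • φ₁) + (A₂ • (X₂ - φ₂) + (A₂ - a₂) • φ₂) + μ • (y - y₀)
        + ((A₁ * A₂) • (W - w₀) + (A₁ * (A₂ - a₂) + (A₁ - a₁) * a₂) • w₀) := by module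
  have p2 : ν ^ 2 ≤ 1 := pow_le_one₀ hν hν1
  have G0 : 0 ≤ G := by linarith
  have t : ∀ {x a b : ℝ} {v : V}, |x| ≤ a → ‖v‖ ≤ b → ‖x • v‖ ≤ a * b := by
    intro x a b v hx hv
    rw [norm_smul, Real.norm_eq_abs]
    exact mul_le_mul hx hv (norm_nonneg _) ((abs_nonneg _).trans hx)
  have m : ∀ {x y a b : ℝ}, |x| ≤ a → |y| ≤ b → |x * y| ≤ a * b := by
    intro x y a b hx hy
    rw [abs_mul]
    exact mul_le_mul hx hy (abs_nonneg _) ((abs_nonneg _).trans hx)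
  have i1 := norm_add_le_of_le (t hA₁ hX₁) (t hd₁ hφ₁)
  have i2 := norm_add_le_of_le (t hA₂ hX₂) (t hd₂ hφ₂)
  have i3 := t hμ.le hy
  have i4 := norm_add_le_of_le (t (m hA₁ hA₂) hW)
    (t ((abs_add_le _ _).trans (add_le_add (m hA₁ hd₂) (m hd₁ ha₂))) hw₀)
  have i := norm_add_le_of_le (norm_add_le_of_le (norm_add_le_of_le i1 i2) i3) i4
  rw [e]
  refine i.trans ?_
  have g2 : G ^ 2 ≤ G ^ 3 := pow_le_pow_right₀ hG (by norm_num)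
  have g1 : G ≤ G ^ 3 := le_self_pow₀ hG (by norm_num)
  have n4 : ν ^ 4 ≤ ν ^ 3 := pow_le_pow_of_le_one hν hν1 (by norm_num)
  have n3 : 0 ≤ ν ^ 3 := by positivity
  have n4' : 0 ≤ ν ^ 4 := by positivity
  have g3 : 0 ≤ G ^ 3 := by positivity
  have k1 : G ^ 2 * ν ^ 3 ≤ G ^ 3 * ν ^ 3 := mul_le_mul_of_nonneg_right g2 n3
  have k2 : G * ν ^ 4 ≤ G ^ 3 * ν ^ 3 := mul_le_mul g1 n4 n4' g3
  have k3 : G ^ 3 * ν ^ 4 ≤ G ^ 3 * ν ^ 3 := mul_le_mul_of_nonneg_left n4 g3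
  nlinarith

theorem norm_sub_leading_le {φ y W : V} {a₁ a₂ μ ν G : ℝ} {U : V} {M : ℝ}
    (hν1 : ν ≤ 1) (hν : 0 ≤ ν) (hG : 1 ≤ G) (hμ : |μ| = ν ^ 2)
    (ha₁ : |a₁| ≤ G * ν) (ha₂ : |a₂| ≤ G * ν) (hM : 0 ≤ M)
    (h : ‖U - (φ + μ • y + (a₁ * a₂) • W)‖ ≤ M * ν ^ 3) (hy : ‖y‖ ≤ G) (hW : ‖W‖ ≤ G) :
    ‖U - φ‖ ≤ (M + 2 * G ^ 3) * ν ^ 2 := by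
  have e : U - φ = (U - (φ + μ • y + (a₁ * a₂) • W)) + μ • y + (a₁ * a₂) • W := by abel
  have i1 : ‖μ • y‖ ≤ ν ^ 2 * G := by
    rw [norm_smul, Real.norm_eq_abs, hμ]; gcongr
  have i2 : ‖(a₁ * a₂) • W‖ ≤ (G * ν * (G * ν)) * G := by
    rw [norm_smul, Real.norm_eq_abs, abs_mul]; gcongr
  have i := norm_add_le_of_le (norm_add_le_of_le h i1) i2
  rw [e]
  refine i.trans ?_
  have g1 : G ≤ G ^ 3 := le_self_pow₀ hG (by norm_num)
  have n3 : ν ^ 3 ≤ ν ^ 2 := pow_le_pow_of_le_one hν hν1 (by norm_num)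
  have k1 : M * ν ^ 3 ≤ M * ν ^ 2 := mul_le_mul_of_nonneg_left n3 hM
  have k2 : G * ν ^ 2 ≤ G ^ 3 * ν ^ 2 := mul_le_mul_of_nonneg_right g1 (sq_nonneg _)
  nlinarith

end

/-! ### Amplitudes -/

/-- Comparison of the amplitude with its leading order. -/
theorem amplitude_bounds {b c μ C G : ℝ} (hC : 0 ≤ C) (hbc : |b - c| ≤ C * |μ|)
    (h0 : c = 0 → b = 0) (hμ : c ≠ 0 → C * |μ| < |c|) (hμ1 : |μ| ≤ 1) (hc : 0 ≤ μ * c)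
    (hG₁ : C / √|c| ≤ G) (hG₂ : √(|c| + C) ≤ G) :
    0 ≤ μ * b ∧ |√(μ * b)| ≤ G * √|μ| ∧ |√(μ * c)| ≤ G * √|μ| ∧
      |√(μ * b) - √(μ * c)| ≤ G * √|μ| ^ 3 := by
  have hν := Real.sqrt_nonneg |μ|
  have hν2 := Real.sq_sqrt (abs_nonneg μ)
  have hcG : √|c| ≤ G := (Real.sqrt_le_sqrt (by linarith)).trans hG₂
  have hbG : √|b| ≤ G := by
    refine (Real.sqrt_le_sqrt ?_).trans hG₂
    have := abs_sub_abs_le_abs_sub b c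
    nlinarith [abs_nonneg μ]
  have hG0 : 0 ≤ G := (Real.sqrt_nonneg _).trans hG₂
  -- For `c ≠ 0` the bound `|b - c| < |c|` gives `b` the sign of `c`, so `μ * b` inherits the sign
  -- of `μ * c`.
  have hb : 0 ≤ μ * b := by
    by_cases hc0 : c = 0
    · simp [h0 hc0]
    · have h1 := hμ hc0
      rcases lt_or_gt_of_ne hc0 with hneg | hpos
      · have h2 : μ ≤ 0 := by
          by_contra h; exact absurd hc (not_le.2 (mul_neg_of_pos_of_neg (not_le.1 h) hneg))
        rw [abs_of_neg hneg] at h1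
        have := (abs_le.1 hbc).2
        exact mul_nonneg_of_nonpos_of_nonpos h2 (by linarith)
      · have h2 : 0 ≤ μ := by
          by_contra h; exact absurd hc (not_le.2 (mul_neg_of_neg_of_pos (not_le.1 h) hpos))
        rw [abs_of_pos hpos] at h1
        have := (abs_le.1 hbc).1
        exact mul_nonneg h2 (by linarith)
  have sb : √(μ * b) = √|μ| * √|b| := by
    rw [← Real.sqrt_mul (abs_nonneg _), ← abs_mul, abs_of_nonneg hb]
  have sc : √(μ * c) = √|μ| * √|c| := by
    rw [← Real.sqrt_mul (abs_nonneg _), ← abs_mul, abs_of_nonneg hc]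
  refine ⟨hb, ?_, ?_, ?_⟩
  · rw [abs_of_nonneg (Real.sqrt_nonneg _), sb, mul_comm]; gcongr
  · rw [abs_of_nonneg (Real.sqrt_nonneg _), sc, mul_comm]; gcongr
  · by_cases hc0 : c = 0
    · rw [h0 hc0, hc0]; simp; positivity
    have hcp : 0 < √|c| := Real.sqrt_pos.2 (abs_pos.2 hc0)
    have hbn := Real.sqrt_nonneg |b|
    have e1 := Real.mul_self_sqrt (abs_nonneg b)
    have e2 := Real.mul_self_sqrt (abs_nonneg c)
    have hbc' := (abs_abs_sub_abs_le b c).trans hbc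
    rw [sb, sc, ← mul_sub, abs_mul, abs_of_nonneg hν]
    generalize √|b| = x at *
    generalize √|c| = y at *
    generalize √|μ| = ν at *
    -- With `x = √|b|` and `y = √|c|`, `|x - y| y ≤ |x² - y²| ≤ |b - c|`; dividing by `y > 0` avoids
    -- the singularity of the root at zero.
    have key : |x - y| * y ≤ C * ν ^ 2 := by
      rw [hν2]
      refine le_trans ?_ hbc'
      rw [← e1, ← e2, show x * x - y * y = (x - y) * (x + y) by ring, abs_mul,
        abs_of_nonneg (a := x + y) (by positivity)]
      exact mul_le_mul_of_nonneg_left (by linarith) (abs_nonneg _)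
    calc ν * |x - y| ≤ ν * (C * ν ^ 2 / y) :=
          mul_le_mul_of_nonneg_left ((le_div_iff₀ hcp).2 key) hν
      _ = C / y * ν ^ 3 := by ring
      _ ≤ G * ν ^ 3 := by gcongr

end StandingWave
end

noncomputable section
namespace StandingWave

open StandingWaveData

variable {D : StandingWaveData} (K : ℕ)

/-! ### The bifurcation problem for the Boussinesq system -/

/-- The symmetric sequences of given parities. -/
def gradedSpace (i j : ZMod 2) : Submodule ℝ Seq := symSpace K ⊓ parSpace K i j

theorem isClosed_gradedSpace (i j : ZMod 2) : IsClosed (gradedSpace K i j : Set Seq) :=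
  (isClosed_symSpace K).inter (isClosed_parSpace K i j)

theorem quad_mem_gradedSpace {i j i' j' k l : ZMod 2} {u v : Seq} (hu : u ∈ gradedSpace K i j)
    (hv : v ∈ gradedSpace K i' j') (hk : i + i' = k) (hl : j + j' = l) :
    quad K u v ∈ gradedSpace K k l := by
  subst hk hl
  exact ⟨quad_mem_symSpace hu.1 hv.1, quad_mem_parSpace hu.2 hv.2⟩

theorem Balanced.of_eq {u u' f f' : Seq} (h : Balanced D K u f) (hu : u = u') (hf : f = f') :
    Balanced D K u' f' := hu ▸ hf ▸ h

theorem balanced_zero : Balanced D K 0 0 := by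
  intro g
  simp [coef_zero]

theorem ampSq₁_eq (μ : ℝ) : D.ampSq₁ μ = μ * D.ampSq₁ 1 := by
  rw [ampSq₁, ampSq₁]; ring

theorem ampSq₂_eq (μ : ℝ) : D.ampSq₂ μ = μ * D.ampSq₂ 1 := by
  rw [ampSq₂, ampSq₂]; ring

section
variable (hβ₀ : D.β₀ ≠ 0) (hB : D.l₁ * D.l₃ - D.l₂ ^ 2 ≠ 0)
include hβ₀ hB

/-- `ampSq₁ 1` and `ampSq₂ 1` are Cramer's formulas for the symmetric system with matrix `(l₁, l₂;
l₂, l₃)`. -/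
theorem amplitude_equation₁ :
    D.β₀ * (D.l₁ * D.ampSq₁ 1 + D.l₂ * D.ampSq₂ 1) = 2 * R₁ D ^ 2 := by
  rw [ampSq₁, ampSq₂, R₁_sq]
  generalize hd : D.l₁ * D.l₃ - D.l₂ ^ 2 = d at *
  field_simp
  rw [← hd]
  ring

theorem amplitude_equation₂ :
    D.β₀ * (D.l₂ * D.ampSq₁ 1 + D.l₃ * D.ampSq₂ 1) = 2 * R₂ D ^ 2 := by
  rw [ampSq₁, ampSq₂, R₂_sq]
  generalize hd : D.l₁ * D.l₃ - D.l₂ ^ 2 = d at *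
  field_simp
  rw [← hd]
  ring

/-- If the first amplitude vanishes, the second equation reads `β₀ l₃ ampSq₂ 1 = 2 R₂²` with
positive right-hand side. This keeps the reduced problem, with the first equation replaced,
non-degenerate. -/
theorem l₃_ne_zero (hk₂ : 0 < D.k₂) (h : D.ampSq₁ 1 = 0) : D.l₃ ≠ 0 := by
  intro h3
  have hR := (R₂_pos hk₂).ne'
  have h2 := amplitude_equation₂ hβ₀ hB
  have h1 := amplitude_equation₁ hβ₀ hB
  rw [h, h3] at h2
  have : R₂ D ^ 2 = 0 := by linarith
  exact hR (pow_eq_zero_iff two_ne_zero |>.1 this)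

theorem l₁_ne_zero (hk₁ : 0 < D.k₁) (h : D.ampSq₂ 1 = 0) : D.l₁ ≠ 0 := by
  intro h3
  have hR := (R₁_pos hk₁).ne'
  have h1 := amplitude_equation₁ hβ₀ hB
  rw [h, h3] at h1
  have : R₁ D ^ 2 = 0 := by linarith
  exact hR (pow_eq_zero_iff two_ne_zero |>.1 this)

end

variable {C : ℝ} (hC : 0 ≤ C)
  (hb : ∀ g, ‖LinearMap.toContinuousLinearMap (invSymbol D g)‖ ≤ C)

/-- The bifurcation problem; the equation for the amplitude of a critical mode is
replaced by the vanishing of this amplitude where `e = 1`. -/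
def bifurcation (e₁ e₂ : ℝ) : Bifurcation Seq where
  T := partialInv hC hb
  Q := quad K
  κ₁ := (1 - e₁) • kernelFun K D (R₁ D) (1, 0, D.q)
  κ₂ := (1 - e₂) • kernelFun K D (R₂ D) (0, 1, D.q)
  φ₁ := crit₁ D K
  φ₂ := crit₂ D K
  β₀ := D.β₀
  e₁ := e₁
  e₂ := e₂

theorem graded_bifurcation (e₁ e₂ : ℝ) :
    Bifurcation.Graded (bifurcation K hC hb e₁ e₂) (gradedSpace K) where
  T_mem h := ⟨partialInv_mem_symSpace hC hb h.1, partialInv_mem_parSpace hC hb h.2⟩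
  Q_mem h h' := quad_mem_gradedSpace K h h' rfl rfl
  φ₁_mem := ⟨crit₁_mem_symSpace K, crit₁_mem_parSpace K⟩
  φ₂_mem := ⟨crit₂_mem_symSpace K, crit₂_mem_parSpace K⟩

variable (hω : 0 < D.ω) (hβ₀ : 0 < D.β₀)
  (hΩ : D.Omega D.β₀ = {(1, 0, D.q), (-1, 0, D.q), (0, 1, D.q), (0, -1, D.q)})
  (hk₁ : 0 < D.k₁) (hk₂ : 0 < D.k₂) (hτ₁ : 0 < D.τ₁) (hτ₂ : 0 < D.τ₂)
include hω hβ₀ hΩ hk₁ hk₂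

/-- A mode of parities `(1, 0)` or `(0, 1)`, with its amplitude. -/
theorem balanced_critical {i j : ZMod 2} {A b e μ R : ℝ} {g : Mode} {φ X r : Seq}
    (hφ : Balanced D K φ 0) (hr : r ∈ gradedSpace K i j)
    (hg : (i, j, g, R) = (1, 0, (1, 0, D.q), R₁ D) ∨ (i, j, g, R) = (0, 1, (0, 1, D.q), R₂ D))
    (hX : X = φ + μ • partialInv hC hb r)
    (hA : A ^ 2 = μ * b) (he : e = 0 ∨ e = 1)
    (hκ : (1 - e) * kernelFun K D R g r + e * b = 0) :
    Balanced D K (A • X) ((A * μ) • r) := by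
  -- With zero amplitude both sides vanish and no solvability condition is needed. This covers `e =
  -- 1`, where `b = 0` forces `A = 0`.
  by_cases hA0 : A = 0
  · rw [hA0, zero_mul, zero_smul, zero_smul]; exact balanced_zero K
  have hκ0 : kernelFun K D R g r = 0 := by
    rcases he with rfl | rfl
    · simpa using hκ
    · have hb0 : b = 0 := by simpa using hκ
      rw [hb0, mul_zero] at hA
      exact absurd (pow_eq_zero_iff two_ne_zero |>.1 hA) hA0
  have hbal : Balanced D K (partialInv hC hb r) r := by
    refine balanced_of_kernelFun hC hb hω hβ₀ hk₁ hk₂ hΩ hr.1 ?_ ?_ <;>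
    rcases hg with hg | hg <;> simp only [Prod.mk.injEq] at hg <;>
    obtain ⟨rfl, rfl, rfl, rfl⟩ := hg
    · exact hκ0
    · exact kernelFun_eq_zero hr.2 (by simp) _
    · exact kernelFun_eq_zero hr.2 (by simp) _
    · exact hκ0
  refine ((hφ.add (hbal.smul μ)).smul A).of_eq K (by rw [hX]) ?_
  rw [zero_add, smul_smul]

/-- The critical modes have indices of opposite parities, so data whose indices have equal parities
meet both solvability conditions automatically. -/
theorem balanced_graded {i : ZMod 2} {f : Seq} (hf : f ∈ gradedSpace K i i) :
    Balanced D K (partialInv hC hb f) f := by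
  have h01 : (0 : ZMod 2) ≠ 1 := by decide
  refine balanced_of_kernelFun hC hb hω hβ₀ hk₁ hk₂ hΩ hf.1 (kernelFun_eq_zero hf.2 ?_ _)
    (kernelFun_eq_zero hf.2 ?_ _)
  · rintro ⟨h1, h2⟩
    exact h01 (by simpa using h2.trans h1.symm)
  · rintro ⟨h1, h2⟩
    exact h01 (by simpa using h1.trans h2.symm)


variable (hB : D.l₁ * D.l₃ - D.l₂ ^ 2 ≠ 0)
include hτ₁ hτ₂ hB

/-- With both equations kept, the matrix is `β₀/2` times `(l₁, l₂; l₂, l₃)`. Replacing one leaves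
`β₀ l₁ / 2` or `β₀ l₃ / 2` as determinant, nonzero by the previous lemmas. The right-hand sides come
from `κ_j φ_j = -R_j²` when `e_j = 0`. -/
theorem bifurcation_nondegenerate {e₁ e₂ : ℝ} (h₁ : e₁ = 0 ∨ e₁ = 1 ∧ D.ampSq₁ 1 = 0)
    (h₂ : e₂ = 0 ∨ e₂ = 1 ∧ D.ampSq₂ 1 = 0) :
    (bifurcation K hC hb e₁ e₂).det ≠ 0 ∧
    (bifurcation K hC hb e₁ e₂).m₁₁ * D.ampSq₁ 1 + (bifurcation K hC hb e₁ e₂).m₁₂ * D.ampSq₂ 1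
      = -(bifurcation K hC hb e₁ e₂).κ₁ (bifurcation K hC hb e₁ e₂).φ₁ ∧
    (bifurcation K hC hb e₁ e₂).m₂₁ * D.ampSq₁ 1 + (bifurcation K hC hb e₁ e₂).m₂₂ * D.ampSq₂ 1
      = -(bifurcation K hC hb e₁ e₂).κ₂ (bifurcation K hC hb e₁ e₂).φ₂ := by
  have hq := q_pos hΩ
  have E₁ := amplitude_equation₁ hβ₀.ne' hB
  have E₂ := amplitude_equation₂ hβ₀.ne' hB
  have m₁₁ : (bifurcation K hC hb e₁ e₂).m₁₁ = (1 - e₁) * (D.β₀ / 2 * D.l₁) + e₁ := by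
    simp only [Bifurcation.m₁₁, bifurcation, smul_apply, smul_eq_mul,
      kernelFun_crit₁_crit₁ K hω hβ₀ hΩ hk₁ hk₂ hτ₁ hτ₂ hC hb]
    field_simp; ring
  have m₁₂ : (bifurcation K hC hb e₁ e₂).m₁₂ = (1 - e₁) * (D.β₀ / 2 * D.l₂) := by
    simp only [Bifurcation.m₁₂, bifurcation, smul_apply, smul_eq_mul,
      kernelFun_crit₁_crit₂ K hω hβ₀ hΩ hk₁ hk₂ hτ₁ hτ₂ hC hb,
      kernelFun_mixed₁ K hω hβ₀ hΩ hk₁ hk₂ hτ₁ hτ₂ hC hb]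
    field_simp; ring
  have m₂₁ : (bifurcation K hC hb e₁ e₂).m₂₁ = (1 - e₂) * (D.β₀ / 2 * D.l₂) := by
    simp only [Bifurcation.m₂₁, bifurcation, smul_apply, smul_eq_mul,
      kernelFun_crit₂_crit₁ K hω hβ₀ hΩ hk₁ hk₂ hτ₁ hτ₂ hC hb,
      kernelFun_mixed₂ K hω hβ₀ hΩ hk₁ hk₂ hτ₁ hτ₂ hC hb]
    field_simp; ring
  have m₂₂ : (bifurcation K hC hb e₁ e₂).m₂₂ = (1 - e₂) * (D.β₀ / 2 * D.l₃) + e₂ := by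
    simp only [Bifurcation.m₂₂, bifurcation, smul_apply, smul_eq_mul,
      kernelFun_crit₂_crit₂ K hω hβ₀ hΩ hk₁ hk₂ hτ₁ hτ₂ hC hb]
    field_simp; ring
  have k₁ : (bifurcation K hC hb e₁ e₂).κ₁ (bifurcation K hC hb e₁ e₂).φ₁
      = (1 - e₁) * -R₁ D ^ 2 := by
    simp only [bifurcation, smul_apply, smul_eq_mul, kernelFun_crit₁ K hq]
  have k₂ : (bifurcation K hC hb e₁ e₂).κ₂ (bifurcation K hC hb e₁ e₂).φ₂
      = (1 - e₂) * -R₂ D ^ 2 := by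
    simp only [bifurcation, smul_apply, smul_eq_mul, kernelFun_crit₂ K hq]
  have hc₁ : e₁ * D.ampSq₁ 1 = 0 := by rcases h₁ with h | h <;> simp [h]
  have hc₂ : e₂ * D.ampSq₂ 1 = 0 := by rcases h₂ with h | h <;> simp [h]
  rw [Bifurcation.det, m₁₁, m₁₂, m₂₁, m₂₂, k₁, k₂]
  refine ⟨?_, by linear_combination (1 - e₁) / 2 * E₁ + hc₁,
    by linear_combination (1 - e₂) / 2 * E₂ + hc₂⟩
  rcases h₁ with rfl | ⟨rfl, h₁⟩ <;> rcases h₂ with rfl | ⟨rfl, h₂⟩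
  · have : D.β₀ ^ 2 / 4 * (D.l₁ * D.l₃ - D.l₂ ^ 2) ≠ 0 := mul_ne_zero (by positivity) hB
    intro h; apply this; linear_combination h
  · have : D.β₀ / 2 * D.l₁ ≠ 0 := mul_ne_zero (by positivity) (l₁_ne_zero hβ₀.ne' hB hk₁ h₂)
    intro h; apply this; linear_combination h
  · have : D.β₀ / 2 * D.l₃ ≠ 0 := mul_ne_zero (by positivity) (l₃_ne_zero hβ₀.ne' hB hk₂ h₁)
    intro h; apply this; linear_combination h
  · norm_num

end StandingWave
end

/-! ### Existence of the solution and its second-order expansion in Fourier coefficients. -/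

noncomputable section
namespace StandingWave

open StandingWaveData

variable {D : StandingWaveData} (K : ℕ)
  (hω : 0 < D.ω) (hβ₀ : 0 < D.β₀)
  (hΩ : D.Omega D.β₀ = {(1, 0, D.q), (-1, 0, D.q), (0, 1, D.q), (0, -1, D.q)})
  (hk₁ : 0 < D.k₁) (hk₂ : 0 < D.k₂) (hτ₁ : 0 < D.τ₁) (hτ₂ : 0 < D.τ₂)
  (hB : D.l₁ * D.l₃ - D.l₂ ^ 2 ≠ 0)
  {C₀ : ℝ} (hC₀ : 0 ≤ C₀)
  (hb : ∀ g, ‖LinearMap.toContinuousLinearMap (invSymbol D g)‖ ≤ C₀)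
include hω hβ₀ hΩ hk₁ hk₂ hτ₁ hτ₂ hB

-- Each parity class satisfies its own linear problem: the critical ones through the bifurcation
-- equations, the other two unconditionally. Linearity and `superposition` reassemble the full
-- equation.
omit hτ₁ hτ₂ hB in
theorem balanced_superposition {e₁ e₂ μ A₁ A₂ b₁ b₂ : ℝ} {X₁ X₂ y W U : Seq}
    (he₁ : e₁ = 0 ∨ e₁ = 1) (he₂ : e₂ = 0 ∨ e₂ = 1)
    (hW : W ∈ gradedSpace K 1 1) (hy : y ∈ gradedSpace K 0 0) (hX₁ : X₁ ∈ gradedSpace K 1 0)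
    (hX₂ : X₂ ∈ gradedSpace K 0 1)
    (eW : W = (bifurcation K hC₀ hb e₁ e₂).mixed μ X₁ X₂ y W)
    (ey : y = (bifurcation K hC₀ hb e₁ e₂).even μ X₁ X₂ y W b₁ b₂)
    (eX₁ : X₁ = (bifurcation K hC₀ hb e₁ e₂).φ₁ + μ • (bifurcation K hC₀ hb e₁ e₂).T
      ((bifurcation K hC₀ hb e₁ e₂).critical μ X₁ X₂ y W b₂))
    (eX₂ : X₂ = (bifurcation K hC₀ hb e₁ e₂).φ₂ + μ • (bifurcation K hC₀ hb e₁ e₂).T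
      ((bifurcation K hC₀ hb e₁ e₂).critical μ X₂ X₁ y W b₁))
    (eκ₁ : (bifurcation K hC₀ hb e₁ e₂).κ₁
      ((bifurcation K hC₀ hb e₁ e₂).critical μ X₁ X₂ y W b₂)
      + (bifurcation K hC₀ hb e₁ e₂).e₁ * b₁ = 0)
    (eκ₂ : (bifurcation K hC₀ hb e₁ e₂).κ₂
      ((bifurcation K hC₀ hb e₁ e₂).critical μ X₂ X₁ y W b₁)
      + (bifurcation K hC₀ hb e₁ e₂).e₂ * b₂ = 0)
    (sA₁ : A₁ ^ 2 = μ * b₁) (sA₂ : A₂ ^ 2 = μ * b₂)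
    (hU : U = A₁ • X₁ + A₂ • X₂ + μ • y + (A₁ * A₂) • W) :
    Balanced D K U (μ • U + (D.β₀ + μ) • quad K U U) := by
  have hgr := graded_bifurcation K hC₀ hb e₁ e₂
  have hsup := (bifurcation K hC₀ hb e₁ e₂).superposition (quad_comm K) μ b₁ b₂ A₁ A₂ sA₁ sA₂
    X₁ X₂ y W U hU
  have r₁ := hgr.critical₁_mem hX₁ hX₂ hy hW μ b₂
  have r₂ := hgr.critical₂_mem hX₁ hX₂ hy hW μ b₁
  generalize (bifurcation K hC₀ hb e₁ e₂).critical μ X₁ X₂ y W b₂ = f₁ at *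
  generalize (bifurcation K hC₀ hb e₁ e₂).critical μ X₂ X₁ y W b₁ = f₂ at *
  have q₁ := balanced_critical K hC₀ hb hω hβ₀ hΩ hk₁ hk₂ (balanced_crit₁ K hΩ hk₁) r₁
    (Or.inl rfl) eX₁ sA₁ he₁ (b := b₁) (R := R₁ D) (g := (1, 0, D.q)) eκ₁
  have q₂ := balanced_critical K hC₀ hb hω hβ₀ hΩ hk₁ hk₂ (balanced_crit₂ K hΩ hk₂) r₂
    (Or.inr rfl) eX₂ sA₂ he₂ (b := b₂) (R := R₂ D) (g := (0, 1, D.q)) eκ₂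
  have r₃ : (μ • y + (D.β₀ + μ) • (b₁ • quad K X₁ X₁ + b₂ • quad K X₂ X₂
      + μ • quad K y y + (μ * b₁ * b₂) • quad K W W)) ∈ gradedSpace K 0 0 :=
    add_mem (Submodule.smul_mem _ _ hy) (Submodule.smul_mem _ _ (add_mem (add_mem (add_mem
      (Submodule.smul_mem _ _ (quad_mem_gradedSpace K hX₁ hX₁ (by decide) (by decide)))
      (Submodule.smul_mem _ _ (quad_mem_gradedSpace K hX₂ hX₂ (by decide) (by decide))))
      (Submodule.smul_mem _ _ (quad_mem_gradedSpace K hy hy (by decide) (by decide))))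
      (Submodule.smul_mem _ _ (quad_mem_gradedSpace K hW hW (by decide) (by decide)))))
  have r₄ : (μ • W + (D.β₀ + μ) • ((2 : ℝ) • quad K X₁ X₂ + (2 * μ) • quad K y W))
      ∈ gradedSpace K 1 1 :=
    add_mem (Submodule.smul_mem _ _ hW) (Submodule.smul_mem _ _ (add_mem
      (Submodule.smul_mem _ _ (quad_mem_gradedSpace K hX₁ hX₂ (by decide) (by decide)))
      (Submodule.smul_mem _ _ (quad_mem_gradedSpace K hy hW (by decide) (by decide)))))
  have q₃ := (balanced_graded K hC₀ hb hω hβ₀ hΩ hk₁ hk₂ r₃).of_eq K ey.symm rfl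
  have q₄ := (balanced_graded K hC₀ hb hω hβ₀ hΩ hk₁ hk₂ r₄).of_eq K eW.symm rfl
  exact (((q₁.add q₂).add (q₃.smul μ)).add (q₄.smul (A₁ * A₂))).of_eq K hU.symm hsup.symm

/-- Standing waves in terms of Fourier coefficients, with the second order expansion. -/
theorem exists_expansion : ∃ μ₀ : ℝ, 0 < μ₀ ∧ ∃ M : ℝ, 0 < M ∧ ∀ μ : ℝ, |μ| < μ₀ →
    0 ≤ D.ampSq₁ μ → 0 ≤ D.ampSq₂ μ → ∃ U ∈ symSpace K, (coef K U (0, 0, 0)).1 = 0 ∧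
      Balanced D K U (μ • U + (D.β₀ + μ) • quad K U U) ∧
      ‖U - (√(D.ampSq₁ μ) • crit₁ D K + √(D.ampSq₂ μ) • crit₂ D K
        + (D.β₀ * √(D.ampSq₁ μ) ^ 2) • partialInv hC₀ hb (quad K (crit₁ D K) (crit₁ D K))
        + (D.β₀ * √(D.ampSq₂ μ) ^ 2) • partialInv hC₀ hb (quad K (crit₂ D K) (crit₂ D K))
        + (2 * D.β₀ * (√(D.ampSq₁ μ) * √(D.ampSq₂ μ))) •
          partialInv hC₀ hb (quad K (crit₁ D K) (crit₂ D K)))‖ ≤ M * √|μ| ^ 3 ∧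
      ‖U - (√(D.ampSq₁ μ) • crit₁ D K + √(D.ampSq₂ μ) • crit₂ D K)‖ ≤ M * √|μ| ^ 2 := by
  -- The switch is on exactly when the limiting squared amplitude is zero; otherwise `b₁` would only
  -- be known to be `O(μ)` and `μ b₁` could be negative.
  obtain ⟨e₁, he₁, he₁'⟩ : ∃ e : ℝ, (e = 0 ∨ e = 1 ∧ D.ampSq₁ 1 = 0) ∧
      (D.ampSq₁ 1 = 0 → e = 1) := by
    by_cases h : D.ampSq₁ 1 = 0
    · exact ⟨1, Or.inr ⟨rfl, h⟩, fun _ => rfl⟩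
    · exact ⟨0, Or.inl rfl, fun h' => absurd h' h⟩
  obtain ⟨e₂, he₂, he₂'⟩ : ∃ e : ℝ, (e = 0 ∨ e = 1 ∧ D.ampSq₂ 1 = 0) ∧
      (D.ampSq₂ 1 = 0 → e = 1) := by
    by_cases h : D.ampSq₂ 1 = 0
    · exact ⟨1, Or.inr ⟨rfl, h⟩, fun _ => rfl⟩
    · exact ⟨0, Or.inl rfl, fun h' => absurd h' h⟩
  obtain ⟨hdet, hm₁, hm₂⟩ := bifurcation_nondegenerate K hC₀ hb hω hβ₀ hΩ hk₁ hk₂ hτ₁ hτ₂ hB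
    he₁ he₂
  obtain ⟨δ, hδ, C, hC, hsol⟩ := Bifurcation.exists_solution hdet hm₁ hm₂
    (graded_bifurcation K hC₀ hb e₁ e₂) (isClosed_gradedSpace K)
  set c₁ := D.ampSq₁ 1 with hc₁
  set c₂ := D.ampSq₂ 1 with hc₂
  set B := bifurcation K hC₀ hb e₁ e₂ with hBdef
  set y₀ : Seq := B.T (B.β₀ • (c₁ • B.Q B.φ₁ B.φ₁ + c₂ • B.Q B.φ₂ B.φ₂)) with hy₀
  set w₀ : Seq := B.T (B.β₀ • ((2 : ℝ) • B.Q B.φ₁ B.φ₂)) with hw₀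
  obtain ⟨G, hG⟩ := Finset.exists_le (α := ℝ) (Finset.univ.image
    ![1, C, C / √|c₁|, √(|c₁| + C), C / √|c₂|, √(|c₂| + C), ‖crit₁ D K‖, ‖crit₂ D K‖, ‖y₀‖, ‖w₀‖])
  have hGi : ∀ i, (![1, C, C / √|c₁|, √(|c₁| + C), C / √|c₂|, √(|c₂| + C), ‖crit₁ D K‖,
      ‖crit₂ D K‖, ‖y₀‖, ‖w₀‖] : Fin 10 → ℝ) i ≤ G := fun i =>
    hG _ (Finset.mem_image_of_mem _ (Finset.mem_univ i))
  have hG1 : 1 ≤ G := hGi 0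
  have hGC : C ≤ G := hGi 1
  -- For `|μ| < r₁` the deviation `C * |μ|` stays below `|c₁|`, as `amplitude_bounds` requires.
  obtain ⟨r₁, hr₁, hr₁'⟩ : ∃ r : ℝ, 0 < r ∧ (c₁ ≠ 0 → C * r ≤ |c₁|) := by
    by_cases h : c₁ = 0
    · exact ⟨1, one_pos, fun h' => absurd h h'⟩
    · exact ⟨|c₁| / C, div_pos (abs_pos.2 h) hC, fun _ => (mul_div_cancel₀ _ hC.ne').le⟩
  obtain ⟨r₂, hr₂, hr₂'⟩ : ∃ r : ℝ, 0 < r ∧ (c₂ ≠ 0 → C * r ≤ |c₂|) := by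
    by_cases h : c₂ = 0
    · exact ⟨1, one_pos, fun h' => absurd h h'⟩
    · exact ⟨|c₂| / C, div_pos (abs_pos.2 h) hC, fun _ => (mul_div_cancel₀ _ hC.ne').le⟩
  refine ⟨min (min δ 1) (min r₁ r₂), by positivity, 8 * G ^ 3 + 2 * G ^ 3, by positivity,
    fun μ hμ ha₁ ha₂ => ?_⟩
  obtain ⟨⟨hμδ, hμ1⟩, hμr₁, hμr₂⟩ : (|μ| < δ ∧ |μ| < 1) ∧ |μ| < r₁ ∧ |μ| < r₂ := by
    simpa only [lt_min_iff] using hμ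
  obtain ⟨W, hW, y, hy, X₁, hX₁, X₂, hX₂, b₁, b₂, eW, ey, eX₁, eX₂, eκ₁, eκ₂, nW, ny, nX₁, nX₂,
    nb₁, nb₂⟩ := hsol μ hμδ
  rw [ampSq₁_eq, ← hc₁] at ha₁ ⊢
  rw [ampSq₂_eq, ← hc₂] at ha₂ ⊢
  have hb₁0 : c₁ = 0 → b₁ = 0 := fun h => by
    have h1 := he₁' h
    simpa [hBdef, bifurcation, h1] using eκ₁
  have hb₂0 : c₂ = 0 → b₂ = 0 := fun h => by
    have h1 := he₂' h
    simpa [hBdef, bifurcation, h1] using eκ₂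
  obtain ⟨p₁, A₁le, a₁le, d₁le⟩ := amplitude_bounds hC.le nb₁ hb₁0
    (fun h => (mul_lt_mul_of_pos_left hμr₁ hC).trans_le (hr₁' h)) hμ1.le ha₁ (hGi 2) (hGi 3)
  obtain ⟨p₂, A₂le, a₂le, d₂le⟩ := amplitude_bounds hC.le nb₂ hb₂0
    (fun h => (mul_lt_mul_of_pos_left hμr₂ hC).trans_le (hr₂' h)) hμ1.le ha₂ (hGi 4) (hGi 5)
  have sA₁ := Real.sq_sqrt p₁
  have sA₂ := Real.sq_sqrt p₂
  have sa₁ := Real.sq_sqrt ha₁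
  have sa₂ := Real.sq_sqrt ha₂
  generalize √(μ * b₁) = A₁ at *
  generalize √(μ * b₂) = A₂ at *
  generalize √(μ * c₁) = a₁ at *
  generalize √(μ * c₂) = a₂ at *
  have hν2 := Real.sq_sqrt (abs_nonneg μ)
  have hν0 := Real.sqrt_nonneg |μ|
  have hν1 : √|μ| ≤ 1 := Real.sqrt_le_one.2 hμ1.le
  have toG : ∀ {x : ℝ}, x ≤ C * |μ| → x ≤ G * √|μ| ^ 2 := fun h => by
    rw [hν2]; exact h.trans (mul_le_mul_of_nonneg_right hGC (abs_nonneg _))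
  have main := norm_sub_expansion_le hν0 hν1 hG1 hν2.symm A₁le A₂le a₂le d₁le d₂le (toG nX₁)
    (toG nX₂) (toG ny) (toG nW) (hGi 6) (hGi 7) (hGi 9)
  have second := norm_sub_leading_le hν1 hν0 hG1 hν2.symm a₁le a₂le (by positivity) main (hGi 8)
    (hGi 9)
  refine ⟨A₁ • X₁ + A₂ • X₂ + μ • y + (A₁ * A₂) • W, ?_, ?_, ?_, ?_, second⟩
  · exact add_mem (add_mem (add_mem (Submodule.smul_mem _ _ hX₁.1) (Submodule.smul_mem _ _ hX₂.1))
      (Submodule.smul_mem _ _ hy.1)) (Submodule.smul_mem _ _ hW.1)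
  -- Parity excludes the constant mode from `X₁, X₂, W`; for `y` it is excluded because the partial
  -- inverse annihilates `p = 0`.
  · have z₁ : coef K X₁ (0, 0, 0) = 0 := hX₁.2 _ (by decide)
    have z₂ : coef K X₂ (0, 0, 0) = 0 := hX₂.2 _ (by decide)
    have z₃ : coef K W (0, 0, 0) = 0 := hW.2 _ (by decide)
    have z₄ : coef K y (0, 0, 0) = 0 := by
      rw [ey]
      exact (coef_partialInv hC₀ hb _ _).trans (invSymbol_wave_zero _ _)
    simp only [coef_add, coef_smul, z₁, z₂, z₃, z₄, smul_zero, add_zero, Prod.fst_zero]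
  · exact balanced_superposition K hω hβ₀ hΩ hk₁ hk₂ hC₀ hb (he₁.imp_right And.left)
      (he₂.imp_right And.left) hW hy hX₁ hX₂ eW ey eX₁ eX₂ eκ₁ eκ₂ sA₁ sA₂ rfl
  -- Since `a_j² = μ c_j`, the term `μ y₀` is quadratic in the amplitudes.
  · have e : a₁ • crit₁ D K + a₂ • crit₂ D K + μ • y₀ + (a₁ * a₂) • w₀
        = a₁ • crit₁ D K + a₂ • crit₂ D K
        + (D.β₀ * a₁ ^ 2) • partialInv hC₀ hb (quad K (crit₁ D K) (crit₁ D K))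
        + (D.β₀ * a₂ ^ 2) • partialInv hC₀ hb (quad K (crit₂ D K) (crit₂ D K))
        + (2 * D.β₀ * (a₁ * a₂)) • partialInv hC₀ hb (quad K (crit₁ D K) (crit₂ D K)) := by
      rw [sa₁, sa₂]
      simp only [hy₀, hw₀, hBdef, bifurcation, map_smul, map_add]
      module
    rw [← e]
    refine main.trans (mul_le_mul_of_nonneg_right ?_ (by positivity))
    exact le_add_of_nonneg_right (by positivity)

end StandingWave
end

/-! ### From Fourier coefficients back to functions of space and time. -/

theorem mainTheorem3 (D : StandingWaveData)
    (hω : 0 < D.ω) (hk₁ : 0 < D.k₁) (hk₂ : 0 < D.k₂) (hτ₁ : 0 < D.τ₁) (hτ₂ : 0 < D.τ₂)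
    (hβ₀ : 0 < D.β₀)
    (hΩ : D.Omega D.β₀ = {(1, 0, D.q), (-1, 0, D.q), (0, 1, D.q), (0, -1, D.q)})
    (hB : D.l₁ * D.l₃ - D.l₂ ^ 2 ≠ 0)
    (s : ℝ) (hs : 2 ≤ s) :
    ∃ μ₀ : ℝ, 0 < μ₀ ∧ ∃ M : ℝ, 0 < M ∧
      ∀ μ : ℝ, |μ| < μ₀ → 0 ≤ D.ampSq₁ μ → 0 ≤ D.ampSq₂ μ →
        ∃ η v₁ v₂ : ℝ → ℝ → ℝ → ℝ,
          (∀ σ₁ σ₂ : ℝ, D.IsStandingWave (D.β₀ + μ) s 0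
            (StandingWaveData.shift σ₁ σ₂ η) (StandingWaveData.shift σ₁ σ₂ v₁)
            (StandingWaveData.shift σ₁ σ₂ v₂)) ∧
          (∀ x₁ x₂ t : ℝ,
            |η x₁ x₂ t - D.surface √(D.ampSq₁ μ) √(D.ampSq₂ μ) x₁ x₂ t|
              ≤ M * |μ| ^ (3 / 2 : ℝ)) ∧
          D.EvenNormLE s
            (fun x₁ x₂ t => η x₁ x₂ t - D.surface √(D.ampSq₁ μ) √(D.ampSq₂ μ) x₁ x₂ t)
            (M * |μ| ^ (3 / 2 : ℝ)) ∧
          D.OddNormLE s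
            (fun x₁ x₂ t => v₁ x₁ x₂ t - D.velocity₁ √(D.ampSq₁ μ) √(D.ampSq₂ μ) x₁ x₂ t)
            (M * |μ|) ∧
          D.OddNormLE s
            (fun x₁ x₂ t => v₂ x₁ x₂ t - D.velocity₂ √(D.ampSq₁ μ) √(D.ampSq₂ μ) x₁ x₂ t)
            (M * |μ|) := by
  have hs0 : 0 ≤ s := by linarith
  -- One weight exponent gives both classical regularity (`K ≥ 3`) and the `H^s` bounds (`K ≥ s`).
  obtain ⟨K, hK, hsK⟩ : ∃ K : ℕ, 3 ≤ K ∧ s ≤ K :=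
    ⟨max 3 ⌈s⌉₊, le_max_left _ _, (Nat.le_ceil s).trans (by exact_mod_cast le_max_right _ _)⟩
  obtain ⟨C₀, hC₀, hb⟩ := StandingWave.exists_invSymbol_bound hω hk₁ hk₂ hτ₁ hτ₂ hβ₀
  obtain ⟨μ₀, hμ₀, M, hM, hsol⟩ :=
    StandingWave.exists_expansion K hω hβ₀ hΩ hk₁ hk₂ hτ₁ hτ₂ hB hC₀ hb
  have hS := StandingWave.sobolevConst_pos D s
  -- The summand `1` covers the pointwise bound, the other the Sobolev norms.
  refine ⟨μ₀, hμ₀, (1 + StandingWave.sobolevConst D s) * M, by positivity, fun μ hμ h₁ h₂ => ?_⟩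
  obtain ⟨U, hU, hU0, hbal, hη, hv⟩ := hsol μ hμ h₁ h₂
  have e3 : |μ| ^ (3 / 2 : ℝ) = √|μ| ^ 3 := by
    rw [Real.sqrt_eq_rpow, ← Real.rpow_natCast, ← Real.rpow_mul (abs_nonneg μ)]
    norm_num
  rw [Real.sq_sqrt (abs_nonneg μ)] at hv
  rw [← e3] at hη
  have hφ₁ := StandingWave.crit₁_mem_symSpace (D := D) K
  have hφ₂ := StandingWave.crit₂_mem_symSpace (D := D) K
  have hT : ∀ {u v : StandingWave.Seq}, u ∈ StandingWave.symSpace K →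
      v ∈ StandingWave.symSpace K → StandingWave.partialInv hC₀ hb (StandingWave.quad K u v)
        ∈ StandingWave.symSpace K := fun hu hv =>
    StandingWave.partialInv_mem_symSpace hC₀ hb (StandingWave.quad_mem_symSpace hu hv)
  have hlead := add_mem (Submodule.smul_mem _ (√(D.ampSq₁ μ)) hφ₁)
    (Submodule.smul_mem _ (√(D.ampSq₂ μ)) hφ₂)
  have hexp := add_mem (add_mem (add_mem hlead
    (Submodule.smul_mem _ (D.β₀ * √(D.ampSq₁ μ) ^ 2) (hT hφ₁ hφ₁)))
    (Submodule.smul_mem _ (D.β₀ * √(D.ampSq₂ μ) ^ 2) (hT hφ₂ hφ₂)))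
    (Submodule.smul_mem _ (2 * D.β₀ * (√(D.ampSq₁ μ) * √(D.ampSq₂ μ))) (hT hφ₁ hφ₂))
  have hle : ∀ {x B : ℝ}, x ≤ M * B → 0 ≤ B →
      StandingWave.sobolevConst D s * x ≤ (1 + StandingWave.sobolevConst D s) * M * B := by
    intro x B hx hB
    have h1 := mul_le_mul_of_nonneg_left hx hS.le
    have h2 : 0 ≤ M * B := by positivity
    linarith
  have hp : 0 ≤ |μ| ^ (3 / 2 : ℝ) := by positivity
  have hsurf : ∀ x₁ x₂ t, StandingWave.field D K StandingWave.comp₀ U x₁ x₂ t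
      - D.surface √(D.ampSq₁ μ) √(D.ampSq₂ μ) x₁ x₂ t
      = StandingWave.field D K StandingWave.comp₀ _ x₁ x₂ t := fun x₁ x₂ t => by
    rw [StandingWave.surface_eq_field K hω hβ₀ hΩ hk₁ hk₂ hτ₁ hτ₂ hC₀ hb,
      ← StandingWave.field_sub StandingWave.abs_comp₀_le]
  refine ⟨StandingWave.field D K StandingWave.comp₀ U, StandingWave.field D K StandingWave.comp₁ U,
    StandingWave.field D K StandingWave.comp₂ U, fun σ₁ σ₂ => ?_, fun x₁ x₂ t => ?_, ?_, ?_, ?_⟩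
  · exact StandingWave.isStandingWave_shift
      (StandingWave.isStandingWave_field hK hs0 hsK hU hU0 hbal.solvesFourier) σ₁ σ₂
  · rw [hsurf]
    refine (StandingWave.abs_field_le StandingWave.abs_comp₀_le _ _ _ _).trans (hη.trans ?_)
    have h2 : 0 ≤ StandingWave.sobolevConst D s * (M * |μ| ^ (3 / 2 : ℝ)) := by positivity
    linarith
  · simp only [hsurf]
    exact StandingWave.evenNormLE_field hs0 hsK (sub_mem hU hexp) (hle hη hp)
  · simp only [StandingWave.velocity₁_eq_field K,
      ← StandingWave.field_sub StandingWave.abs_comp₁_le]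
    exact StandingWave.oddNormLE_field₁ hs0 hsK (sub_mem hU hlead) (hle hv (abs_nonneg μ))
  · simp only [StandingWave.velocity₂_eq_field K,
      ← StandingWave.field_sub StandingWave.abs_comp₂_le]
    exact StandingWave.oddNormLE_field₂ hs0 hsK (sub_mem hU hlead) (hle hv (abs_nonneg μ))
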